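/- Setting. Let $q_o>0$, $q_\pm\in\mathbb C$ with $|q_\pm|=q_o$, and let $\mathbf q:\mathbb R\times\mathbb R\to\mathbb C^3$ be a classical solution ($\mathbf q,\mathbf q_t,\mathbf q_x,\mathbf q_{xx}$ exist and are continuous) of $i\mathbf q_t+\mathbf q_{xx}-2(\|\mathbf q\|^2-q_o^2)\mathbf q=0$. Put $\mathbf q_\pm=(0,0,q_\pm)^T$ and assume $\mathbf q(\cdot,t)-\mathbf q_\pm\in L^1(\mathbb R^\pm)$ for every $t$, and $\mathbf q\to\mathbf q_\pm$, $\mathbf q_x\to0$ as $x\to\pm\infty$, locally uniformly in $t$. Write $k=\frac12(z+q_o^2/z)$, $\lambda=\frac12(z-q_o^2/z)$, $\hat z=q_o^2/z^*$, $J=\mathrm{diag}(1,-1,-1,-1)$, $Q=\begin{pmatrix}0&\mathbf q^\dagger\\ \mathbf q&0\end{pmatrix}$, $Q_\pm$ likewise with $\mathbf q_\pm$, $E_\pm(z)=I-\frac iz JQ_\pm$, $\theta_1=-\lambda x+2k\lambda t$, $\theta_2=kx-(k^2+\lambda^2)t$, $\Theta=\mathrm{diag}(\theta_1,\theta_2,\theta_2,-\theta_1)$.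 For real $z\ne0,\pm q_o$ let $\phi_\pm(x,t,z)$ be the $4\times4$ simultaneous solutions of $\phi_x=(-ikJ+Q)\phi$, $\phi_t=(2ik^2J-iJ(Q_x-Q^2+q_o^2)-2kQ)\phi$ with $\phi_\pm=E_\pm e^{i\Theta}+o(1)$ as $x\to\pm\infty$, and define $A(z)=(a_{ij})$ by $\phi_-=\phi_+A$. $A_{(i_1\dots i_p;k_1\dots k_p)}$ is the minor with rows $i$ and columns $k$, and $A_{[i_1,\dots,i_p]}$ the principal one. A function on the real line is said to extend to a half plane if it is the boundary value, at all real $z\neq 0,\pm q_o$, of an analytic function there, denoted by the same symbol. Then $A_{[1]},A_{[1,2]},A_{[1,2,3]},A_{(1,3;1,2)},A_{(1,2;1,3)}$, $\phi_{-,1}$, $\phi_{+,4}$, $\chi_2^+=A_{[1]}\phi_{-,2}-a_{12}\phi_{-,1}$, $\chi_3^+=A_{[1,2]}\phi_{-,3}-A_{(1,2;1,3)}\phi_{-,2}+A_{(1,2;2,3)}\phi_{-,1}$ extend to $\operatorname{Im}z>0$, and $A_{[4]},A_{[3,4]},A_{[2,3,4]},A_{(2,4;3,4)},A_{(3,4;2,4)}$,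 $\phi_{+,1}$, $\phi_{-,4}$, $\chi_2^-=A_{[3,4]}\phi_{-,2}-A_{(3,4;2,4)}\phi_{-,3}+A_{(3,4;2,3)}\phi_{-,4}$, $\chi_3^-=A_{[4]}\phi_{-,3}-a_{43}\phi_{-,4}$ extend to $\operatorname{Im}z<0$. Define $$M^+=\Big(\tfrac{\phi_{-,1}}{A_{[1]}},\ \tfrac1{A_{[1,2]}}\big(\chi_2^+-\tfrac{A_{(1,3;1,2)}}{A_{[1,2,3]}}\chi_3^+\big),\ \tfrac{\chi_3^+}{A_{[1,2,3]}},\ \phi_{+,4}\Big)e^{-i\Theta}\quad(\operatorname{Im}z>0),$$ $$M^-=\Big(\phi_{+,1},\ \tfrac{\chi_2^-}{A_{[2,3,4]}},\ \tfrac1{A_{[3,4]}}\big(\chi_3^--\tfrac{A_{(2,4;3,4)}}{A_{[2,3,4]}}\chi_2^-\big),\ \tfrac{\phi_{-,4}}{A_{[4]}}\Big)e^{-i\Theta}\quad(\operatorname{Im}z<0),$$ with columns $M_j^\pm$. Assume the analytic non-principal minors $A_{(1,3;1,2)},A_{(1,2;1,3)},A_{(2,4;3,4)},A_{(3,4;2,4)}$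 vanish identically. Lemma. (Type I.) Let $z_n$, $\operatorname{Im}z_n>0$, be a simple zero of $A_{[1]}$ with $A_{[1,2]}(z_n)\ne0$ and $A_{[1,2,3]}(z_n)\neq0$. Then there are constants $d_n,\check d_n,\bar d_n,\hat d_n\in\mathbb C$, independent of $(x,t)$, such that for all $(x,t)$ $$\phi_{-,1}(z_n)=\tfrac{d_n}{A_{[1,2]}(z_n)}\chi_2^+(z_n),\quad \phi_{-,4}(\hat z_n^*)=\check d_n\chi_2^-(\hat z_n^*),\quad \chi_2^-(z_n^*)=\bar d_n\phi_{+,1}(z_n^*),\quad \chi_2^+(\hat z_n)=\hat d_n\phi_{+,4}(\hat z_n),$$ and $M^+$ has simple poles at $z_n,\hat z_n$ and $M^-$ at $z_n^*,\hat z_n^*$, with (nonzero) residues $$\operatorname{Res}_{z_n}M^+=(D_nM_2^+(z_n),0,0,0),\quad \operatorname{Res}_{\hat z_n}M^+=(0,\hat D_nM_4^+(\hat z_n),0,0),$$ $$\operatorname{Res}_{z_n^*}M^-=(0,\bar D_nM_1^-(z_n^*),0,0),\quad \operatorname{Res}_{\hat z_n^*}M^-=(0,0,0,\check D_nM_2^-(\hat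 z_n^*)),$$ $$D_n=\tfrac{d_n}{A_{[1]}'(z_n)}e^{-i(\theta_1-\theta_2)(x,t,z_n)},\quad \check D_n=\tfrac{\check d_nA_{[2,3,4]}(\hat z_n^*)}{A_{[4]}'(\hat z_n^*)}e^{-i(\theta_1-\theta_2)(x,t,z_n)},$$ $$\bar D_n=\tfrac{\bar d_n}{A_{[2,3,4]}'(z_n^*)}e^{i(\theta_1-\theta_2)(x,t,z_n^*)},\quad \hat D_n=\tfrac{\hat d_n}{A_{[1,2]}'(\hat z_n)}e^{i(\theta_1-\theta_2)(x,t,z_n^*)}.$$ (Type IV.) Let $w_n$, $\operatorname{Im}w_n>0$, be a simple zero of $A_{[1]}$ with $A_{[1,2]}(w_n)=0$ and $A_{[1,2,3]}(w_n)\neq0$. Then there are constants $c_n,\check c_n,\bar c_n,\hat c_n\in\mathbb C$, independent of $(x,t)$, such that for all $(x,t)$ $$\phi_{-,1}(w_n)=\tfrac{c_n}{A_{[1,2,3]}(w_n)}\chi_3^+(w_n),\quad \phi_{-,4}(\hat w_n^*)=\check c_n\chi_3^-(\hat w_n^*),\quad \chi_3^-(w_n^*)=\bar c_n\phi_{+,1}(w_n^*),\quad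 \chi_3^+(\hat w_n)=\hat c_n\phi_{+,4}(\hat w_n),$$ and $M^+$ has simple poles at $w_n,\hat w_n$ and $M^-$ at $w_n^*,\hat w_n^*$, with (nonzero) residues $$\operatorname{Res}_{w_n}M^+=(C_nM_3^+(w_n),0,0,0),\quad \operatorname{Res}_{\hat w_n}M^+=(0,0,\hat C_nM_4^+(\hat w_n),0),$$ $$\operatorname{Res}_{w_n^*}M^-=(0,0,\bar C_nM_1^-(w_n^*),0),\quad \operatorname{Res}_{\hat w_n^*}M^-=(0,0,0,\check C_nM_3^-(\hat w_n^*)),$$ $$C_n=\tfrac{c_n}{A_{[1]}'(w_n)}e^{-i(\theta_1-\theta_2)(x,t,w_n)},\quad \check C_n=\tfrac{\check c_nA_{[3,4]}(\hat w_n^*)}{A_{[4]}'(\hat w_n^*)}e^{-i(\theta_1-\theta_2)(x,t,w_n)},$$ $$\bar C_n=\tfrac{\bar c_n}{A_{[3,4]}'(w_n^*)}e^{i(\theta_1-\theta_2)(x,t,w_n^*)},\quad \hat C_n=\tfrac{\hat c_n}{A_{[1,2,3]}'(\hat w_n)}e^{i(\theta_1-\theta_2)(x,t,w_n^*)}.$$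 -/

import Mathlib

open Filter Topology MeasureTheory

namespace VNLS

noncomputable section

/-- `4 × 4` complex matrices. Indices `0, 1, 2, 3` stand for the mathematical `1, 2, 3, 4`. -/
abbrev Mat4 := Matrix (Fin 4) (Fin 4) ℂ

/-! ### The equation and its boundary conditions -/

/-- Partial derivative with respect to the first variable `x`. -/
def dx (u : ℝ → ℝ → Fin 3 → ℂ) (x t : ℝ) : Fin 3 → ℂ := deriv (fun y => u y t) x

/-- Partial derivative with respect to the second variable `t`. -/
def dt (u : ℝ → ℝ → Fin 3 → ℂ) (x t : ℝ) : Fin 3 → ℂ := deriv (fun s => u x s) t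

/-- A three-component potential `q(x,t)` together with its background data: the amplitude `q_o`
and the two complex numbers `q_±`, the boundary vectors being `(0, 0, q_±)`. -/
structure Potential where
  q0 : ℝ
  qm : ℂ
  qp : ℂ
  q : ℝ → ℝ → Fin 3 → ℂ

/-- `q` is a classical solution of the defocusing three-component equation
`i q_t + q_xx - 2 (‖q‖² - q_o²) q = 0`. -/
structure Potential.IsSolution (P : Potential) : Prop where
  differentiable_t : ∀ x t, DifferentiableAt ℝ (fun s => P.q x s) t
  differentiable_x : ∀ x t, DifferentiableAt ℝ (fun y => P.q y t) x
  differentiable_xx : ∀ x t, DifferentiableAt ℝ (fun y => dx P.q y t) x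
  continuous_q : Continuous fun p : ℝ × ℝ => P.q p.1 p.2
  continuous_t : Continuous fun p : ℝ × ℝ => dt P.q p.1 p.2
  continuous_x : Continuous fun p : ℝ × ℝ => dx P.q p.1 p.2
  continuous_xx : Continuous fun p : ℝ × ℝ => dx (dx P.q) p.1 p.2
  equation : ∀ x t j,
    Complex.I * dt P.q x t j + dx (dx P.q) x t j
      - 2 * (((∑ i, ‖P.q x t i‖ ^ 2 - P.q0 ^ 2 : ℝ)) : ℂ) * P.q x t j = 0

/-- Nonzero boundary conditions: `q → (0,0,q_±)` as `x → ±∞`, with `|q_±| = q_o > 0`, the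
differences being integrable at `±∞` for every `t`; convergence of `q` and `q_x → 0` are locally
uniform in `t`. -/
structure Potential.HasNZBC (P : Potential) : Prop where
  q0_pos : 0 < P.q0
  norm_qm : ‖P.qm‖ = P.q0
  norm_qp : ‖P.qp‖ = P.q0
  integrable_left : ∀ t, IntegrableOn (fun x => P.q x t - ![0, 0, P.qm]) (Set.Iic 0)
  integrable_right : ∀ t, IntegrableOn (fun x => P.q x t - ![0, 0, P.qp]) (Set.Ici 0)
  tendsto_left : TendstoLocallyUniformly (fun x t => P.q x t) (fun _ => ![0, 0, P.qm]) atBot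
  tendsto_right : TendstoLocallyUniformly (fun x t => P.q x t) (fun _ => ![0, 0, P.qp]) atTop
  tendsto_dx_left : TendstoLocallyUniformly (fun x t => dx P.q x t) (fun _ => 0) atBot
  tendsto_dx_right : TendstoLocallyUniformly (fun x t => dx P.q x t) (fun _ => 0) atTop

/-! ### The Lax pair -/

/-- `J = diag(1, -1, -1, -1)`. -/
def J : Mat4 := Matrix.diagonal ![1, -1, -1, -1]

/-- The matrix `Q` with first row `(0, q^†)` and first column `(0, q)^T`. -/
def Qmat (v : Fin 3 → ℂ) : Mat4 :=
  !![0, star (v 0), star (v 1), star (v 2);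
     v 0, 0, 0, 0;
     v 1, 0, 0, 0;
     v 2, 0, 0, 0]

/-- `k = (z + q_o²/z) / 2`. -/
def Potential.k (P : Potential) (z : ℂ) : ℂ := (z + (P.q0 : ℂ) ^ 2 / z) / 2

/-- `λ = (z - q_o²/z) / 2`. -/
def Potential.lam (P : Potential) (z : ℂ) : ℂ := (z - (P.q0 : ℂ) ^ 2 / z) / 2

/-- `X = -i k J + Q`. -/
def Potential.X (P : Potential) (x t : ℝ) (z : ℂ) : Mat4 :=
  -(Complex.I * P.k z) • J + Qmat (P.q x t)

/-- `T = 2 i k² J - i J (Q_x - Q² + q_o²) - 2 k Q`. -/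
def Potential.T (P : Potential) (x t : ℝ) (z : ℂ) : Mat4 :=
  (2 * Complex.I * P.k z ^ 2) • J
    - Complex.I • (J * (Qmat (dx P.q x t) - Qmat (P.q x t) ^ 2 + ((P.q0 : ℂ) ^ 2) • (1 : Mat4)))
    - (2 * P.k z) • Qmat (P.q x t)

/-- `θ₁ = -λ x + 2 k λ t`. -/
def Potential.θ₁ (P : Potential) (x t : ℝ) (z : ℂ) : ℂ :=
  -P.lam z * x + 2 * P.k z * P.lam z * t

/-- `θ₂ = k x - (k² + λ²) t`. -/
def Potential.θ₂ (P : Potential) (x t : ℝ) (z : ℂ) : ℂ :=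
  P.k z * x - (P.k z ^ 2 + P.lam z ^ 2) * t

/-- The diagonal of `Θ = diag(θ₁, θ₂, θ₂, -θ₁)`. -/
def Potential.Θ (P : Potential) (x t : ℝ) (z : ℂ) : Fin 4 → ℂ :=
  ![P.θ₁ x t z, P.θ₂ x t z, P.θ₂ x t z, -P.θ₁ x t z]

/-- The eigenvector matrix `E_±(z) = I - (i/z) J Q_±` of the limiting Lax pair, where `Q_±` is
built from the boundary vector `(0, 0, q_±)`. -/
def E (qb z : ℂ) : Mat4 := 1 - (Complex.I / z) • (J * Qmat ![0, 0, qb])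

/-! ### Jost eigenfunctions and the scattering matrix on the continuous spectrum -/

/-- `Φ` is a simultaneous matrix solution of both parts `φ_x = X φ`, `φ_t = T φ` of the Lax pair
at the real spectral parameter `s`, and `Φ = E e^{iΘ} + o(1)` in the limit `l` of `x`. -/
structure Potential.IsJost (P : Potential) (l : Filter ℝ) (qb : ℂ) (s : ℝ)
    (Φ : ℝ → ℝ → Mat4) : Prop where
  x_part : ∀ x t i j, HasDerivAt (fun y => Φ y t i j) ((P.X x t s * Φ x t) i j) x
  t_part : ∀ x t i j, HasDerivAt (fun r => Φ x r i j) ((P.T x t s * Φ x t) i j) t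
  asymp : ∀ t i j, Tendsto
    (fun x => Φ x t i j -
      (E qb s * Matrix.diagonal fun a => Complex.exp (Complex.I * P.Θ x t s a)) i j) l (𝓝 0)

open Classical in
/-- The Jost eigenfunction matrix `φ_-(x,t,s)`, normalized as `x → -∞`. -/
def Potential.φm (P : Potential) (x t s : ℝ) : Mat4 :=
  if h : ∃ Φ, P.IsJost atBot P.qm s Φ then h.choose x t else 0

open Classical in
/-- The Jost eigenfunction matrix `φ_+(x,t,s)`, normalized as `x → +∞`. -/
def Potential.φp (P : Potential) (x t s : ℝ) : Mat4 :=
  if h : ∃ Φ, P.IsJost atTop P.qp s Φ then h.choose x t else 0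

/-- The scattering matrix `A(s)`, `φ_-(x,t,s) = φ_+(x,t,s) A(s)`. (It does not depend on the point
`(x,t)` used to compute it, since both sides solve the same Lax pair.) -/
def Potential.A (P : Potential) (s : ℝ) : Mat4 := (P.φp 0 0 s)⁻¹ * P.φm 0 0 s

/-- The minor `A_{(rows; cols)}(s)` of the scattering matrix. -/
def Potential.minor (P : Potential) {p : ℕ} (rows cols : Fin p → Fin 4) (s : ℝ) : ℂ :=
  ((P.A s).submatrix rows cols).det

/-! ### Analytic extension off the continuous spectrum -/

/-- The upper half plane. -/
def upper : Set ℂ := {z | 0 < z.im}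

/-- The lower half plane. -/
def lower : Set ℂ := {z | z.im < 0}

/-- `f` is analytic in the half plane `U` and has the boundary values `g(s)` at all real `s` other
than `0` and the branch points `±q_o`. Such an `f` is unique on `U`. -/
def IsAnalyticExtension {V : Type} [NormedAddCommGroup V] [NormedSpace ℂ V]
    (U : Set ℂ) (q0 : ℝ) (g : ℝ → V) (f : ℂ → V) : Prop :=
  DifferentiableOn ℂ f U ∧
    ∀ s : ℝ, s ≠ 0 → s ≠ q0 → s ≠ -q0 → Tendsto f (𝓝[U] (s : ℂ)) (𝓝 (g s))

open Classical in
/-- The analytic extension to `U` of a function `g` on the continuous spectrum. -/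
def analyticExt {V : Type} [NormedAddCommGroup V] [NormedSpace ℂ V]
    (U : Set ℂ) (q0 : ℝ) (g : ℝ → V) : ℂ → V :=
  if h : ∃ f, IsAnalyticExtension U q0 g f then h.choose else 0

/-- Extension to the upper half plane of the minor `A_{(rows; cols)}`. -/
def Potential.minorUp (P : Potential) {p : ℕ} (rows cols : Fin p → Fin 4) : ℂ → ℂ :=
  analyticExt upper P.q0 (P.minor rows cols)

/-- Extension to the lower half plane of the minor `A_{(rows; cols)}`. -/
def Potential.minorLow (P : Potential) {p : ℕ} (rows cols : Fin p → Fin 4) : ℂ → ℂ :=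
  analyticExt lower P.q0 (P.minor rows cols)

/-- `A_{[1]}`, analytic in the upper half plane. -/
def Potential.A1 (P : Potential) : ℂ → ℂ := P.minorUp ![0] ![0]
/-- `A_{[1,2]}`, analytic in the upper half plane. -/
def Potential.A12 (P : Potential) : ℂ → ℂ := P.minorUp ![0, 1] ![0, 1]
/-- `A_{[1,2,3]}`, analytic in the upper half plane. -/
def Potential.A123 (P : Potential) : ℂ → ℂ := P.minorUp ![0, 1, 2] ![0, 1, 2]
/-- `A_{(1,3; 1,2)}`, analytic in the upper half plane. -/
def Potential.A13_12 (P : Potential) : ℂ → ℂ := P.minorUp ![0, 2] ![0, 1]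
/-- `A_{(1,2; 1,3)}`, analytic in the upper half plane. -/
def Potential.A12_13 (P : Potential) : ℂ → ℂ := P.minorUp ![0, 1] ![0, 2]
/-- `A_{[4]}`, analytic in the lower half plane. -/
def Potential.A4 (P : Potential) : ℂ → ℂ := P.minorLow ![3] ![3]
/-- `A_{[3,4]}`, analytic in the lower half plane. -/
def Potential.A34 (P : Potential) : ℂ → ℂ := P.minorLow ![2, 3] ![2, 3]
/-- `A_{[2,3,4]}`, analytic in the lower half plane. -/
def Potential.A234 (P : Potential) : ℂ → ℂ := P.minorLow ![1, 2, 3] ![1, 2, 3]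
/-- `A_{(2,4; 3,4)}`, analytic in the lower half plane. -/
def Potential.A24_34 (P : Potential) : ℂ → ℂ := P.minorLow ![1, 3] ![2, 3]
/-- `A_{(3,4; 2,4)}`, analytic in the lower half plane. -/
def Potential.A34_24 (P : Potential) : ℂ → ℂ := P.minorLow ![2, 3] ![1, 3]

/-- The four analytic non-principal minors are identically zero. -/
def Potential.NonPrincipalMinorsVanish (P : Potential) : Prop :=
  (∀ z ∈ upper, P.A13_12 z = 0 ∧ P.A12_13 z = 0) ∧
    ∀ z ∈ lower, P.A24_34 z = 0 ∧ P.A34_24 z = 0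

/-- `φ_{-,1}`, analytic in the upper half plane. -/
def Potential.φm1 (P : Potential) (x t : ℝ) : ℂ → Fin 4 → ℂ :=
  analyticExt upper P.q0 fun s => (P.φm x t s).col 0

/-- `φ_{+,4}`, analytic in the upper half plane. -/
def Potential.φp4 (P : Potential) (x t : ℝ) : ℂ → Fin 4 → ℂ :=
  analyticExt upper P.q0 fun s => (P.φp x t s).col 3

/-- `φ_{+,1}`, analytic in the lower half plane. -/
def Potential.φp1 (P : Potential) (x t : ℝ) : ℂ → Fin 4 → ℂ :=
  analyticExt lower P.q0 fun s => (P.φp x t s).col 0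

/-- `φ_{-,4}`, analytic in the lower half plane. -/
def Potential.φm4 (P : Potential) (x t : ℝ) : ℂ → Fin 4 → ℂ :=
  analyticExt lower P.q0 fun s => (P.φm x t s).col 3

/-- The auxiliary eigenfunction `χ₂⁺ = A_{[1]} φ_{-,2} - a₁₂ φ_{-,1}`, analytic in the upper half
plane. -/
def Potential.χp2 (P : Potential) (x t : ℝ) : ℂ → Fin 4 → ℂ :=
  analyticExt upper P.q0 fun s =>
    P.minor ![0] ![0] s • (P.φm x t s).col 1 - P.minor ![0] ![1] s • (P.φm x t s).col 0

/-- The auxiliary eigenfunction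
`χ₃⁺ = A_{[1,2]} φ_{-,3} - A_{(1,2;1,3)} φ_{-,2} + A_{(1,2;2,3)} φ_{-,1}`, analytic in the upper
half plane. -/
def Potential.χp3 (P : Potential) (x t : ℝ) : ℂ → Fin 4 → ℂ :=
  analyticExt upper P.q0 fun s =>
    P.minor ![0, 1] ![0, 1] s • (P.φm x t s).col 2
      - P.minor ![0, 1] ![0, 2] s • (P.φm x t s).col 1
      + P.minor ![0, 1] ![1, 2] s • (P.φm x t s).col 0

/-- The auxiliary eigenfunction
`χ₂⁻ = A_{[3,4]} φ_{-,2} - A_{(3,4;2,4)} φ_{-,3} + A_{(3,4;2,3)} φ_{-,4}`, analytic in the lower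
half plane. -/
def Potential.χm2 (P : Potential) (x t : ℝ) : ℂ → Fin 4 → ℂ :=
  analyticExt lower P.q0 fun s =>
    P.minor ![2, 3] ![2, 3] s • (P.φm x t s).col 1
      - P.minor ![2, 3] ![1, 3] s • (P.φm x t s).col 2
      + P.minor ![2, 3] ![1, 2] s • (P.φm x t s).col 3

/-- The auxiliary eigenfunction `χ₃⁻ = A_{[4]} φ_{-,3} - a₄₃ φ_{-,4}`, analytic in the lower half
plane. -/
def Potential.χm3 (P : Potential) (x t : ℝ) : ℂ → Fin 4 → ℂ :=
  analyticExt lower P.q0 fun s =>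
    P.minor ![3] ![3] s • (P.φm x t s).col 2 - P.minor ![3] ![2] s • (P.φm x t s).col 3

/-! ### The meromorphic matrices -/

/-- `e^{-iΘ(x,t,z)}`. -/
def Potential.expNegΘ (P : Potential) (x t : ℝ) (z : ℂ) : Mat4 :=
  Matrix.diagonal fun j => Complex.exp (-Complex.I * P.Θ x t z j)

/-- The meromorphic matrix `M⁺(x,t,z)`, `Im z > 0`. -/
def Potential.Mp (P : Potential) (x t : ℝ) (z : ℂ) : Mat4 :=
  (Matrix.of ![
    (P.A1 z)⁻¹ • P.φm1 x t z,
    (P.A12 z)⁻¹ • (P.χp2 x t z - (P.A13_12 z / P.A123 z) • P.χp3 x t z),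
    (P.A123 z)⁻¹ • P.χp3 x t z,
    P.φp4 x t z]).transpose * P.expNegΘ x t z

/-- The meromorphic matrix `M⁻(x,t,z)`, `Im z < 0`. -/
def Potential.Mm (P : Potential) (x t : ℝ) (z : ℂ) : Mat4 :=
  (Matrix.of ![
    P.φp1 x t z,
    (P.A234 z)⁻¹ • P.χm2 x t z,
    (P.A34 z)⁻¹ • (P.χm3 x t z - (P.A24_34 z / P.A234 z) • P.χm2 x t z),
    (P.A4 z)⁻¹ • P.φm4 x t z]).transpose * P.expNegΘ x t z

/-! ### Discrete eigenvalues and residues -/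

/-- `ẑ = q_o² / z^*`. -/
def Potential.hat (P : Potential) (z : ℂ) : ℂ := (P.q0 : ℂ) ^ 2 / star z

/-- `z` is a discrete eigenvalue of type I: a simple zero of `A_{[1]}` in the upper half plane
which is a zero of neither `A_{[1,2]}` nor `A_{[1,2,3]}`. -/
def Potential.IsTypeI (P : Potential) (z : ℂ) : Prop :=
  z ∈ upper ∧ P.A1 z = 0 ∧ deriv P.A1 z ≠ 0 ∧ P.A12 z ≠ 0 ∧ P.A123 z ≠ 0

/-- `w` is a discrete eigenvalue of type IV: a simple zero of `A_{[1]}` in the upper half plane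
which is a zero of `A_{[1,2]}` but not of `A_{[1,2,3]}`. -/
def Potential.IsTypeIV (P : Potential) (w : ℂ) : Prop :=
  w ∈ upper ∧ P.A1 w = 0 ∧ deriv P.A1 w ≠ 0 ∧ P.A12 w = 0 ∧ P.A123 w ≠ 0

/-- The matrix whose column `c` is `v` and whose other columns vanish. -/
def singleCol (c : Fin 4) (v : Fin 4 → ℂ) : Mat4 := Matrix.of fun i j => if j = c then v i else 0

/-- `F` has a simple pole at `z₀` with (nonzero) residue `R`. -/
def HasSimplePole (F : ℂ → Mat4) (z₀ : ℂ) (R : Mat4) : Prop :=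
  R ≠ 0 ∧ ∀ i j, ∃ g : ℂ → ℂ, AnalyticAt ℂ g z₀ ∧
    ∀ᶠ z in 𝓝[≠] z₀, F z i j = R i j / (z - z₀) + g z

/-- `e^{-i(θ₁-θ₂)(x,t,z)}`. -/
def Potential.expm (P : Potential) (x t : ℝ) (z : ℂ) : ℂ :=
  Complex.exp (-Complex.I * (P.θ₁ x t z - P.θ₂ x t z))

/-- `e^{i(θ₁-θ₂)(x,t,z)}`. -/
def Potential.expp (P : Potential) (x t : ℝ) (z : ℂ) : ℂ :=
  Complex.exp (Complex.I * (P.θ₁ x t z - P.θ₂ x t z))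

/-- `d, ď, d̄, d̂` are norming constants of the type I eigenvalue `z`. -/
structure Potential.NormingI (P : Potential) (z d dcheck dbar dhat : ℂ) : Prop where
  main : ∀ x t, P.φm1 x t z = (d / P.A12 z) • P.χp2 x t z
  check : ∀ x t, P.φm4 x t (star (P.hat z)) = dcheck • P.χm2 x t (star (P.hat z))
  bar : ∀ x t, P.χm2 x t (star z) = dbar • P.φp1 x t (star z)
  hat : ∀ x t, P.χp2 x t (P.hat z) = dhat • P.φp4 x t (P.hat z)

/-- `c, č, c̄, ĉ` are norming constants of the type IV eigenvalue `w`. -/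
structure Potential.NormingIV (P : Potential) (w c ccheck cbar chat : ℂ) : Prop where
  main : ∀ x t, P.φm1 x t w = (c / P.A123 w) • P.χp3 x t w
  check : ∀ x t, P.φm4 x t (star (P.hat w)) = ccheck • P.χm3 x t (star (P.hat w))
  bar : ∀ x t, P.χm3 x t (star w) = cbar • P.φp1 x t (star w)
  hat : ∀ x t, P.χp3 x t (P.hat w) = chat • P.φp4 x t (P.hat w)

end

end VNLS

/-!
Everything is reduced to the base point `(x, t) = (0, 0)`. By the zero curvature equation
(`zero_curvature`) the Lax pair has a simultaneous fundamental solution `G x t k` with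
`G 0 0 k = 1`, which is invertible and entire in `k`; every eigenfunction at `(x, t)` is `G x t k`
applied to its value at `(0, 0)`. A linear relation with constant coefficients between
eigenfunctions therefore holds for all `(x, t)` as soon as it holds at the base point, and this is
why the norming constants do not depend on `(x, t)`.

*Analyticity.* In the basis `E_±` of asymptotic eigenvectors the `x`-equation is an integrable
perturbation of a diagonal system. A column along which the growth rate is extreme, relative to
which all other components are neutral or damped, is obtained as the locally uniform limit of
solutions that agree with the free solution far away (`Damped.Family.exists_limit`). In the closed
upper half plane this applies to `φ_{-,1}` and `φ_{+,4}`, and, since the same equation is induced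
on bivectors, to `φ_{-,1} ∧ φ_{-,m}` and `φ_{+,m} ∧ φ_{+,4}` for `m = 2, 3`. The limits are
continuous up to the real line, analytic inside, and vanish nowhere (`exists_col_limit`,
`exists_wedge_limit`). On the real line `φ_±^† J φ_± = diag(γ, -1, -1, -γ)`, and this makes the
minors of `A` and the auxiliary eigenfunctions polynomial in these limits and in the complex
conjugates of `φ_{+,1}` and `φ_{-,4}`. The latter are extended by the symmetry `z ↦ q_o² / z`,
which interchanges first and fourth columns (`V_hat`), so everything extends to the upper half
plane; the same symmetry yields the extensions to the lower half plane. An extension is determined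
by its boundary values (`eqOn_zero_of_boundary`), so the extensions constructed here
(`exists_upperData`) are the ones in the statement, and algebraic identities on the real line
persist in the half plane.

*Zeros.* Write `a = φ_{-,1}`, `b = φ_{+,4}`, `p₁ = A_{[1]}`, `p₃ = A_{[1,2,3]}`, and `p^m` for the
principal minor with rows and columns `1, m`, where `m = 2, 3` and `m'` is the other of the two.
There are vectors `χ^m` and `ψ^m` such that
`χ₂⁺ = χ²`, `χ₃⁺ = ψ³`, while `χ₂⁻`, `χ₃⁻` are the pull-backs of `ψ²`, `χ³` under `z ↦ q_o² / z`.
If the non-principal minors vanish, then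
`p^m p^{m'} = p₁ p₃`, `p₁ ψ^m = p^{m'} χ^m`, `p₃ χ^m = p^m ψ^m`.
Moreover `a ∧ χ^m` is `p₁` times a nowhere vanishing bivector, and `ψ^m ∧ b` is `p₃` times one, so
`p₁ = 0` makes `a` parallel to `χ^m`, and `p₃ = 0` makes `ψ^m` parallel to `b`. Finally
`p₃(z)` and `p^m(z)` are constant multiples of the complex conjugates of `p₁(ẑ)` and `p^{m'}(ẑ)`.

The two types of eigenvalues are now the same situation for `m = 2` and `m = 3`: at a simple zero
`z` of `p₁` with `p₃(z) ≠ 0`, the product `p^m p^{m'}` has a simple zero, so exactly one of the two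
factors vanishes, and it does so simply; `m` is chosen with `p^m(z) ≠ 0`
(`UpperData.IsSimpleZero`). Proportionality of the eigenfunctions follows from the wedge products,
and each residue is that of a quotient with a simple zero in the denominator. The other columns of
`M^±` have removable singularities, because by the relations above each can be rewritten as a
quotient whose denominator does not vanish.
-/

/-! ### Linear differential equations in a Banach algebra, with parameters -/

set_option linter.unusedSectionVars false

namespace LinearODE

variable {𝔸 : Type*} [NormedRing 𝔸] [NormedAlgebra ℝ 𝔸] [CompleteSpace 𝔸]
  {T : Type*} [TopologicalSpace T]

/-- The Picard iterates of `Y' = N Y`, `Y(0) = 1`, where `N` depends on a parameter `τ`. -/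
noncomputable def picard (N : ℝ → T → 𝔸) : ℕ → ℝ → T → 𝔸
  | 0 => fun _ _ => 1
  | n + 1 => fun x τ => ∫ y in (0 : ℝ)..x, N y τ * picard N n y τ

theorem continuous_picard {N : ℝ → T → 𝔸} (hN : Continuous fun p : ℝ × T => N p.1 p.2) (n : ℕ) :
    Continuous fun p : ℝ × T => picard N n p.1 p.2 := by
  induction n with
  | zero => exact continuous_const
  | succ n ih =>
    have h : Continuous (Function.uncurry fun (p : ℝ × T) (y : ℝ) =>
        N y p.2 * picard N n y p.2) := by
      have e : Continuous fun p : (ℝ × T) × ℝ => ((p.2, p.1.2) : ℝ × T) := by fun_prop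
      exact (hN.comp e).mul (ih.comp e)
    exact intervalIntegral.continuous_parametric_intervalIntegral_of_continuous h continuous_fst

theorem hasDerivAt_picard_succ {N : ℝ → T → 𝔸}
    (hN : Continuous fun p : ℝ × T => N p.1 p.2) (n : ℕ) (x : ℝ) (τ : T) :
    HasDerivAt (fun y => picard N (n + 1) y τ) (N x τ * picard N n x τ) x := by
  have e : Continuous fun y : ℝ => ((y, τ) : ℝ × T) := by fun_prop
  have h : Continuous fun y => N y τ * picard N n y τ :=
    (hN.comp e).mul ((continuous_picard hN n).comp e)
  exact intervalIntegral.integral_hasDerivAt_right (h.intervalIntegrable _ _)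
    h.stronglyMeasurable.stronglyMeasurableAtFilter h.continuousAt

/-- The factorial bound behind the convergence of the Picard series. -/
theorem norm_picard_le {N : ℝ → T → 𝔸} {τ : T}
    {R M : ℝ} (hM : ∀ y, |y| ≤ R → ‖N y τ‖ ≤ M) (n : ℕ) :
    ∀ x, |x| ≤ R → ‖picard N n x τ‖ ≤ ‖(1 : 𝔸)‖ * (M ^ n * (|x| ^ n / n.factorial)) := by
  induction n with
  | zero => intro x _; simp [picard]
  | succ n ih =>
    intro x hx
    have hM0 : 0 ≤ M := (norm_nonneg _).trans (hM 0 (by simpa using (abs_nonneg x).trans hx))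
    have hb : ∀ y ∈ Set.uIoc 0 x, ‖N y τ * picard N n y τ‖ ≤
        (‖(1 : 𝔸)‖ * M ^ (n + 1) / n.factorial) * |y - 0| ^ n := by
      intro y hy
      have hyx : |y| ≤ |x| := by
        rcases Set.mem_uIoc.1 hy with h | h
        · rw [abs_of_pos h.1, abs_of_pos (h.1.trans_le h.2)]; exact h.2
        · rw [abs_of_nonpos h.2, abs_of_neg (h.1.trans_le h.2)]; linarith [h.1]
      calc ‖N y τ * picard N n y τ‖ ≤ ‖N y τ‖ * ‖picard N n y τ‖ := norm_mul_le _ _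
        _ ≤ M * (‖(1 : 𝔸)‖ * (M ^ n * (|y| ^ n / n.factorial))) := by
          gcongr
          · exact hM y (hyx.trans hx)
          · exact ih y (hyx.trans hx)
        _ = _ := by rw [sub_zero]; ring
    rw [picard, intervalIntegral.norm_intervalIntegral_eq]
    calc _ ≤ ∫ y in Set.uIoc 0 x, (‖(1 : 𝔸)‖ * M ^ (n + 1) / n.factorial) * |y - 0| ^ n := by
          apply norm_integral_le_of_norm_le
          · apply Continuous.integrableOn_uIoc; fun_prop
          · exact (ae_restrict_iff' measurableSet_uIoc).2 (Eventually.of_forall hb)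
      _ = _ := by
          rw [integral_const_mul, integral_pow_abs_sub_uIoc, Nat.factorial_succ]
          push_cast
          field_simp
          simp

/-- The fundamental solution of `Y' = N Y`, normalized by `Y(0) = 1`. -/
noncomputable def fund (N : ℝ → T → 𝔸) (x : ℝ) (τ : T) : 𝔸 := ∑' n, picard N n x τ

theorem summable_bound (C M R : ℝ) :
    Summable fun n : ℕ => C * (M ^ n * (R ^ n / n.factorial)) := by
  have := (Real.summable_pow_div_factorial (M * R)).mul_left C
  refine this.congr fun n => ?_
  rw [mul_pow]; ring

theorem exists_local_bound {N : ℝ → T → 𝔸} (hN : Continuous fun p : ℝ × T => N p.1 p.2)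
    (R : ℝ) (τ : T) : ∃ M, 0 ≤ M ∧ ∀ᶠ σ in 𝓝 τ, ∀ y, |y| ≤ R → ‖N y σ‖ ≤ M := by
  obtain ⟨M, hM⟩ := (isCompact_Icc (a := -R) (b := R)).exists_bound_of_continuousOn
    (f := fun y => N y τ)
    (hN.comp (by fun_prop : Continuous fun y : ℝ => ((y, τ) : ℝ × T))).continuousOn
  refine ⟨|M| + 1, by positivity, ?_⟩
  have key : ∀ᶠ σ in 𝓝 τ, ∀ y ∈ Set.Icc (-R) R, ‖N y σ‖ < |M| + 1 := by
    apply (isCompact_Icc (a := -R) (b := R)).eventually_forall_of_forall_eventually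
    intro y hy
    have : ContinuousAt (fun p : T × ℝ => ‖N p.2 p.1‖) (τ, y) :=
      (hN.comp continuous_swap).norm.continuousAt
    apply this.eventually_lt continuousAt_const
    exact lt_of_le_of_lt ((hM y hy).trans (le_abs_self M)) (lt_add_one _)
  filter_upwards [key] with σ h y hy using (h y (abs_le.1 hy)).le

theorem continuous_fund {N : ℝ → T → 𝔸} (hN : Continuous fun p : ℝ × T => N p.1 p.2) :
    Continuous fun p : ℝ × T => fund N p.1 p.2 := by
  rw [continuous_iff_continuousAt]
  rintro ⟨x, τ⟩
  obtain ⟨M, hM0, hM⟩ := exists_local_bound hN (|x| + 1) τ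
  obtain ⟨U, hU, hUo, hτ⟩ := eventually_nhds_iff.1 hM
  have hball : Metric.ball x 1 ×ˢ U ∈ 𝓝 (x, τ) :=
    prod_mem_nhds (Metric.ball_mem_nhds x one_pos) (hUo.mem_nhds hτ)
  refine ContinuousOn.continuousAt (s := Metric.ball x 1 ×ˢ U) ?_ hball
  refine continuousOn_tsum (fun n => (continuous_picard hN n).continuousOn)
    (summable_bound ‖(1 : 𝔸)‖ M (|x| + 1)) ?_
  rintro n ⟨y, σ⟩ ⟨hy, hσ⟩
  have hy' : |y| ≤ |x| + 1 := by
    have h1 : |y - x| < 1 := by simpa [Real.dist_eq] using hy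
    have := abs_add_le (y - x) x
    rw [sub_add_cancel] at this
    linarith
  refine (norm_picard_le (hU σ hσ) n y hy').trans ?_
  gcongr

/-- The fundamental solution commutes with a change of parameters. -/
theorem fund_comp {T' : Type*} (N : ℝ → T → 𝔸) (f : T' → T) (x : ℝ) (τ : T') :
    fund (fun y σ => N y (f σ)) x τ = fund N x (f τ) := by
  have : ∀ m y, picard (fun y σ => N y (f σ)) m y τ = picard N m y (f τ) := by
    intro m
    induction m with
    | zero => intro y; rfl
    | succ m ih => intro y; simp only [picard, ih]
  simp only [fund, this]

theorem fund_zero (N : ℝ → T → 𝔸) (τ : T) : fund N 0 τ = 1 := by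
  rw [fund, tsum_eq_single 0]
  · rfl
  · intro n hn
    obtain ⟨m, rfl⟩ := Nat.exists_eq_succ_of_ne_zero hn
    simp [picard]

theorem hasDerivAt_fund {N : ℝ → T → 𝔸} (hN : Continuous fun p : ℝ × T => N p.1 p.2)
    (x : ℝ) (τ : T) : HasDerivAt (fun y => fund N y τ) (N x τ * fund N x τ) x := by
  obtain ⟨M, hM0, hM⟩ := exists_local_bound hN (|x| + 1) τ
  have hM := hM.self_of_nhds
  have hb : ∀ y ∈ Metric.ball x 1, |y| ≤ |x| + 1 := by
    intro y hy
    have h1 : |y - x| < 1 := by simpa [Real.dist_eq] using hy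
    have := abs_add_le (y - x) x
    rw [sub_add_cancel] at this
    linarith
  have hs : ∀ y, |y| ≤ |x| + 1 → Summable fun n => picard N n y τ := fun y hy =>
    .of_norm_bounded (summable_bound ‖(1 : 𝔸)‖ M |y|) fun n => norm_picard_le hM n y hy
  have hx : |x| ≤ |x| + 1 := by linarith
  have hs1 : Summable fun n => picard N (n + 1) x τ :=
    (summable_nat_add_iff (f := fun n => picard N n x τ) 1).2 (hs x hx)
  have main : HasDerivAt (fun y => ∑' n, picard N (n + 1) y τ)
      (∑' n, N x τ * picard N n x τ) x := by
    refine hasDerivAt_tsum_of_isPreconnected (t := Metric.ball x 1)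
      (g := fun n y => picard N (n + 1) y τ) (g' := fun n y => N y τ * picard N n y τ)
      (u := fun n => M * (‖(1 : 𝔸)‖ * (M ^ n * ((|x| + 1) ^ n / n.factorial))))
      ((summable_bound ‖(1 : 𝔸)‖ M (|x| + 1)).mul_left M)
      Metric.isOpen_ball (convex_ball x 1).isPreconnected
      (fun n y _ => hasDerivAt_picard_succ hN n y τ) ?_ (Metric.mem_ball_self one_pos)
      hs1 (Metric.mem_ball_self one_pos)
    intro n y hy
    refine (norm_mul_le _ _).trans ?_
    gcongr
    · exact hM y (hb y hy)
    · refine (norm_picard_le hM n y (hb y hy)).trans ?_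
      gcongr
      exact hb y hy
  rw [(hs x hx).tsum_mul_left] at main
  refine (main.const_add (1 : 𝔸)).congr_of_eventuallyEq ?_
  filter_upwards [Metric.ball_mem_nhds x one_pos] with y hy
  rw [fund, (hs y (hb y hy)).tsum_eq_zero_add]
  rfl

end LinearODE

/-! ### Matrix equations: inverses, determinants and parameter derivatives -/


namespace LinearODE

open Matrix

attribute [local instance] Matrix.linftyOpNormedRing Matrix.linftyOpNormedAlgebra

variable {n : Type*} [Fintype n] [DecidableEq n]

theorem hasDerivAt_matrix_iff {𝕜 : Type*} [NontriviallyNormedField 𝕜] [NormedAlgebra 𝕜 ℂ]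
    {F : 𝕜 → Matrix n n ℂ} {F' : Matrix n n ℂ} {x : 𝕜} :
    HasDerivAt F F' x ↔ ∀ i j, HasDerivAt (fun y => F y i j) (F' i j) x := by
  refine (hasDerivAt_pi (φ := F) (φ' := F')).trans (forall_congr' fun i => ?_)
  exact hasDerivAt_pi (φ := fun y => F y i) (φ' := F' i)

theorem hasDerivAt_transpose {F : ℝ → Matrix n n ℂ} {F' : Matrix n n ℂ} {x : ℝ}
    (h : HasDerivAt F F' x) : HasDerivAt (fun y => (F y)ᵀ) F'ᵀ x :=
  hasDerivAt_matrix_iff.2 fun i j => hasDerivAt_matrix_iff.1 h j i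

theorem hasDerivAt_conjTranspose {F : ℝ → Matrix n n ℂ} {F' : Matrix n n ℂ} {x : ℝ}
    (h : HasDerivAt F F' x) : HasDerivAt (fun y => (F y)ᴴ) F'ᴴ x :=
  hasDerivAt_matrix_iff.2 fun i j => (hasDerivAt_matrix_iff.1 h j i).star

theorem matrix_eq_of_deriv_zero {F : ℝ → Matrix n n ℂ} (h : ∀ x, HasDerivAt F 0 x) (x y : ℝ) :
    F x = F y :=
  is_const_of_deriv_eq_zero (fun x => (h x).differentiableAt) (fun x => (h x).deriv) x y

/-- Liouville's formula. -/
theorem hasDerivAt_det {F : ℝ → Matrix n n ℂ} {N : Matrix n n ℂ} {x : ℝ}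
    (h : HasDerivAt F (N * F x) x) : HasDerivAt (fun y => (F y).det) (N.trace * (F x).det) x := by
  have h' := hasDerivAt_matrix_iff.1 h
  have key : ∀ i, ((F x).updateRow i ((N * F x) i)).det = N i i * (F x).det := by
    intro i
    have := det_updateRow_sum (F x) i (fun k => N i k)
    rw [smul_eq_mul] at this
    rw [← this]
    congr 2
    ext j
    simp [Matrix.mul_apply]
  have h1 : HasDerivAt (fun y => ∑ σ : Equiv.Perm n,
        ((Equiv.Perm.sign σ : ℤ) : ℂ) * ∏ i, (F y)ᵀ (σ i) i)
      (∑ σ : Equiv.Perm n, ((Equiv.Perm.sign σ : ℤ) : ℂ) *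
        ∑ i, (∏ j ∈ Finset.univ.erase i, (F x)ᵀ (σ j) j) • (N * F x)ᵀ (σ i) i) x := by
    refine HasDerivAt.fun_sum fun σ _ => HasDerivAt.const_mul _ ?_
    exact HasDerivAt.fun_finsetProd fun i _ => h' i (σ i)
  have e : (fun y => (F y).det) = fun y => ∑ σ : Equiv.Perm n,
        ((Equiv.Perm.sign σ : ℤ) : ℂ) * ∏ i, (F y)ᵀ (σ i) i := by
    funext y
    rw [← det_transpose, det_apply']
  rw [e]
  convert h1 using 1
  rw [Matrix.trace, Finset.sum_mul]
  simp only [Matrix.diag_apply, ← key, Finset.mul_sum]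
  rw [Finset.sum_comm]
  refine Finset.sum_congr rfl fun i _ => ?_
  rw [← det_transpose, det_apply']
  refine Finset.sum_congr rfl fun σ _ => ?_
  rw [← Finset.prod_erase_mul Finset.univ _ (Finset.mem_univ i), smul_eq_mul]
  congr 2
  · refine Finset.prod_congr rfl fun j hj => ?_
    simp [Matrix.updateRow_ne (Finset.ne_of_mem_erase hj)]
  · simp

section

variable {T : Type*} [TopologicalSpace T] {N : ℝ → T → Matrix n n ℂ}

/-- The inverse of the fundamental solution, constructed as the solution of `Z' = -Z N`. -/
noncomputable def fundInv (N : ℝ → T → Matrix n n ℂ) (x : ℝ) (τ : T) : Matrix n n ℂ :=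
  (fund (fun y σ => -(N y σ)ᵀ) x τ)ᵀ

theorem continuous_fundInv (hN : Continuous fun p : ℝ × T => N p.1 p.2) :
    Continuous fun p : ℝ × T => fundInv N p.1 p.2 :=
  (continuous_fund (N := fun y σ => -(N y σ)ᵀ) (hN.matrix_transpose.neg)).matrix_transpose

theorem hasDerivAt_fundInv (hN : Continuous fun p : ℝ × T => N p.1 p.2) (x : ℝ) (τ : T) :
    HasDerivAt (fun y => fundInv N y τ) (-(fundInv N x τ * N x τ)) x := by
  have := hasDerivAt_transpose (hasDerivAt_fund (N := fun y σ => -(N y σ)ᵀ)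
    (hN.matrix_transpose.neg) x τ)
  rw [Matrix.transpose_mul, Matrix.transpose_neg, Matrix.transpose_transpose, Matrix.mul_neg]
    at this
  exact this

theorem fundInv_comp {T' : Type*} (f : T' → T) (x : ℝ) (τ : T') :
    fundInv (fun y σ => N y (f σ)) x τ = fundInv N x (f τ) := by
  rw [fundInv, fundInv, ← fund_comp (fun y σ => -(N y σ)ᵀ) f]

theorem fundInv_zero (τ : T) : fundInv N 0 τ = 1 := by simp [fundInv, fund_zero]

theorem fundInv_mul_fund (hN : Continuous fun p : ℝ × T => N p.1 p.2) (x : ℝ) (τ : T) :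
    fundInv N x τ * fund N x τ = 1 := by
  have h : ∀ y, HasDerivAt (fun y => fundInv N y τ * fund N y τ) 0 y := fun y => by
    refine ((hasDerivAt_fundInv hN y τ).mul (hasDerivAt_fund hN y τ)).congr_deriv ?_
    noncomm_ring
  have := matrix_eq_of_deriv_zero h x 0
  simpa [fundInv_zero, fund_zero] using this

theorem fund_mul_fundInv (hN : Continuous fun p : ℝ × T => N p.1 p.2) (x : ℝ) (τ : T) :
    fund N x τ * fundInv N x τ = 1 := mul_eq_one_comm.1 (fundInv_mul_fund hN x τ)

/-- Uniqueness: a solution is determined by its value at `0`. -/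
theorem eq_fund_mul (hN : Continuous fun p : ℝ × T => N p.1 p.2) (τ : T)
    {F : ℝ → Matrix n n ℂ} (hF : ∀ x, HasDerivAt F (N x τ * F x) x) (x : ℝ) :
    F x = fund N x τ * F 0 := by
  have h : ∀ y, HasDerivAt (fun y => fundInv N y τ * F y) 0 y := fun y => by
    refine ((hasDerivAt_fundInv hN y τ).mul (hF y)).congr_deriv ?_
    noncomm_ring
  have := matrix_eq_of_deriv_zero h x 0
  simp only [fundInv_zero, one_mul] at this
  rw [← this, ← mul_assoc, fund_mul_fundInv hN, one_mul]

theorem det_fund (hN : Continuous fun p : ℝ × T => N p.1 p.2) (τ : T) {c : ℂ}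
    (hc : ∀ x, (N x τ).trace = c) (x : ℝ) : (fund N x τ).det = Complex.exp (c * x) := by
  have h : ∀ y : ℝ, HasDerivAt
      (fun y : ℝ => (fund N y τ).det * Complex.exp (-c * y)) 0 y := fun y => by
    have h2 : HasDerivAt (fun y : ℝ => Complex.exp (-c * y)) (Complex.exp (-c * y) * (-c * 1)) y :=
      ((Complex.ofRealCLM.hasDerivAt (x := y)).const_mul (-c)).cexp
    refine ((hasDerivAt_det (hasDerivAt_fund hN y τ)).mul h2).congr_deriv ?_
    rw [hc]; ring
  have := is_const_of_deriv_eq_zero (fun x => (h x).differentiableAt) (fun x => (h x).deriv) x 0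
  simp only [fund_zero, det_one, Complex.ofReal_zero, mul_zero, Complex.exp_zero, mul_one] at this
  rw [neg_mul, Complex.exp_neg] at this
  field_simp [Complex.exp_ne_zero] at this
  exact this

/-- Duhamel's formula comparing the fundamental solutions at two parameters. -/
theorem fund_sub_fund (hN : Continuous fun p : ℝ × T => N p.1 p.2) (x : ℝ) (τ σ : T) :
    fund N x σ - fund N x τ = fund N x σ *
      ∫ y in (0 : ℝ)..x, fundInv N y σ * (N y σ - N y τ) * fund N y τ := by
  have hd : ∀ y, HasDerivAt (fun y => -(fundInv N y σ * fund N y τ))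
      (fundInv N y σ * (N y σ - N y τ) * fund N y τ) y := fun y => by
    refine ((hasDerivAt_fundInv hN y σ).mul (hasDerivAt_fund hN y τ)).neg.congr_deriv ?_
    noncomm_ring
  have hc : ∀ σ : T, Continuous fun y : ℝ => ((y, σ) : ℝ × T) := fun σ => by fun_prop
  rw [intervalIntegral.integral_eq_sub_of_hasDerivAt (fun y _ => hd y)]
  · rw [fundInv_zero, fund_zero, Matrix.mul_sub, Matrix.mul_neg, ← mul_assoc,
      fund_mul_fundInv hN]
    simp only [one_mul, mul_one, Matrix.mul_neg]
    abel
  · refine Continuous.intervalIntegrable ?_ _ _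
    exact (((continuous_fundInv hN).comp (hc σ)).mul ((hN.comp (hc σ)).sub (hN.comp (hc τ)))).mul
      ((continuous_fund hN).comp (hc τ))

end

/-- Differentiability of the fundamental solution in a (real or complex) parameter `σ`, when the
coefficient has divided differences `M` that are jointly continuous. -/
theorem hasDerivAt_fund_param {𝕜 : Type*} [RCLike 𝕜] [NormedAlgebra 𝕜 ℂ]
    {N M : ℝ → 𝕜 → Matrix n n ℂ} {τ : 𝕜}
    (hN : Continuous fun p : ℝ × 𝕜 => N p.1 p.2) (hM : Continuous fun p : ℝ × 𝕜 => M p.1 p.2)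
    (hNM : ∀ y σ, N y σ - N y τ = (σ - τ) • M y σ) (x : ℝ) :
    HasDerivAt (fun σ => fund N x σ)
      (fund N x τ * ∫ y in (0 : ℝ)..x, fundInv N y τ * M y τ * fund N y τ) τ := by
  set g : 𝕜 → Matrix n n ℂ := fun σ =>
    fund N x σ * ∫ y in (0 : ℝ)..x, fundInv N y σ * M y σ * fund N y τ with hg
  have hgc : Continuous g := by
    have h : Continuous (Function.uncurry fun (σ : 𝕜) (y : ℝ) =>
        fundInv N y σ * M y σ * fund N y τ) := by
      have e1 : Continuous fun p : 𝕜 × ℝ => ((p.2, p.1) : ℝ × 𝕜) := by fun_prop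
      have e2 : Continuous fun p : 𝕜 × ℝ => ((p.2, τ) : ℝ × 𝕜) := by fun_prop
      exact (((continuous_fundInv hN).comp e1).mul (hM.comp e1)).mul ((continuous_fund hN).comp e2)
    have h2 := intervalIntegral.continuous_parametric_intervalIntegral_of_continuous' (μ := volume)
      h 0 x
    exact ((continuous_fund hN).comp (by fun_prop : Continuous fun σ : 𝕜 => ((x, σ) : ℝ × 𝕜))).mul
      h2
  have hgs : ∀ σ, fund N x σ - fund N x τ = (σ - τ) • g σ := by
    intro σ
    rw [fund_sub_fund hN, hg]
    simp only [hNM, Matrix.mul_smul, Matrix.smul_mul]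
    rw [intervalIntegral.integral_smul, Matrix.mul_smul]
  refine hasDerivAt_iff_tendsto_slope.2 ?_
  refine ((hgc.tendsto τ).mono_left nhdsWithin_le_nhds).congr' ?_
  filter_upwards [self_mem_nhdsWithin] with σ hσ
  rw [slope_def_module, hgs, smul_smul, inv_mul_cancel₀ (sub_ne_zero.2 hσ), one_smul]

end LinearODE

/-! ### The fundamental solution of the Lax pair -/

namespace VNLS

noncomputable section

open LinearODE

attribute [local instance] Matrix.linftyOpNormedRing Matrix.linftyOpNormedAlgebra

theorem hasDerivAt_Qmat {v : ℝ → Fin 3 → ℂ} {v' : Fin 3 → ℂ} {s : ℝ} (h : HasDerivAt v v' s) :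
    HasDerivAt (fun r => Qmat (v r)) (Qmat v') s := by
  have h' := hasDerivAt_pi.1 h
  refine hasDerivAt_matrix_iff.2 fun i j => ?_
  fin_cases i <;> fin_cases j <;>
    first
    | exact hasDerivAt_const s (0 : ℂ)
    | exact (h' 0).star
    | exact (h' 1).star
    | exact (h' 2).star
    | exact h' 0
    | exact h' 1
    | exact h' 2

theorem continuous_Qmat : Continuous Qmat := by
  refine continuous_matrix fun i j => ?_
  fin_cases i <;> fin_cases j <;> simp [Qmat] <;> fun_prop

theorem Qmat_sub (v w : Fin 3 → ℂ) : Qmat v - Qmat w = Qmat (v - w) := by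
  ext i j
  fin_cases i <;> fin_cases j <;> simp [Qmat]

theorem Qmat_smul (r : ℝ) (v : Fin 3 → ℂ) : Qmat (r • v) = r • Qmat v := by
  ext i j
  fin_cases i <;> fin_cases j <;> simp [Qmat]

/-- The matrix `T` of the Lax pair as a function of the values `v = q`, `w = q_x` and `k`. -/
def Tval (q0 : ℝ) (v w : Fin 3 → ℂ) (k : ℂ) : Mat4 :=
  (2 * Complex.I * k ^ 2) • J
    - Complex.I • (J * (Qmat w - Qmat v ^ 2 + ((q0 : ℂ) ^ 2) • (1 : Mat4)))
    - (2 * k) • Qmat v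

/-- The matrix `X` of the Lax pair as a function of the value `v = q` and `k`. -/
def Xval (v : Fin 3 → ℂ) (k : ℂ) : Mat4 := -(Complex.I * k) • J + Qmat v

theorem J_mul_J : J * J = 1 := by
  ext i j
  fin_cases i <;> fin_cases j <;> simp [J]

theorem Qmat_mul_J (v : Fin 3 → ℂ) : Qmat v * J = -(J * Qmat v) := by
  ext i j
  fin_cases i <;> fin_cases j <;> simp [J, Qmat]

theorem Qmat_cube (v : Fin 3 → ℂ) :
    Qmat v * (Qmat v * Qmat v) = ((∑ i, ‖v i‖ ^ 2 : ℝ) : ℂ) • Qmat v := by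
  have hn : ((∑ i, ‖v i‖ ^ 2 : ℝ) : ℂ)
      = star (v 0) * v 0 + star (v 1) * v 1 + star (v 2) * v 2 := by
    push_cast
    rw [Fin.sum_univ_three]
    simp only [← Complex.conj_mul']
    rfl
  rw [hn]
  ext i j
  fin_cases i <;> fin_cases j <;>
    simp [Qmat, Matrix.mul_apply, Fin.sum_univ_succ] <;> ring

/-- The commutator part of the zero curvature equation, using only `Q J = -J Q` and `J² = 1`. -/
theorem commutator_Tval_Xval (q0 : ℝ) (v w : Fin 3 → ℂ) (k : ℂ) :
    Tval q0 v w k * Xval v k - Xval v k * Tval q0 v w k =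
      (2 * k) • Qmat w - Complex.I • (J * (Qmat w * Qmat v + Qmat v * Qmat w
        - (2 : ℂ) • (Qmat v * (Qmat v * Qmat v)) + (2 * (q0 : ℂ) ^ 2) • Qmat v)) := by
  have hI : Complex.I * Complex.I = -1 := Complex.I_mul_I
  have hv := Qmat_mul_J v
  have hw := Qmat_mul_J w
  have hv' : ∀ R : Mat4, Qmat v * (J * R) = -(J * (Qmat v * R)) := fun R => by
    rw [← mul_assoc, hv, neg_mul, mul_assoc]
  have hJ' : ∀ R : Mat4, J * (J * R) = R := fun R => by rw [← mul_assoc, J_mul_J, one_mul]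
  simp only [Tval, Xval, pow_two, mul_add, add_mul, mul_sub, sub_mul, Matrix.mul_smul,
    Matrix.smul_mul, mul_assoc, hv, hw, hv', hJ', J_mul_J, mul_one, mul_neg, smul_neg, neg_neg,
    smul_sub, smul_add, smul_smul]
  match_scalars <;> ring_nf <;> simp

/-- The zero curvature equation: the nonlinear equation for `q` is the compatibility condition `X_t
= T_x + [T, X]` of the Lax pair. Here `v, w, w', vt` are the values of `q, q_x, q_xx, q_t`. -/
theorem zero_curvature {q0 : ℝ} {v w w' vt : Fin 3 → ℂ} (k : ℂ)
    (h : ∀ j, Complex.I * vt j + w' j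
      - 2 * (((∑ i, ‖v i‖ ^ 2 - q0 ^ 2 : ℝ)) : ℂ) * v j = 0) :
    Qmat vt = (-Complex.I • (J * (Qmat w' - (Qmat w * Qmat v + Qmat v * Qmat w)))
        - (2 * k) • Qmat w)
      + (Tval q0 v w k * Xval v k - Xval v k * Tval q0 v w k) := by
  have hr : Qmat vt = -Complex.I • (J * (Qmat w' - (2 : ℂ) •
      (((∑ i, ‖v i‖ ^ 2 - q0 ^ 2 : ℝ) : ℂ) • Qmat v))) := by
    have h1 : ∀ j, vt j = -Complex.I * -(w' j - 2 *
        ((((∑ i, ‖v i‖ ^ 2 - q0 ^ 2 : ℝ)) : ℂ) * v j)) := fun j => by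
      linear_combination (-Complex.I) * h j + vt j * Complex.I_mul_I
    have h2 : ∀ j, star (vt j) = -Complex.I * (star (w' j) - 2 *
        ((((∑ i, ‖v i‖ ^ 2 - q0 ^ 2 : ℝ)) : ℂ) * star (v j))) := fun j => by
      rw [h1 j]
      simp only [star_mul', star_neg, star_sub, Complex.star_def, Complex.conj_I,
        Complex.conj_ofReal, map_ofNat]
      ring
    generalize (((∑ i, ‖v i‖ ^ 2 - q0 ^ 2 : ℝ)) : ℂ) = r at h1 h2
    ext i j
    fin_cases i <;> fin_cases j <;>
      first
      | (simp [Qmat, J]; done)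
      | simpa [Qmat, J] using h2 0
      | simpa [Qmat, J] using h2 1
      | simpa [Qmat, J] using h2 2
      | simpa [Qmat, J] using h1 0
      | simpa [Qmat, J] using h1 1
      | simpa [Qmat, J] using h1 2
  rw [hr, commutator_Tval_Xval, Qmat_cube]
  push_cast
  simp only [mul_sub, mul_add, smul_sub, smul_add, sub_smul, Matrix.mul_smul]
  module

theorem continuous_Xval : Continuous fun p : (Fin 3 → ℂ) × ℂ => Xval p.1 p.2 := by
  have := continuous_Qmat
  unfold Xval
  fun_prop

namespace Potential

variable (P : Potential)

/-- The coefficient of the `x`-equation, with parameters `(t, k)`. -/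
def Xcoef (x : ℝ) (p : ℝ × ℂ) : Mat4 := Xval (P.q x p.1) p.2

/-- The coefficient of the `t`-equation along `x = 0`, with parameter `k`. -/
def Tcoef (t : ℝ) (k : ℂ) : Mat4 := Tval P.q0 (P.q 0 t) (dx P.q 0 t) k

/-- The fundamental solution of the Lax pair at the spectral parameter `k`, normalized to be the
identity at `(x,t) = (0,0)`: first along the `t`-axis, then in the direction of `x`. -/
def G (x t : ℝ) (k : ℂ) : Mat4 := fund P.Xcoef x (t, k) * fund P.Tcoef t k

/-- The inverse of the fundamental solution `G`. -/
def Ginv (x t : ℝ) (k : ℂ) : Mat4 := fundInv P.Tcoef t k * fundInv P.Xcoef x (t, k)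

variable {P}

theorem IsSolution.continuous_Xcoef (h : P.IsSolution) :
    Continuous fun p : ℝ × ℝ × ℂ => P.Xcoef p.1 p.2 := by
  have e : Continuous fun p : ℝ × ℝ × ℂ => ((p.1, p.2.1) : ℝ × ℝ) := by fun_prop
  exact continuous_Xval.comp ((h.continuous_q.comp e).prodMk continuous_snd.snd)

theorem IsSolution.continuous_Tcoef (h : P.IsSolution) :
    Continuous fun p : ℝ × ℂ => P.Tcoef p.1 p.2 := by
  have e : Continuous fun p : ℝ × ℂ => ((0, p.1) : ℝ × ℝ) := by fun_prop
  have h1 := continuous_Qmat.comp (h.continuous_q.comp e)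
  have h2 := continuous_Qmat.comp (h.continuous_x.comp e)
  simp only [Function.comp_def] at h1 h2
  unfold Tcoef Tval
  fun_prop

theorem G_zero (k : ℂ) : P.G 0 0 k = 1 := by simp [G, fund_zero]

theorem IsSolution.Ginv_mul_G (h : P.IsSolution) (x t : ℝ) (k : ℂ) :
    P.Ginv x t k * P.G x t k = 1 := by
  rw [Ginv, G, mul_assoc, ← mul_assoc (fundInv P.Xcoef _ _), fundInv_mul_fund h.continuous_Xcoef,
    one_mul, fundInv_mul_fund h.continuous_Tcoef]

theorem IsSolution.G_mul_Ginv (h : P.IsSolution) (x t : ℝ) (k : ℂ) :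
    P.G x t k * P.Ginv x t k = 1 := mul_eq_one_comm.1 (h.Ginv_mul_G x t k)

theorem IsSolution.hasDerivAt_G_x (h : P.IsSolution) (x t : ℝ) (k : ℂ) :
    HasDerivAt (fun y => P.G y t k) (Xval (P.q x t) k * P.G x t k) x := by
  have := (hasDerivAt_fund h.continuous_Xcoef x (t, k)).mul_const (fund P.Tcoef t k)
  rw [mul_assoc] at this
  exact this

/-- The time derivative of the propagator of the `x`-equation. Duhamel's formula expresses it as an
integral whose integrand is a derivative by the zero curvature equation. -/
theorem IsSolution.hasDerivAt_fund_Xcoef_t (h : P.IsSolution) (x t : ℝ) (k : ℂ) :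
    HasDerivAt (fun s => fund P.Xcoef x (s, k))
      (Tval P.q0 (P.q x t) (dx P.q x t) k * fund P.Xcoef x (t, k)
        - fund P.Xcoef x (t, k) * P.Tcoef t k) t := by
  have hX := h.continuous_Xcoef
  have e : Continuous fun p : ℝ × ℝ => ((p.1, (p.2, k)) : ℝ × ℝ × ℂ) := by fun_prop
  have hN : Continuous fun p : ℝ × ℝ => P.Xcoef p.1 (p.2, k) := hX.comp e
  have hfund : ∀ y s, fund P.Xcoef y (s, k) = fund (fun y s => P.Xcoef y (s, k)) y s :=
    fun y s => (fund_comp P.Xcoef (fun s => (s, k)) y s).symm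
  have hinv : ∀ y s, fundInv P.Xcoef y (s, k) = fundInv (fun y s => P.Xcoef y (s, k)) y s :=
    fun y s => (fundInv_comp (N := P.Xcoef) (fun s => (s, k)) y s).symm
  set D : ℝ → ℝ → Mat4 := fun y s => Qmat (∫ r in (0 : ℝ)..1, dt P.q y (t + r * (s - t))) with hD
  have hDc : Continuous fun p : ℝ × ℝ => D p.1 p.2 := by
    refine continuous_Qmat.comp ?_
    refine intervalIntegral.continuous_parametric_intervalIntegral_of_continuous'
      (f := fun (p : ℝ × ℝ) r => dt P.q p.1 (t + r * (p.2 - t))) ?_ 0 1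
    exact h.continuous_t.comp
      (by fun_prop : Continuous fun p : (ℝ × ℝ) × ℝ => ((p.1.1, t + p.2 * (p.1.2 - t)) : ℝ × ℝ))
  have hqt : ∀ y s, HasDerivAt (fun s => P.q y s) (dt P.q y s) s := fun y s =>
    (h.differentiable_t y s).hasDerivAt
  have hND : ∀ y s, P.Xcoef y (s, k) - P.Xcoef y (t, k) = (s - t) • D y s := by
    intro y s
    have e1 : P.Xcoef y (s, k) - P.Xcoef y (t, k) = Qmat (P.q y s - P.q y t) := by
      rw [← Qmat_sub]; simp [Xcoef, Xval]
    have e2 : P.q y s - P.q y t =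
        (s - t) • ∫ r in (0 : ℝ)..1, dt P.q y (t + r * (s - t)) := by
      have h1 := intervalIntegral.integral_eq_sub_of_hasDerivAt (a := t) (b := s)
        (fun r _ => hqt y r) ((h.continuous_t.comp
          (by fun_prop : Continuous fun r : ℝ => ((y, r) : ℝ × ℝ))).intervalIntegrable _ _)
      have h2 := intervalIntegral.smul_integral_comp_add_mul (a := 0) (b := 1)
        (fun r => dt P.q y r) (s - t) t
      simp only [mul_zero, add_zero, mul_one, add_sub_cancel] at h2
      rw [← h1, ← h2]
      simp only [mul_comm]
    rw [e1, e2, Qmat_smul]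
  have main := hasDerivAt_fund_param (𝕜 := ℝ) hN hDc hND x
  simp only [← hfund, ← hinv] at main
  refine main.congr_deriv ?_
  have hDt : ∀ y, D y t = Qmat (dt P.q y t) := by intro y; simp [hD]
  have hTx : ∀ y, HasDerivAt (fun y => Tval P.q0 (P.q y t) (dx P.q y t) k)
      (-Complex.I • (J * (Qmat (dx (dx P.q) y t) - (Qmat (dx P.q y t) * Qmat (P.q y t)
        + Qmat (P.q y t) * Qmat (dx P.q y t)))) - (2 * k) • Qmat (dx P.q y t)) y := by
    intro y
    have hq := hasDerivAt_Qmat (h.differentiable_x y t).hasDerivAt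
    have hqx := hasDerivAt_Qmat (h.differentiable_xx y t).hasDerivAt
    have h3 := ((((hqx.sub (hq.mul hq)).add_const (((P.q0 : ℂ) ^ 2) • (1 : Mat4))).const_mul
      J).const_smul Complex.I).const_sub ((2 * Complex.I * k ^ 2) • J)
    have h4 := h3.sub (hq.const_smul (2 * k))
    simp only [Tval, pow_two (Qmat _)]
    refine h4.congr_deriv ?_
    rw [neg_smul]
    rfl
  have hder : ∀ y, HasDerivAt (fun y => fundInv P.Xcoef y (t, k) *
      Tval P.q0 (P.q y t) (dx P.q y t) k * fund P.Xcoef y (t, k))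
      (fundInv P.Xcoef y (t, k) * D y t * fund P.Xcoef y (t, k)) y := by
    intro y
    have h1 := (hasDerivAt_fundInv hX y (t, k)).fun_mul (hTx y)
    have h2 := h1.fun_mul (hasDerivAt_fund hX y (t, k))
    refine h2.congr_deriv ?_
    rw [hDt, zero_curvature k (h.equation y t), Xcoef]
    noncomm_ring
  rw [intervalIntegral.integral_eq_sub_of_hasDerivAt (fun y _ => hder y)]
  · rw [fundInv_zero, fund_zero, mul_sub, ← mul_assoc, ← mul_assoc, fund_mul_fundInv hX]
    simp [Tcoef]
  · refine Continuous.intervalIntegrable ?_ _ _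
    have e1 : Continuous fun y : ℝ => ((y, (t, k)) : ℝ × ℝ × ℂ) := by fun_prop
    have e2 : Continuous fun y : ℝ => ((y, t) : ℝ × ℝ) := by fun_prop
    exact (((continuous_fundInv hX).comp e1).mul (hDc.comp e2)).mul ((continuous_fund hX).comp e1)

theorem IsSolution.hasDerivAt_G_t (h : P.IsSolution) (x t : ℝ) (k : ℂ) :
    HasDerivAt (fun s => P.G x s k) (Tval P.q0 (P.q x t) (dx P.q x t) k * P.G x t k) t := by
  refine ((h.hasDerivAt_fund_Xcoef_t x t k).fun_mul
    (hasDerivAt_fund h.continuous_Tcoef t k)).congr_deriv ?_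
  rw [G]
  noncomm_ring

theorem IsSolution.differentiable_G (h : P.IsSolution) (x t : ℝ) :
    Differentiable ℂ fun k => P.G x t k := by
  intro k
  have e : Continuous fun p : ℝ × ℂ => ((p.1, (t, p.2)) : ℝ × ℝ × ℂ) := by fun_prop
  have h1 := hasDerivAt_fund_param (𝕜 := ℂ) (τ := k) (N := fun y κ => P.Xcoef y (t, κ))
    (M := fun _ _ => -Complex.I • J) (h.continuous_Xcoef.comp e) continuous_const (fun y κ => by
      simp only [Xcoef, Xval]
      module) x
  have h2 := hasDerivAt_fund_param (𝕜 := ℂ) (τ := k) (N := P.Tcoef)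
    (M := fun s κ => (2 * Complex.I * (κ + k)) • J - (2 : ℂ) • Qmat (P.q 0 s))
    h.continuous_Tcoef (by
      have e' : Continuous fun p : ℝ × ℂ => ((0, p.1) : ℝ × ℝ) := by fun_prop
      have := continuous_Qmat.comp (h.continuous_q.comp e')
      simp only [Function.comp_def] at this
      fun_prop) (fun y κ => by
      simp only [Tcoef, Tval]
      module) t
  simp only [fund_comp P.Xcoef (fun κ => (t, κ))] at h1
  exact (h1.fun_mul h2).differentiableAt

/-- A simultaneous solution of the Lax pair is determined by its value at `(0,0)`. The `t`-equation
is only needed on the `t`-axis. -/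
theorem IsSolution.eq_G_mul (h : P.IsSolution) {k : ℂ} {F : ℝ → ℝ → Mat4}
    (hx : ∀ x t, HasDerivAt (fun y => F y t) (Xval (P.q x t) k * F x t) x)
    (ht : ∀ t, HasDerivAt (fun s => F 0 s) (Tval P.q0 (P.q 0 t) (dx P.q 0 t) k * F 0 t) t)
    (x t : ℝ) : F x t = P.G x t k * F 0 0 := by
  rw [eq_fund_mul h.continuous_Xcoef (t, k) (F := fun y => F y t) (fun y => hx y t) x,
    eq_fund_mul h.continuous_Tcoef k (F := fun s => F 0 s) ht t, G, mul_assoc]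

theorem IsSolution.det_G_x (h : P.IsSolution) (x : ℝ) (k : ℂ) :
    (P.G x 0 k).det = Complex.exp (2 * Complex.I * k * x) := by
  rw [G, fund_zero, mul_one]
  refine det_fund h.continuous_Xcoef (0, k) (fun y => ?_) x
  simp [Xcoef, Xval, Matrix.trace, Fin.sum_univ_succ, J, Qmat]
  ring

end Potential

end

end VNLS

/-! ### Perturbations of damped diagonal systems -/

namespace Damped

variable {ι : Type*} [Fintype ι]

/-- `w` solves a perturbation `w_i' = δ_i w_i + r_i` of a diagonal system, in which every component
that does not vanish identically is neutral or damped, and the perturbation is bounded by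
`β ∑ |w_l|`. -/
def IsSol (δ : ι → ℂ) (β : ℝ → ℝ) (w : ℝ → ι → ℂ) : Prop :=
  ∃ w' : ℝ → ι → ℂ, (∀ τ i, HasDerivAt (fun s => w s i) (w' τ i) τ) ∧
    (∀ τ i, ‖w' τ i - δ i * w τ i‖ ≤ β τ * ∑ l, ‖w τ l‖) ∧
    ∀ i, (δ i).re ≤ 0 ∨ ∀ τ, w τ i = 0

variable {δ : ι → ℂ} {β : ℝ → ℝ} {w : ℝ → ι → ℂ}

theorem hasDerivAt_integral {β : ℝ → ℝ} (hβ : Continuous β) (a x : ℝ) :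
    HasDerivAt (fun y => ∫ s in a..y, β s) (β x) x :=
  intervalIntegral.integral_hasDerivAt_right (hβ.intervalIntegrable _ _)
    hβ.stronglyMeasurable.stronglyMeasurableAtFilter hβ.continuousAt

/-- Grönwall's inequality for the energy `∑ |w_i|²`, to which the diagonal part contributes a
nonpositive term. -/
theorem IsSol.sum_sq_le (hw : IsSol δ β w) (hβ : Continuous β) (hβ0 : ∀ τ, 0 ≤ β τ)
    {τ₀ τ₁ : ℝ} (hτ : τ₀ ≤ τ₁) :
    ∑ i, ‖w τ₁ i‖ ^ 2 ≤
      (∑ i, ‖w τ₀ i‖ ^ 2) * Real.exp (2 * (Fintype.card ι * ∫ s in τ₀..τ₁, β s)) := by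
  obtain ⟨w', hd, hr, hδ⟩ := hw
  set n : ℝ := (Fintype.card ι : ℝ)
  have he : ∀ τ, HasDerivAt (fun τ => ∑ i, ‖w τ i‖ ^ 2)
      (∑ i, 2 * inner ℝ (w τ i) (w' τ i)) τ := fun τ =>
    HasDerivAt.fun_sum fun i _ => (hd τ i).norm_sq
  have hle : ∀ τ, ∑ i, 2 * inner ℝ (w τ i) (w' τ i) ≤ 2 * n * β τ * ∑ i, ‖w τ i‖ ^ 2 := by
    intro τ
    have h1 : ∀ i, inner ℝ (w τ i) (w' τ i) ≤ ‖w τ i‖ * (β τ * ∑ l, ‖w τ l‖) := by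
      intro i
      have e : w' τ i = δ i * w τ i + (w' τ i - δ i * w τ i) := by ring
      rw [e, inner_add_right]
      have a1 : inner ℝ (w τ i) (δ i * w τ i) ≤ 0 := by
        rcases hδ i with h | h
        · rw [Complex.inner]
          have : (starRingEnd ℂ) (w τ i) * (δ i * w τ i) = δ i * ((‖w τ i‖ ^ 2 : ℝ) : ℂ) := by
            push_cast
            rw [← Complex.conj_mul']; ring
          rw [mul_comm, this, Complex.re_mul_ofReal]
          exact mul_nonpos_of_nonpos_of_nonneg h (by positivity)
        · rw [h τ]; simp
      have a2 : inner ℝ (w τ i) (w' τ i - δ i * w τ i) ≤ ‖w τ i‖ * (β τ * ∑ l, ‖w τ l‖) :=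
        (real_inner_le_norm _ _).trans (mul_le_mul_of_nonneg_left (hr τ i) (norm_nonneg _))
      linarith
    have h2 : (∑ i, ‖w τ i‖) ^ 2 ≤ n * ∑ i, ‖w τ i‖ ^ 2 := sq_sum_le_card_mul_sum_sq
    calc ∑ i, 2 * inner ℝ (w τ i) (w' τ i) ≤ ∑ i, 2 * (‖w τ i‖ * (β τ * ∑ l, ‖w τ l‖)) :=
          Finset.sum_le_sum fun i _ => by linarith [h1 i]
      _ = 2 * β τ * (∑ i, ‖w τ i‖) ^ 2 := by
          rw [pow_two, ← Finset.mul_sum, ← Finset.sum_mul]; ring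
      _ ≤ 2 * β τ * (n * ∑ i, ‖w τ i‖ ^ 2) :=
          mul_le_mul_of_nonneg_left h2 (mul_nonneg zero_le_two (hβ0 τ))
      _ = _ := by ring
  set f : ℝ → ℝ := fun τ =>
    (∑ i, ‖w τ i‖ ^ 2) * Real.exp (-(2 * (n * ∫ s in τ₀..τ, β s))) with hf
  have hfd : ∀ τ, HasDerivAt f ((∑ i, 2 * inner ℝ (w τ i) (w' τ i)) *
      Real.exp (-(2 * (n * ∫ s in τ₀..τ, β s))) + (∑ i, ‖w τ i‖ ^ 2) *
      (Real.exp (-(2 * (n * ∫ s in τ₀..τ, β s))) * (-(2 * (n * β τ))))) τ := fun τ =>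
    (he τ).fun_mul ((((hasDerivAt_integral hβ τ₀ τ).const_mul n).const_mul 2).fun_neg.exp)
  have hanti : Antitone f := by
    refine antitone_of_deriv_nonpos (fun τ => (hfd τ).differentiableAt) fun τ => ?_
    rw [(hfd τ).deriv]
    have := mul_le_mul_of_nonneg_right (hle τ)
      (Real.exp_pos (-(2 * (n * ∫ s in τ₀..τ, β s)))).le
    linarith
  have := hanti hτ
  simp only [hf, intervalIntegral.integral_same, mul_zero, neg_zero, Real.exp_zero, mul_one] at this
  rw [Real.exp_neg, ← div_eq_mul_inv, div_le_iff₀ (Real.exp_pos _)] at this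
  exact this

theorem IsSol.norm_le (hw : IsSol δ β w) (hβ : Continuous β) (hβ0 : ∀ τ, 0 ≤ β τ)
    {τ₀ τ₁ : ℝ} (hτ : τ₀ ≤ τ₁) (i : ι) :
    ‖w τ₁ i‖ ≤ (∑ i, ‖w τ₀ i‖) * Real.exp (Fintype.card ι * ∫ s in τ₀..τ₁, β s) := by
  have hs : 0 ≤ ∑ i, ‖w τ₀ i‖ := Finset.sum_nonneg fun i _ => norm_nonneg _
  refine abs_le_of_sq_le_sq' ?_ (mul_nonneg hs (Real.exp_pos _).le) |>.2
  calc ‖w τ₁ i‖ ^ 2 ≤ ∑ i, ‖w τ₁ i‖ ^ 2 :=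
        Finset.single_le_sum (f := fun i => ‖w τ₁ i‖ ^ 2) (fun i _ => by positivity)
          (Finset.mem_univ i)
    _ ≤ _ := hw.sum_sq_le hβ hβ0 hτ
    _ ≤ (∑ i, ‖w τ₀ i‖) ^ 2 * Real.exp (2 * (Fintype.card ι * ∫ s in τ₀..τ₁, β s)) := by
        gcongr
        exact Finset.sum_sq_le_sq_sum_of_nonneg fun i _ => norm_nonneg _
    _ = _ := by rw [mul_pow, ← Real.exp_nat_mul]; norm_num

/-- A solution that starts at an equilibrium `c` of the unperturbed system stays close to it. -/
theorem IsSol.norm_sub_le (hw : IsSol δ β w) (hβ : Continuous β) (hβ0 : ∀ τ, 0 ≤ β τ)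
    {τ₀ τ₁ : ℝ} (hτ : τ₀ ≤ τ₁) (hc : ∀ i, δ i * w τ₀ i = 0) (i : ι) :
    ‖w τ₁ i - w τ₀ i‖ ≤ (Fintype.card ι * (∑ i, ‖w τ₀ i‖) *
      Real.exp (Fintype.card ι * ∫ s in τ₀..τ₁, β s)) * ∫ s in τ₀..τ₁, β s := by
  set K : ℝ := Fintype.card ι * (∑ i, ‖w τ₀ i‖) *
      Real.exp (Fintype.card ι * ∫ s in τ₀..τ₁, β s) with hK
  have hs : 0 ≤ ∑ i, ‖w τ₀ i‖ := Finset.sum_nonneg fun i _ => norm_nonneg _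
  have hI : ∀ y ∈ Set.Icc τ₀ τ₁, ∫ s in τ₀..y, β s ≤ ∫ s in τ₀..τ₁, β s := fun y hy =>
    intervalIntegral.integral_mono_interval le_rfl hy.1 hy.2 (ae_of_all _ hβ0)
      (hβ.intervalIntegrable _ _)
  have hsum : ∀ y ∈ Set.Icc τ₀ τ₁, ∑ l, ‖w y l‖ ≤ K := by
    intro y hy
    calc ∑ l, ‖w y l‖ ≤ ∑ _l : ι, (∑ i, ‖w τ₀ i‖) *
          Real.exp (Fintype.card ι * ∫ s in τ₀..τ₁, β s) := by
          refine Finset.sum_le_sum fun l _ => (hw.norm_le hβ hβ0 hy.1 l).trans ?_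
          gcongr
          exact hI y hy
      _ = K := by rw [Finset.sum_const, Finset.card_univ, nsmul_eq_mul, hK]; ring
  obtain ⟨w', hd, hr, hδ⟩ := hw
  have hInn : 0 ≤ ∫ s in τ₀..τ₁, β s := intervalIntegral.integral_nonneg hτ fun s _ => hβ0 s
  rcases hδ i with h | h
  · set f : ℝ → ℂ := fun y => Complex.exp (δ i * ((τ₁ - y : ℝ) : ℂ)) * (w y i - w τ₀ i) with hf
    have hfd : ∀ y, HasDerivAt f (Complex.exp (δ i * ((τ₁ - y : ℝ) : ℂ)) *
        (w' y i - δ i * w y i)) y := by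
      intro y
      have e1 : HasDerivAt (fun y : ℝ => Complex.exp (δ i * ((τ₁ - y : ℝ) : ℂ)))
          (Complex.exp (δ i * ((τ₁ - y : ℝ) : ℂ)) * (δ i * ((-1 : ℝ) : ℂ))) y :=
        ((((hasDerivAt_id y).const_sub τ₁).ofReal_comp).const_mul (δ i)).cexp
      refine (e1.fun_mul ((hd y i).sub_const (w τ₀ i))).congr_deriv ?_
      push_cast
      linear_combination Complex.exp (δ i * ((τ₁ - y : ℂ))) * hc i
    have key := image_norm_le_of_norm_deriv_right_le_deriv_boundary' (a := τ₀) (b := τ₁) (f := f)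
      (f' := fun y => Complex.exp (δ i * ((τ₁ - y : ℝ) : ℂ)) * (w' y i - δ i * w y i))
      (B := fun y => K * ∫ s in τ₀..y, β s) (B' := fun y => K * β y)
      (fun y _ => (hfd y).continuousAt.continuousWithinAt)
      (fun y _ => (hfd y).hasDerivWithinAt) (by simp [hf])
      (fun y _ => (((hasDerivAt_integral hβ τ₀ y).const_mul K).continuousAt).continuousWithinAt)
      (fun y _ => ((hasDerivAt_integral hβ τ₀ y).const_mul K).hasDerivWithinAt)
      (fun y hy => by
        rw [norm_mul]
        have e1 : ‖Complex.exp (δ i * ((τ₁ - y : ℝ) : ℂ))‖ ≤ 1 := by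
          rw [Complex.norm_exp, Complex.re_mul_ofReal]
          exact Real.exp_le_one_iff.2
            (mul_nonpos_of_nonpos_of_nonneg h (by linarith [hy.2]))
        calc _ ≤ 1 * (β y * ∑ l, ‖w y l‖) :=
              mul_le_mul e1 (hr y i) (norm_nonneg _) zero_le_one
          _ ≤ K * β y := by
              rw [one_mul, mul_comm]
              exact mul_le_mul_of_nonneg_right (hsum y ⟨hy.1, hy.2.le⟩) (hβ0 y))
      (Set.right_mem_Icc.2 hτ)
    simpa [hf] using key
  · rw [h, h, sub_zero, norm_zero]
    positivity

section HalfLine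

variable {h : ℝ → ℝ} {C : ℝ}

theorem integral_le_tail (h0 : ∀ τ, 0 ≤ h τ)
    (hi : IntegrableOn h (Set.Iic 0)) {τ₁ τ₀ : ℝ} (h1 : τ₁ ≤ τ₀) (h2 : τ₀ ≤ 0) :
    ∫ s in τ₁..τ₀, h s ≤ ∫ s in Set.Iic τ₀, h s := by
  rw [intervalIntegral.integral_of_le h1]
  exact setIntegral_mono_set (hi.mono_set (Set.Iic_subset_Iic.2 h2)) (ae_of_all _ h0)
    (Set.Ioc_subset_Iic_self).eventuallyLE

theorem tail_le (h0 : ∀ τ, 0 ≤ h τ) (hi : IntegrableOn h (Set.Iic 0)) {τ₀ : ℝ} (h2 : τ₀ ≤ 0) :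
    ∫ s in Set.Iic τ₀, h s ≤ ∫ s in Set.Iic 0, h s :=
  setIntegral_mono_set hi (ae_of_all _ h0) (Set.Iic_subset_Iic.2 h2).eventuallyLE

theorem tail_nonneg (h0 : ∀ τ, 0 ≤ h τ) (τ : ℝ) : 0 ≤ ∫ s in Set.Iic τ, h s :=
  integral_nonneg h0

theorem tendsto_tail (hi : IntegrableOn h (Set.Iic 0)) :
    Tendsto (fun τ => ∫ s in Set.Iic τ, h s) atBot (𝓝 0) := by
  have e : ∀ᶠ τ in atBot, (∫ s in Set.Iic 0, h s) - (∫ s in τ..0, h s) = ∫ s in Set.Iic τ, h s := by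
    filter_upwards [eventually_le_atBot (0 : ℝ)] with τ hτ
    have := intervalIntegral.integral_Iic_sub_Iic (hi.mono_set (Set.Iic_subset_Iic.2 hτ)) hi
    rw [← this]; ring
  have := (intervalIntegral_tendsto_integral_Iic (0 : ℝ) hi tendsto_id).const_sub
    (∫ s in Set.Iic 0, h s)
  rw [sub_self] at this
  exact this.congr' e

variable {W : ℝ → ℝ → ι → ℂ} {c : ι → ℂ}

/-- The deviation from the equilibrium is controlled by the tail of `h`, uniformly in the initial
time. -/
theorem deviation_le (hh : Continuous h) (h0 : ∀ τ, 0 ≤ h τ)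
    (hi : IntegrableOn h (Set.Iic 0)) (hC : 0 ≤ C)
    (hW : ∀ τ, IsSol δ (fun s => C * h s) (W τ)) (hc : ∀ τ, W τ τ = c) (hδc : ∀ i, δ i * c i = 0)
    {τ₁ τ₀ : ℝ} (h1 : τ₁ ≤ τ₀) (h2 : τ₀ ≤ 0) (i : ι) :
    ‖W τ₁ τ₀ i - c i‖ ≤ Fintype.card ι * (∑ i, ‖c i‖) *
      Real.exp (Fintype.card ι * (C * ∫ s in Set.Iic 0, h s)) *
      (C * ∫ s in Set.Iic τ₀, h s) := by
  have key := (hW τ₁).norm_sub_le (hh.const_mul C) (fun s => mul_nonneg hC (h0 s)) h1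
    (fun i => by rw [hc]; exact hδc i) i
  rw [hc, intervalIntegral.integral_const_mul] at key
  have h3 := integral_le_tail h0 hi h1 h2
  have h4 := tail_le h0 hi h2
  have h5 : 0 ≤ ∫ s in τ₁..τ₀, h s := intervalIntegral.integral_nonneg h1 fun s _ => h0 s
  refine key.trans ?_
  have hs : 0 ≤ ∑ i, ‖c i‖ := Finset.sum_nonneg fun i _ => norm_nonneg _
  gcongr
  exact h3.trans h4

/-- The values at time `0` of the solutions started at `τ₁` and at `τ₀` differ by the tail of `h`:
at time `τ₀` both are close to `c`, and their difference does not grow afterwards by more than a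
factor. -/
theorem cauchy_le (hh : Continuous h) (h0 : ∀ τ, 0 ≤ h τ)
    (hi : IntegrableOn h (Set.Iic 0)) (hC : 0 ≤ C)
    (hW : ∀ τ, IsSol δ (fun s => C * h s) (W τ)) (hc : ∀ τ, W τ τ = c) (hδc : ∀ i, δ i * c i = 0)
    (hsub : ∀ τ τ', IsSol δ (fun s => C * h s) (fun s => W τ s - W τ' s))
    {τ₁ τ₀ : ℝ} (h1 : τ₁ ≤ τ₀) (h2 : τ₀ ≤ 0) (i : ι) :
    ‖W τ₁ 0 i - W τ₀ 0 i‖ ≤ Fintype.card ι * (Fintype.card ι * (∑ i, ‖c i‖) *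
      Real.exp (Fintype.card ι * (C * ∫ s in Set.Iic 0, h s)) *
      (C * ∫ s in Set.Iic τ₀, h s)) *
      Real.exp (Fintype.card ι * (C * ∫ s in Set.Iic 0, h s)) := by
  have key := (hsub τ₁ τ₀).norm_le (hh.const_mul C) (fun s => mul_nonneg hC (h0 s)) h2 i
  simp only [Pi.sub_apply] at key
  refine key.trans ?_
  rw [intervalIntegral.integral_const_mul]
  have h3 := (integral_le_tail h0 hi h2 le_rfl)
  have hdev : ∑ i, ‖W τ₁ τ₀ i - W τ₀ τ₀ i‖ ≤ Fintype.card ι * (Fintype.card ι * (∑ i, ‖c i‖) *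
      Real.exp (Fintype.card ι * (C * ∫ s in Set.Iic 0, h s)) *
      (C * ∫ s in Set.Iic τ₀, h s)) := by
    rw [hc]
    refine (Finset.sum_le_sum fun i _ => deviation_le hh h0 hi hC hW hc hδc h1 h2 i).trans ?_
    rw [Finset.sum_const, Finset.card_univ, nsmul_eq_mul]
  have hs : 0 ≤ ∑ i, ‖W τ₁ τ₀ i - W τ₀ τ₀ i‖ := Finset.sum_nonneg fun i _ => norm_nonneg _
  refine mul_le_mul hdev ?_ (Real.exp_pos _).le (hs.trans hdev)
  gcongr

end HalfLine

/-- A sequence of functions which is locally uniformly Cauchy on `S` has a locally uniform limit. -/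
theorem exists_limit_of_locally_cauchy {S : Set ℂ} {V : Type*} [NormedAddCommGroup V]
    [CompleteSpace V] {p : ℕ → ℂ → V}
    (h : ∀ z₀ ∈ S, ∃ b : ℕ → ℝ, Tendsto b atTop (𝓝 0) ∧
      ∀ᶠ z in 𝓝[S] z₀, ∀ n m, n ≤ m → ‖p m z - p n z‖ ≤ b n) :
    ∃ f : ℂ → V, (∀ z ∈ S, Tendsto (fun n => p n z) atTop (𝓝 (f z))) ∧
      TendstoLocallyUniformlyOn p f atTop S := by
  have hlim : ∀ z, ∃ y, z ∈ S → Tendsto (fun n => p n z) atTop (𝓝 y) := by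
    intro z
    by_cases hz : z ∈ S
    · obtain ⟨b, hb, hev⟩ := h z hz
      have hev := hev.self_of_nhdsWithin hz
      have : CauchySeq fun n => p n z := by
        refine cauchySeq_of_le_tendsto_0' b (fun n m hnm => ?_) hb
        rw [dist_eq_norm, norm_sub_rev]; exact hev n m hnm
      obtain ⟨y, hy⟩ := cauchySeq_tendsto_of_complete this
      exact ⟨y, fun _ => hy⟩
    · exact ⟨0, fun h => absurd h hz⟩
  choose f hf using hlim
  refine ⟨f, hf, ?_⟩
  rw [Metric.tendstoLocallyUniformlyOn_iff]
  intro ε hε z₀ hz₀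
  obtain ⟨b, hb, hev⟩ := h z₀ hz₀
  refine ⟨{z | z ∈ S ∧ ∀ n m, n ≤ m → ‖p m z - p n z‖ ≤ b n},
    (Filter.inter_mem self_mem_nhdsWithin hev), ?_⟩
  filter_upwards [hb.eventually (gt_mem_nhds hε)] with n hn z hz
  refine lt_of_le_of_lt ?_ hn
  rw [dist_eq_norm]
  have : Tendsto (fun m => ‖p m z - p n z‖) atTop (𝓝 ‖f z - p n z‖) :=
    ((hf z hz.1).sub_const _).norm
  refine le_of_tendsto this ?_
  filter_upwards [eventually_ge_atTop n] with m hm using hz.2 n m hm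

/-- `w` solves the linear system `w_i' = δ_i w_i + ∑ R_il w_l`, and its components that do not vanish
identically are neutral or damped. -/
def IsLinSol (δ : ι → ℂ) (R : ℝ → ι → ι → ℂ) (w : ℝ → ι → ℂ) : Prop :=
  (∀ τ i, HasDerivAt (fun s => w s i) (δ i * w τ i + ∑ l, R τ i l * w τ l) τ) ∧
    ∀ i, (δ i).re ≤ 0 ∨ ∀ τ, w τ i = 0

theorem IsLinSol.sub {R : ℝ → ι → ι → ℂ} {w₁ w₂ : ℝ → ι → ℂ} (h₁ : IsLinSol δ R w₁)
    (h₂ : IsLinSol δ R w₂) : IsLinSol δ R fun τ => w₁ τ - w₂ τ := by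
  refine ⟨fun τ i => ((h₁.1 τ i).fun_sub (h₂.1 τ i)).congr_deriv ?_, fun i => ?_⟩
  · simp only [Pi.sub_apply, mul_sub, Finset.sum_sub_distrib]; ring
  · rcases h₁.2 i with h | h
    · exact Or.inl h
    · rcases h₂.2 i with h' | h'
      · exact Or.inl h'
      · exact Or.inr fun τ => by simp [h, h']

theorem IsLinSol.isSol {R : ℝ → ι → ι → ℂ} (h : IsLinSol δ R w)
    (hR : ∀ τ i l, ‖R τ i l‖ ≤ β τ) : IsSol δ β w := by
  refine ⟨_, h.1, fun τ i => ?_, h.2⟩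
  rw [add_sub_cancel_left, Finset.mul_sum]
  refine (norm_sum_le _ _).trans (Finset.sum_le_sum fun l _ => ?_)
  rw [norm_mul]
  exact mul_le_mul_of_nonneg_right (hR τ i l) (norm_nonneg _)

/-- A family of linear systems depending on `z ∈ S`, together with the solutions `W z a` that start
at time `a` at the common equilibrium `c` of the unperturbed systems. The perturbations are
bounded by `C h`, where `C` is locally uniform in `z`. -/
structure Family (S : Set ℂ) (δ : ℂ → ι → ℂ) (c : ι → ℂ) (h : ℝ → ℝ) (W : ℂ → ℝ → ℝ → ι → ℂ) :
    Prop where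
  continuous : Continuous h
  nonneg : ∀ τ, 0 ≤ h τ
  integrable : IntegrableOn h (Set.Iic 0)
  sol : ∀ z₀ ∈ S, ∃ C, 0 ≤ C ∧ ∀ᶠ z in 𝓝[S] z₀, ∃ R : ℝ → ι → ι → ℂ,
    (∀ τ i l, ‖R τ i l‖ ≤ C * h τ) ∧ ∀ a, IsLinSol (δ z) R (W z a)
  init : ∀ z ∈ S, ∀ a, W z a a = c
  equilibrium : ∀ z ∈ S, ∀ i, δ z i * c i = 0

namespace Family

variable {S : Set ℂ} {δ : ℂ → ι → ℂ} {c : ι → ℂ} {h : ℝ → ℝ} {W : ℂ → ℝ → ℝ → ι → ℂ}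

/-- The solutions started at `-n` converge at time `0` as `n → ∞`, locally uniformly in `z`. -/
theorem exists_limit (H : Family S δ c h W) : ∃ f : ℂ → ι → ℂ,
    (∀ z ∈ S, Tendsto (fun n : ℕ => W z (-(n : ℝ)) 0) atTop (𝓝 (f z))) ∧
      TendstoLocallyUniformlyOn (fun (n : ℕ) z => W z (-(n : ℝ)) 0) f atTop S := by
  refine exists_limit_of_locally_cauchy fun z₀ hz₀ => ?_
  obtain ⟨C, hC, hev⟩ := H.sol z₀ hz₀
  refine ⟨fun n => Fintype.card ι * (Fintype.card ι * (∑ i, ‖c i‖) *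
      Real.exp (Fintype.card ι * (C * ∫ s in Set.Iic 0, h s)) *
      (C * ∫ s in Set.Iic (-(n : ℝ)), h s)) *
      Real.exp (Fintype.card ι * (C * ∫ s in Set.Iic 0, h s)), ?_, ?_⟩
  · have h1 := (tendsto_tail H.integrable).comp
      (tendsto_neg_atTop_atBot.comp (tendsto_natCast_atTop_atTop (R := ℝ)))
    have h2 := ((((h1.const_mul C).const_mul (Fintype.card ι * (∑ i, ‖c i‖) *
      Real.exp (Fintype.card ι * (C * ∫ s in Set.Iic 0, h s)))).const_mul
      (Fintype.card ι : ℝ))).mul_const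
      (Real.exp (Fintype.card ι * (C * ∫ s in Set.Iic 0, h s)))
    simpa using h2
  · filter_upwards [hev, self_mem_nhdsWithin] with z hz hzS n m hnm
    obtain ⟨R, hR, hsol⟩ := hz
    have hnm' : -(m : ℝ) ≤ -(n : ℝ) := neg_le_neg (Nat.cast_le.2 hnm)
    have hn0 : -(n : ℝ) ≤ 0 := neg_nonpos.2 (Nat.cast_nonneg n)
    have ht := tail_nonneg H.nonneg (-(n : ℝ))
    have hs : 0 ≤ ∑ i, ‖c i‖ := Finset.sum_nonneg fun i _ => norm_nonneg _
    refine (pi_norm_le_iff_of_nonneg (by positivity)).2 fun i => ?_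
    exact cauchy_le H.continuous H.nonneg H.integrable hC (fun a => (hsol a).isSol hR)
      (H.init z hzS) (H.equilibrium z hzS)
      (fun a b => ((hsol a).sub (hsol b)).isSol hR) hnm' hn0 i

/-- The solutions are close to the equilibrium at early times, uniformly in the initial time. -/
theorem deviation (H : Family S δ c h W) {z : ℂ} (hz : z ∈ S) :
    ∃ b : ℝ → ℝ, Tendsto b atBot (𝓝 0) ∧ ∀ τ ≤ 0, ∀ a ≤ τ, ∀ i, ‖W z a τ i - c i‖ ≤ b τ := by
  obtain ⟨C, hC, hev⟩ := H.sol z hz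
  obtain ⟨R, hR, hsol⟩ := hev.self_of_nhdsWithin hz
  refine ⟨fun τ => Fintype.card ι * (∑ i, ‖c i‖) *
      Real.exp (Fintype.card ι * (C * ∫ s in Set.Iic 0, h s)) *
      (C * ∫ s in Set.Iic τ, h s), ?_, fun τ hτ a ha i =>
    deviation_le H.continuous H.nonneg H.integrable hC (fun a => (hsol a).isSol hR)
      (H.init z hz) (H.equilibrium z hz) ha hτ i⟩
  have h2 := ((tendsto_tail H.integrable).const_mul C).const_mul
    (Fintype.card ι * (∑ i, ‖c i‖) * Real.exp (Fintype.card ι * (C * ∫ s in Set.Iic 0, h s)))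
  simpa using h2

end Family

end Damped

/-! ### The asymptotic system and its eigenvectors -/

namespace VNLS

noncomputable section

open LinearODE Damped

attribute [local instance] Matrix.linftyOpNormedRing Matrix.linftyOpNormedAlgebra

theorem E_eq (qb z : ℂ) : E qb z = !![1, 0, 0, -(Complex.I / z * star qb); 0, 1, 0, 0; 0, 0, 1, 0;
    Complex.I / z * qb, 0, 0, 1] := by
  ext i j
  fin_cases i <;> fin_cases j <;> simp [E, J, Qmat]

theorem det_E (qb z : ℂ) : (E qb z).det = 1 - star qb * qb / z ^ 2 := by
  rw [E_eq, Matrix.det_succ_row_zero, Complex.star_def]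
  simp [Fin.sum_univ_succ, Matrix.det_fin_three, Fin.succAbove]
  linear_combination ((starRingEnd ℂ) qb * qb / z ^ 2) * Complex.I_mul_I

namespace Potential

variable (P : Potential)

/-- `γ = 1 - q_o²/z²`, the determinant of `E_±`. -/
def γ (z : ℂ) : ℂ := 1 - (P.q0 : ℂ) ^ 2 / z ^ 2

/-- The eigenvalues `-iλ, ik, ik, iλ` of the asymptotic `x`-system. -/
def ev (z : ℂ) : Fin 4 → ℂ :=
  ![-(Complex.I * P.lam z), Complex.I * P.k z, Complex.I * P.k z, Complex.I * P.lam z]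

/-- The complex plane without the origin and the branch points. -/
def regular : Set ℂ := {z | z ≠ 0 ∧ z ≠ P.q0 ∧ z ≠ -P.q0}

/-- The closed upper half plane without the origin and the branch points. -/
def closedUpper : Set ℂ := {z | 0 ≤ z.im ∧ z ∈ P.regular}

variable {P}

theorem γ_ne_zero {z : ℂ} (hz : z ∈ P.regular) : P.γ z ≠ 0 := by
  obtain ⟨h0, h1, h2⟩ := hz
  intro h
  have h3 : z ^ 2 = (P.q0 : ℂ) ^ 2 := by
    rw [γ, sub_eq_zero, eq_div_iff (pow_ne_zero 2 h0), one_mul] at h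
    exact h
  rcases sq_eq_sq_iff_eq_or_eq_neg.1 h3 with h | h
  · exact h1 h
  · exact h2 h

theorem star_mul_self_of_norm {qb : ℂ} (hq : ‖qb‖ = P.q0) : star qb * qb = (P.q0 : ℂ) ^ 2 := by
  rw [← hq, Complex.star_def, Complex.conj_mul']

theorem det_E_eq {qb : ℂ} (hq : ‖qb‖ = P.q0) (z : ℂ) : (E qb z).det = P.γ z := by
  rw [det_E, star_mul_self_of_norm hq, γ]

theorem isUnit_det_E {qb z : ℂ} (hq : ‖qb‖ = P.q0) (hz : z ∈ P.regular) :
    IsUnit (E qb z).det := by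
  rw [det_E_eq hq]; exact (γ_ne_zero hz).isUnit

theorem Einv_mul_E {qb z : ℂ} (hq : ‖qb‖ = P.q0) (hz : z ∈ P.regular) :
    (E qb z)⁻¹ * E qb z = 1 := Matrix.nonsing_inv_mul _ (isUnit_det_E hq hz)

theorem E_mul_Einv {qb z : ℂ} (hq : ‖qb‖ = P.q0) (hz : z ∈ P.regular) :
    E qb z * (E qb z)⁻¹ = 1 := Matrix.mul_nonsing_inv _ (isUnit_det_E hq hz)

/-- The columns of `E` are eigenvectors of the limit of `X`. -/
theorem Xval_mul_E {qb z : ℂ} (hq : ‖qb‖ = P.q0) (hz : z ≠ 0) :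
    Xval ![0, 0, qb] (P.k z) * E qb z = E qb z * Matrix.diagonal (P.ev z) := by
  have h := star_mul_self_of_norm hq
  rw [Complex.star_def] at h
  have hI := Complex.I_mul_I
  rw [E_eq]
  ext i j
  rw [Matrix.mul_diagonal, Matrix.mul_apply, Fin.sum_univ_four]
  fin_cases i <;> fin_cases j <;> simp [Xval, J, Qmat, ev, k, lam] <;> field_simp
  · linear_combination 2 * h
  · linear_combination 2 * z ^ 2 * (starRingEnd ℂ) qb * hI
  · linear_combination 2 * z ^ 2 * qb * hI
  · linear_combination -2 * h

theorem Einv_mul_Xval {qb z : ℂ} (hq : ‖qb‖ = P.q0) (hz : z ∈ P.regular) :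
    (E qb z)⁻¹ * Xval ![0, 0, qb] (P.k z) = Matrix.diagonal (P.ev z) * (E qb z)⁻¹ := by
  have h := congrArg (fun M => (E qb z)⁻¹ * M * (E qb z)⁻¹) (Xval_mul_E hq hz.1)
  simp only [mul_assoc, E_mul_Einv hq hz, mul_one] at h
  rw [h, ← mul_assoc, Einv_mul_E hq hz, one_mul]

theorem im_div_eq (z : ℂ) : ((P.q0 : ℂ) ^ 2 / z).im = -(P.q0 ^ 2 * z.im / Complex.normSq z) := by
  rw [← Complex.ofReal_pow, div_eq_mul_inv, Complex.im_ofReal_mul, Complex.inv_im]; ring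

theorem abs_im_k_le {z : ℂ} (hz : 0 ≤ z.im) : |(P.k z).im| ≤ (P.lam z).im := by
  have e1 : (P.k z).im = (z.im + ((P.q0 : ℂ) ^ 2 / z).im) / 2 := by
    rw [k, ← Complex.add_im]; exact Complex.div_ofNat_im _ 2
  have e2 : (P.lam z).im = (z.im - ((P.q0 : ℂ) ^ 2 / z).im) / 2 := by
    rw [lam, ← Complex.sub_im]; exact Complex.div_ofNat_im _ 2
  have h3 : 0 ≤ P.q0 ^ 2 * z.im / Complex.normSq z := by
    have := Complex.normSq_nonneg z; positivity
  rw [e1, e2, im_div_eq, abs_le]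
  constructor <;> linarith

/-- The growth rates of the four eigenvalues: `±Im λ` are the extreme ones. -/
theorem ev_re (z : ℂ) : (P.ev z 0).re = (P.lam z).im ∧ (P.ev z 1).re = -(P.k z).im ∧
    (P.ev z 2).re = -(P.k z).im ∧ (P.ev z 3).re = -(P.lam z).im := by
  simp [ev]

theorem ev_re_of_real (s : ℝ) (i : Fin 4) : (P.ev s i).re = 0 := by
  have h1 : (P.lam s).im = 0 := by
    rw [lam]; norm_cast
  have h2 : (P.k s).im = 0 := by
    rw [k]; norm_cast
  obtain ⟨e0, e1, e2, e3⟩ := ev_re (P := P) (s : ℂ)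
  fin_cases i
  · simpa [h1] using e0
  · simpa [h2] using e1
  · simpa [h2] using e2
  · simpa [h1] using e3

theorem Einv_eq {qb z : ℂ} (hq : ‖qb‖ = P.q0) (hz : z ∈ P.regular) :
    (E qb z)⁻¹ = (P.γ z)⁻¹ • !![1, 0, 0, Complex.I / z * star qb; 0, P.γ z, 0, 0;
      0, 0, P.γ z, 0; -(Complex.I / z * qb), 0, 0, 1] := by
  have hγ := γ_ne_zero hz
  have h := star_mul_self_of_norm hq
  rw [Complex.star_def] at h
  have hz0 := hz.1
  have e : 1 + Complex.I / z * (starRingEnd ℂ) qb * (Complex.I / z * qb) = P.γ z := by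
    rw [γ, ← h]
    linear_combination ((starRingEnd ℂ) qb * qb / z ^ 2) * Complex.I_mul_I
  refine Matrix.inv_eq_right_inv ?_
  rw [E_eq, Matrix.mul_smul]
  ext i j
  rw [Matrix.smul_apply, Matrix.mul_apply, Fin.sum_univ_four, smul_eq_mul,
    inv_mul_eq_iff_eq_mul₀ hγ]
  fin_cases i <;> fin_cases j <;> simp
  · rw [← e]
  · rw [← e]; ring

theorem differentiableOn_E (qb : ℂ) (i j : Fin 4) :
    DifferentiableOn ℂ (fun z => E qb z i j) {z | z ≠ 0} := by
  have h : DifferentiableOn ℂ (fun z : ℂ => Complex.I / z) {z | z ≠ 0} := fun z hz => by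
    have hz : z ≠ 0 := hz
    have : DifferentiableAt ℂ (fun z : ℂ => Complex.I / z) z := by fun_prop (disch := assumption)
    exact this.differentiableWithinAt
  simp only [E_eq]
  fin_cases i <;> fin_cases j <;> simp <;> first
    | exact differentiableOn_const _
    | exact h.mul_const _

theorem differentiableOn_γ : DifferentiableOn ℂ P.γ {z | z ≠ 0} := by
  intro z hz
  have hz2 : z ^ 2 ≠ 0 := pow_ne_zero 2 hz
  have : DifferentiableAt ℂ (fun z : ℂ => 1 - (P.q0 : ℂ) ^ 2 / z ^ 2) z := by
    fun_prop (disch := assumption)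
  exact this.differentiableWithinAt

theorem differentiableOn_Einv {qb : ℂ} (hq : ‖qb‖ = P.q0) (i j : Fin 4) :
    DifferentiableOn ℂ (fun z => (E qb z)⁻¹ i j) P.regular := by
  have h : DifferentiableOn ℂ (fun z : ℂ => Complex.I / z) P.regular := fun z hz => by
    have hz : z ≠ 0 := hz.1
    have : DifferentiableAt ℂ (fun z : ℂ => Complex.I / z) z := by fun_prop (disch := assumption)
    exact this.differentiableWithinAt
  have hγ : DifferentiableOn ℂ P.γ P.regular := differentiableOn_γ.mono fun _ hz => hz.1
  have hγi : DifferentiableOn ℂ (fun z => (P.γ z)⁻¹) P.regular :=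
    hγ.inv fun z hz => γ_ne_zero hz
  refine DifferentiableOn.congr ?_ fun z hz => by rw [Einv_eq hq hz]
  fin_cases i <;> fin_cases j <;> simp <;> first
    | exact differentiableOn_const _
    | exact hγi
    | exact hγi.mul hγ
    | exact hγi.mul (h.mul_const _)

theorem differentiableAt_k {z : ℂ} (hz : z ≠ 0) : DifferentiableAt ℂ P.k z :=
  (differentiableAt_id.add ((differentiableAt_const _).div differentiableAt_id hz)).div_const _

theorem differentiableAt_lam {z : ℂ} (hz : z ≠ 0) : DifferentiableAt ℂ P.lam z :=
  (differentiableAt_id.sub ((differentiableAt_const _).div differentiableAt_id hz)).div_const _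

theorem differentiableAt_ev {z : ℂ} (hz : z ≠ 0) (j : Fin 4) :
    DifferentiableAt ℂ (fun z => P.ev z j) z := by
  have h1 := (differentiableAt_k (P := P) hz).const_mul Complex.I
  have h2 := (differentiableAt_lam (P := P) hz).const_mul Complex.I
  fin_cases j
  · exact h2.neg
  · exact h1
  · exact h1
  · exact h2

theorem norm_Qmat_le (v : Fin 3 → ℂ) (i j : Fin 4) : ‖Qmat v i j‖ ≤ ‖v‖ := by
  have h0 := norm_nonneg v
  have h1 := norm_le_pi_norm v
  fin_cases i <;> fin_cases j <;> simp [Qmat, h0, h1]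

variable (P)

/-- One end `σ x → -∞` (`σ = ±1`) of the real line, with the boundary value `qb` there. -/
structure IsEnd (σ : ℝ) (qb : ℂ) : Prop where
  sign : σ = 1 ∨ σ = -1
  norm : ‖qb‖ = P.q0
  integrable : IntegrableOn (fun τ => P.q (σ * τ) 0 - ![0, 0, qb]) (Set.Iic 0)
  tendsto : TendstoLocallyUniformly (fun τ t => P.q (σ * τ) t) (fun _ => ![0, 0, qb]) atBot
  tendsto_dx : TendstoLocallyUniformly (fun τ t => dx P.q (σ * τ) t) (fun _ => 0) atBot

/-- The propagator of the `x`-system at `t = 0` from `x = σ a` to `x = σ τ`, written in the basis of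
asymptotic eigenvectors and divided in column `j` by the free evolution `e^{ev_j σ (τ - a)}`. -/
def prop (σ : ℝ) (qb z : ℂ) (a τ : ℝ) : Mat4 :=
  (E qb z)⁻¹ * (P.G (σ * τ) 0 (P.k z) * (P.Ginv (σ * a) 0 (P.k z) * (E qb z *
    Matrix.diagonal fun j => Complex.exp (P.ev z j * (σ * (a - τ) : ℝ)))))

variable {P}

theorem HasNZBC.isEnd_left (h : P.HasNZBC) : P.IsEnd 1 P.qm where
  sign := Or.inl rfl
  norm := h.norm_qm
  integrable := by simpa using h.integrable_left 0
  tendsto := by simpa using h.tendsto_left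
  tendsto_dx := by simpa using h.tendsto_dx_left

theorem HasNZBC.isEnd_right (h : P.HasNZBC) : P.IsEnd (-1) P.qp where
  sign := Or.inr rfl
  norm := h.norm_qp
  integrable := by
    have := h.integrable_right 0
    rw [← neg_zero] at this
    simpa using this.comp_neg_Iic
  tendsto := by
    intro u hu t
    obtain ⟨s, hs, hev⟩ := h.tendsto_right u hu t
    exact ⟨s, hs, by simpa using tendsto_neg_atBot_atTop.eventually hev⟩
  tendsto_dx := by
    intro u hu t
    obtain ⟨s, hs, hev⟩ := h.tendsto_dx_right u hu t
    exact ⟨s, hs, by simpa using tendsto_neg_atBot_atTop.eventually hev⟩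

section

variable {σ : ℝ} {qb : ℂ}

theorem prop_self (hsol : P.IsSolution) (he : P.IsEnd σ qb) {z : ℂ} (hz : z ∈ P.regular) (a : ℝ) :
    P.prop σ qb z a a = 1 := by
  rw [prop, ← mul_assoc (P.G _ _ _), hsol.G_mul_Ginv, one_mul, ← mul_assoc,
    Einv_mul_E he.norm hz, one_mul]
  simp

/-- In the basis of asymptotic eigenvectors, each column satisfies a perturbation of a diagonal
system that has the constant unit vector among its unperturbed solutions. -/
theorem hasDerivAt_prop (hsol : P.IsSolution) (he : P.IsEnd σ qb) {z : ℂ} (hz : z ∈ P.regular)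
    (a τ : ℝ) (i j : Fin 4) :
    HasDerivAt (fun τ => P.prop σ qb z a τ i j)
      ((σ * (P.ev z i - P.ev z j)) * P.prop σ qb z a τ i j + ∑ l,
        ((σ : ℂ) • ((E qb z)⁻¹ * Qmat (P.q (σ * τ) 0 - ![0, 0, qb]) * E qb z)) i l *
          P.prop σ qb z a τ l j) τ := by
  set K := P.Ginv (σ * a) 0 (P.k z)
  set D : ℝ → Mat4 := fun τ =>
    Matrix.diagonal fun j => Complex.exp (P.ev z j * (σ * (a - τ) : ℝ)) with hD
  have hDd : HasDerivAt D (D τ * Matrix.diagonal fun j => -(σ * P.ev z j)) τ := by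
    refine hasDerivAt_matrix_iff.2 fun i j => ?_
    rw [hD, Matrix.diagonal_mul_diagonal]
    by_cases hij : i = j
    · subst hij
      simp only [Matrix.diagonal_apply_eq]
      have e1 : HasDerivAt (fun τ : ℝ => σ * (a - τ)) (σ * (-1)) τ :=
        ((hasDerivAt_id τ).const_sub a).const_mul σ
      refine ((e1.ofReal_comp.const_mul (P.ev z i)).cexp).congr_deriv ?_
      push_cast; ring
    · simp only [Matrix.diagonal_apply_ne _ hij]
      exact hasDerivAt_const _ _
  have hG : HasDerivAt (fun τ => P.G (σ * τ) 0 (P.k z))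
      (σ • (Xval (P.q (σ * τ) 0) (P.k z) * P.G (σ * τ) 0 (P.k z))) τ := by
    have := (hsol.hasDerivAt_G_x (σ * τ) 0 (P.k z)).scomp τ ((hasDerivAt_id τ).const_mul σ)
    exact this.congr_deriv (by rw [mul_one])
  have h1 := (hG.fun_mul ((hDd.const_mul (E qb z)).const_mul K)).const_mul ((E qb z)⁻¹)
  refine (hasDerivAt_matrix_iff.1 h1 i j).congr_deriv ?_
  have hX : Xval (P.q (σ * τ) 0) (P.k z) =
      Xval ![0, 0, qb] (P.k z) + Qmat (P.q (σ * τ) 0 - ![0, 0, qb]) := by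
    rw [← Qmat_sub]; simp only [Xval]; abel
  have key : (E qb z)⁻¹ * (σ • (Xval (P.q (σ * τ) 0) (P.k z) * P.G (σ * τ) 0 (P.k z)) *
        (K * (E qb z * D τ)) + P.G (σ * τ) 0 (P.k z) * (K * (E qb z *
          (D τ * Matrix.diagonal fun j => -(σ * P.ev z j))))) =
      (σ : ℂ) • (Matrix.diagonal (P.ev z) * P.prop σ qb z a τ) +
      ((σ : ℂ) • ((E qb z)⁻¹ * Qmat (P.q (σ * τ) 0 - ![0, 0, qb]) * E qb z)) *
        P.prop σ qb z a τ +
      P.prop σ qb z a τ * Matrix.diagonal fun j => -(σ * P.ev z j) := by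
    have hEE : E qb z * P.prop σ qb z a τ = P.G (σ * τ) 0 (P.k z) * (K * (E qb z * D τ)) := by
      rw [prop, ← mul_assoc (E qb z), E_mul_Einv he.norm hz, one_mul]
    have e2 : Matrix.diagonal (P.ev z) * P.prop σ qb z a τ = (E qb z)⁻¹ *
        (Xval ![0, 0, qb] (P.k z) * (P.G (σ * τ) 0 (P.k z) * (K * (E qb z * D τ)))) := by
      rw [prop, ← mul_assoc, ← Einv_mul_Xval he.norm hz, mul_assoc]
    have e3 : ((σ : ℂ) • ((E qb z)⁻¹ * Qmat (P.q (σ * τ) 0 - ![0, 0, qb]) * E qb z)) *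
        P.prop σ qb z a τ = (σ : ℂ) • ((E qb z)⁻¹ * (Qmat (P.q (σ * τ) 0 - ![0, 0, qb]) *
          (P.G (σ * τ) 0 (P.k z) * (K * (E qb z * D τ))))) := by
      rw [Matrix.smul_mul, mul_assoc, hEE, mul_assoc]
    rw [e2, e3, hX, prop, ← Complex.coe_smul]
    simp only [mul_add, add_mul, Matrix.mul_smul, Matrix.smul_mul, smul_add, mul_assoc]
    rfl
  have key' := congrFun (congrFun key i) j
  refine key'.trans ?_
  rw [Matrix.add_apply, Matrix.add_apply, Matrix.mul_diagonal, Matrix.smul_apply,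
    Matrix.diagonal_mul, Matrix.mul_apply, smul_eq_mul]
  ring

end

end Potential

end

end VNLS

/-! ### Jost vectors and their exterior products at `t = 0` -/

namespace VNLS

noncomputable section

open LinearODE Damped

attribute [local instance] Matrix.linftyOpNormedRing Matrix.linftyOpNormedAlgebra

/-- The coordinates of the exterior product `u ∧ v`, as an antisymmetric array. -/
def wedge (u v : Fin 4 → ℂ) : Fin 4 → Fin 4 → ℂ := fun i l => u i * v l - u l * v i

namespace Potential

variable {P : Potential} {σ : ℝ} {qb : ℂ}

variable (P) in
/-- The solution of the `x`-system at `t = 0` that agrees at `x = σ a` with the free solutions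
`E e^{ev x}`, evaluated at `x = 0`. -/
def V (σ : ℝ) (qb z : ℂ) (a : ℝ) : Mat4 :=
  P.Ginv (σ * a) 0 (P.k z) * (E qb z *
    Matrix.diagonal fun j => Complex.exp (P.ev z j * (σ * a : ℝ)))

theorem prop_zero (z : ℂ) (a : ℝ) : P.prop σ qb z a 0 = (E qb z)⁻¹ * P.V σ qb z a := by
  rw [prop, V, mul_zero, G_zero, one_mul, sub_zero]

theorem V_eq (he : P.IsEnd σ qb) {z : ℂ} (hz : z ∈ P.regular) (a : ℝ) :
    P.V σ qb z a = E qb z * P.prop σ qb z a 0 := by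
  rw [prop_zero, ← mul_assoc, E_mul_Einv he.norm hz, one_mul]

theorem prop_eq (z : ℂ) (a τ : ℝ) :
    P.prop σ qb z a τ = (E qb z)⁻¹ * P.G (σ * τ) 0 (P.k z) * P.V σ qb z a *
      Matrix.diagonal fun j => Complex.exp (P.ev z j * (-(σ * τ) : ℝ)) := by
  have e : (Matrix.diagonal fun j => Complex.exp (P.ev z j * (σ * (a - τ) : ℝ))) =
      (Matrix.diagonal fun j => Complex.exp (P.ev z j * (σ * a : ℝ))) *
      Matrix.diagonal fun j => Complex.exp (P.ev z j * (-(σ * τ) : ℝ)) := by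
    rw [Matrix.diagonal_mul_diagonal]
    congr 1
    funext j
    rw [← Complex.exp_add]
    congr 1
    push_cast
    ring
  rw [prop, V, e]
  simp only [mul_assoc]

variable (P) in
/-- The distance of the potential from its boundary value. -/
def gap (σ : ℝ) (qb : ℂ) (τ : ℝ) : ℝ := ‖P.q (σ * τ) 0 - ![0, 0, qb]‖

theorem continuous_gap (hsol : P.IsSolution) : Continuous (P.gap σ qb) := by
  have := hsol.continuous_q.comp (by fun_prop : Continuous fun τ : ℝ => ((σ * τ, 0) : ℝ × ℝ))
  exact (this.sub continuous_const).norm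

/-- A bound for the condition number of `E`. -/
def condE (qb z : ℂ) : ℝ := ∑ i, ∑ l, ∑ a, ∑ b, ‖(E qb z)⁻¹ i a‖ * ‖E qb z b l‖

theorem norm_conj_le {qb z : ℂ} {M : Mat4} {B : ℝ} (hM : ∀ a b, ‖M a b‖ ≤ B) (i l : Fin 4) :
    ‖((E qb z)⁻¹ * M * E qb z) i l‖ ≤ condE qb z * B := by
  have hB : 0 ≤ B := (norm_nonneg _).trans (hM 0 0)
  rw [Matrix.mul_apply]
  simp only [Matrix.mul_apply, Finset.sum_mul]
  have h1 : ‖∑ b, ∑ a, (E qb z)⁻¹ i a * M a b * E qb z b l‖ ≤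
      ∑ b, ∑ a, ‖(E qb z)⁻¹ i a‖ * ‖E qb z b l‖ * B := by
    refine (norm_sum_le _ _).trans (Finset.sum_le_sum fun b _ =>
      (norm_sum_le _ _).trans (Finset.sum_le_sum fun a _ => ?_))
    rw [norm_mul, norm_mul, mul_right_comm]
    exact mul_le_mul_of_nonneg_left (hM _ _) (by positivity)
  refine h1.trans ?_
  rw [Finset.sum_comm]
  simp only [← Finset.sum_mul]
  refine mul_le_mul_of_nonneg_right ?_ hB
  rw [condE]
  refine le_trans ?_ (Finset.single_le_sum (f := fun i => ∑ l, ∑ a, ∑ b,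
    ‖(E qb z)⁻¹ i a‖ * ‖E qb z b l‖) (fun i _ => by positivity) (Finset.mem_univ i))
  exact Finset.single_le_sum (f := fun l => ∑ a, ∑ b,
    ‖(E qb z)⁻¹ i a‖ * ‖E qb z b l‖) (fun i _ => by positivity) (Finset.mem_univ l)

theorem norm_pert_le (he : P.IsEnd σ qb) (z : ℂ) (τ : ℝ) (i l : Fin 4) :
    ‖((σ : ℂ) • ((E qb z)⁻¹ * Qmat (P.q (σ * τ) 0 - ![0, 0, qb]) * E qb z)) i l‖ ≤
      condE qb z * P.gap σ qb τ := by
  have hσ : ‖(σ : ℂ)‖ = 1 := by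
    rcases he.sign with h | h <;> simp [h]
  rw [Matrix.smul_apply, smul_eq_mul, norm_mul, hσ, one_mul]
  exact norm_conj_le (fun a b => norm_Qmat_le _ a b) i l

theorem condE_nonneg (z : ℂ) : 0 ≤ condE qb z := by
  unfold condE; positivity

theorem eventually_condE_le (he : P.IsEnd σ qb) {S : Set ℂ} (hS : S ⊆ P.regular) {z₀ : ℂ}
    (hz₀ : z₀ ∈ S) : ∀ᶠ z in 𝓝[S] z₀, condE qb z ≤ condE qb z₀ + 1 := by
  have hc : ContinuousWithinAt (condE qb) S z₀ := by
    have : ContinuousOn (condE qb) P.regular := by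
      unfold condE
      refine continuousOn_finsetSum _ fun i _ => continuousOn_finsetSum _ fun l _ =>
        continuousOn_finsetSum _ fun a _ => continuousOn_finsetSum _ fun b _ => ?_
      exact (differentiableOn_Einv he.norm i a).continuousOn.norm.mul
        (((differentiableOn_E qb b l).continuousOn.mono fun _ hz => hz.1).norm)
    exact (this z₀ (hS hz₀)).mono hS
  exact (hc.eventually (gt_mem_nhds (lt_add_one _))).mono fun _ h => le_of_lt h

theorem isLinSol_col (hsol : P.IsSolution) (he : P.IsEnd σ qb) {z : ℂ} (hz : z ∈ P.regular)
    (j : Fin 4) (hre : ∀ i, ((σ : ℂ) * (P.ev z i - P.ev z j)).re ≤ 0) (a : ℝ) :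
    IsLinSol (fun i => (σ : ℂ) * (P.ev z i - P.ev z j))
      (fun τ i l => ((σ : ℂ) • ((E qb z)⁻¹ * Qmat (P.q (σ * τ) 0 - ![0, 0, qb]) * E qb z)) i l)
      (fun τ i => P.prop σ qb z a τ i j) :=
  ⟨fun τ i => hasDerivAt_prop hsol he hz a τ i j, fun i => Or.inl (hre i)⟩

/-- The product rule for exterior products, with the induced action of a matrix `R`. -/
theorem wedge_rule (R : Mat4) (e : Fin 4 → ℂ) (σ : ℂ) (w : Mat4) (i l j m : Fin 4) :
    ((σ * (e i - e j)) * w i j + ∑ y, R i y * w y j) * w l m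
      + w i j * ((σ * (e l - e m)) * w l m + ∑ y, R l y * w y m)
      - (((σ * (e l - e j)) * w l j + ∑ y, R l y * w y j) * w i m
      + w l j * ((σ * (e i - e m)) * w i m + ∑ y, R i y * w y m)) =
    σ * (e i + e l - e j - e m) * wedge (w.col j) (w.col m) i l
      + ∑ r : Fin 4 × Fin 4, ((if l = r.2 then R i r.1 else 0) + (if i = r.1 then R l r.2 else 0)) *
        wedge (w.col j) (w.col m) r.1 r.2 := by
  have e1 : ∑ r : Fin 4 × Fin 4, ((if l = r.2 then R i r.1 else 0) +
      (if i = r.1 then R l r.2 else 0)) * wedge (w.col j) (w.col m) r.1 r.2 =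
      (∑ y, R i y * wedge (w.col j) (w.col m) y l) + ∑ y, R l y * wedge (w.col j) (w.col m) i y := by
    rw [Fintype.sum_prod_type]
    simp only [add_mul, Finset.sum_add_distrib, ite_mul, zero_mul, Finset.sum_ite_eq,
      Finset.mem_univ, if_true]
    congr 1
    rw [Finset.sum_comm]
    simp
  rw [e1]
  simp only [wedge, Matrix.col_apply, Fin.sum_univ_four]
  ring

theorem norm_induced_le {R : Mat4} {B : ℝ} (hR : ∀ i l, ‖R i l‖ ≤ B) (hB : 0 ≤ B)
    (p r : Fin 4 × Fin 4) :
    ‖(if p.2 = r.2 then R p.1 r.1 else 0) + (if p.1 = r.1 then R p.2 r.2 else 0)‖ ≤ 2 * B := by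
  refine (norm_add_le _ _).trans ?_
  rw [two_mul]
  refine add_le_add ?_ ?_
  · split_ifs
    · exact hR _ _
    · rwa [norm_zero]
  · split_ifs
    · exact hR _ _
    · rwa [norm_zero]

/-- The exterior products of two columns satisfy the induced equation on bivectors. Antisymmetry
makes the components `(i, i)`, on which there is no condition on the growth rate, vanish. -/
theorem isLinSol_wedge (hsol : P.IsSolution) (he : P.IsEnd σ qb) {z : ℂ} (hz : z ∈ P.regular)
    (j m : Fin 4) (hre : ∀ i l, i ≠ l →
      ((σ : ℂ) * (P.ev z i + P.ev z l - P.ev z j - P.ev z m)).re ≤ 0) (a : ℝ) :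
    IsLinSol (fun p : Fin 4 × Fin 4 => (σ : ℂ) * (P.ev z p.1 + P.ev z p.2 - P.ev z j - P.ev z m))
      (fun τ p r =>
        (if p.2 = r.2 then
          ((σ : ℂ) • ((E qb z)⁻¹ * Qmat (P.q (σ * τ) 0 - ![0, 0, qb]) * E qb z)) p.1 r.1 else 0)
        + (if p.1 = r.1 then
          ((σ : ℂ) • ((E qb z)⁻¹ * Qmat (P.q (σ * τ) 0 - ![0, 0, qb]) * E qb z)) p.2 r.2 else 0))
      (fun τ p => wedge ((P.prop σ qb z a τ).col j) ((P.prop σ qb z a τ).col m) p.1 p.2) := by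
  refine ⟨fun τ => ?_, ?_⟩
  · rintro ⟨i, l⟩
    have h := fun i j => hasDerivAt_prop hsol he hz a τ i j
    refine (((h i j).fun_mul (h l m)).fun_sub ((h l j).fun_mul (h i m))).congr_deriv ?_
    exact wedge_rule _ (P.ev z) σ (P.prop σ qb z a τ) i l j m
  · rintro ⟨i, l⟩
    by_cases h : i = l
    · right
      intro τ
      subst h
      simp only [wedge]; ring
    · exact Or.inl (hre i l h)

theorem family_col (hsol : P.IsSolution) (he : P.IsEnd σ qb) {S : Set ℂ} (hS : S ⊆ P.regular)
    (j : Fin 4) (hre : ∀ z ∈ S, ∀ i, ((σ : ℂ) * (P.ev z i - P.ev z j)).re ≤ 0) :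
    Family S (fun z i => (σ : ℂ) * (P.ev z i - P.ev z j)) (Pi.single j 1) (P.gap σ qb)
      (fun z a τ i => P.prop σ qb z a τ i j) where
  continuous := continuous_gap hsol
  nonneg := fun _ => norm_nonneg _
  integrable := he.integrable.norm
  sol := by
    intro z₀ hz₀
    refine ⟨condE qb z₀ + 1, by have := condE_nonneg (qb := qb) z₀; positivity, ?_⟩
    filter_upwards [eventually_condE_le he hS hz₀, self_mem_nhdsWithin] with z hz hzS
    exact ⟨_, fun τ i l => (norm_pert_le he z τ i l).trans
      (mul_le_mul_of_nonneg_right hz (norm_nonneg _)),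
      fun a => isLinSol_col hsol he (hS hzS) j (hre z hzS) a⟩
  init := by
    intro z hz a
    funext i
    rw [prop_self hsol he (hS hz), Matrix.one_apply, Pi.single_apply]
  equilibrium := by
    intro z _ i
    rw [Pi.single_apply]
    split_ifs with h
    · simp [h]
    · simp

theorem family_wedge (hsol : P.IsSolution) (he : P.IsEnd σ qb) {S : Set ℂ} (hS : S ⊆ P.regular)
    (j m : Fin 4) (hre : ∀ z ∈ S, ∀ i l, i ≠ l →
      ((σ : ℂ) * (P.ev z i + P.ev z l - P.ev z j - P.ev z m)).re ≤ 0) :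
    Family S (fun z (p : Fin 4 × Fin 4) =>
        (σ : ℂ) * (P.ev z p.1 + P.ev z p.2 - P.ev z j - P.ev z m))
      (fun p => wedge (Pi.single j 1) (Pi.single m 1) p.1 p.2) (P.gap σ qb)
      (fun z a τ p => wedge ((P.prop σ qb z a τ).col j) ((P.prop σ qb z a τ).col m) p.1 p.2) where
  continuous := continuous_gap hsol
  nonneg := fun _ => norm_nonneg _
  integrable := he.integrable.norm
  sol := by
    intro z₀ hz₀
    refine ⟨2 * (condE qb z₀ + 1), by have := condE_nonneg (qb := qb) z₀; positivity, ?_⟩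
    filter_upwards [eventually_condE_le he hS hz₀, self_mem_nhdsWithin] with z hz hzS
    refine ⟨_, fun τ p r => ?_,
      fun a => isLinSol_wedge hsol he (hS hzS) j m (hre z hzS) a⟩
    have h0 : 0 ≤ (condE qb z₀ + 1) * P.gap σ qb τ :=
      mul_nonneg ((condE_nonneg z).trans hz) (norm_nonneg _)
    have hb : ∀ i l, ‖((σ : ℂ) • ((E qb z)⁻¹ * Qmat (P.q (σ * τ) 0 - ![0, 0, qb]) *
        E qb z)) i l‖ ≤ (condE qb z₀ + 1) * P.gap σ qb τ := fun i l =>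
      (norm_pert_le he z τ i l).trans (mul_le_mul_of_nonneg_right hz (norm_nonneg _))
    exact (norm_induced_le hb h0 p r).trans_eq (mul_assoc _ _ _).symm
  init := by
    intro z hz a
    have e : ∀ j, (P.prop σ qb z a a).col j = Pi.single j 1 := fun j => by
      funext i
      rw [prop_self hsol he (hS hz), Matrix.col_apply, Matrix.one_apply, Pi.single_apply]
    funext p
    rw [e, e]
  equilibrium := by
    rintro z _ ⟨i, l⟩
    simp only [wedge, Pi.single_apply]
    split_ifs <;> simp_all

end Potential

end

end VNLS

/-! ### Limits of the Jost vectors -/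

namespace VNLS

noncomputable section

open LinearODE Damped

attribute [local instance] Matrix.linftyOpNormedRing Matrix.linftyOpNormedAlgebra

theorem differentiableAt_matrix_iff {F : ℂ → Mat4} {z : ℂ} :
    DifferentiableAt ℂ F z ↔ ∀ i j, DifferentiableAt ℂ (fun z => F z i j) z :=
  ⟨fun h i j => (hasDerivAt_matrix_iff.1 h.hasDerivAt i j).differentiableAt, fun h =>
    HasDerivAt.differentiableAt (f' := (Matrix.of fun i j => deriv (fun z => F z i j) z : Mat4))
      (hasDerivAt_matrix_iff.2 fun i j => (h i j).hasDerivAt)⟩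

theorem wedge_mulVec (M : Mat4) (u v : Fin 4 → ℂ) (i l : Fin 4) :
    wedge (M.mulVec u) (M.mulVec v) i l = ∑ a, ∑ b, M i a * M l b * wedge u v a b := by
  have e : ∀ u v : Fin 4 → ℂ, ∀ i l, M.mulVec u i * M.mulVec v l =
      ∑ a, ∑ b, M i a * M l b * (u a * v b) := by
    intro u v i l
    simp only [Matrix.mulVec, dotProduct]
    rw [Finset.sum_mul_sum]
    exact Finset.sum_congr rfl fun a _ => Finset.sum_congr rfl fun b _ => by ring
  have e2 : M.mulVec u l * M.mulVec v i = ∑ a, ∑ b, M i a * M l b * (u b * v a) := by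
    rw [mul_comm, e v u i l]
    exact Finset.sum_congr rfl fun a _ => Finset.sum_congr rfl fun b _ => by ring
  simp only [wedge]
  rw [e u v i l, e2]
  simp only [← Finset.sum_sub_distrib, mul_sub]

theorem wedge_smul_smul (c d : ℂ) (u v : Fin 4 → ℂ) (i l : Fin 4) :
    wedge (c • u) (d • v) i l = c * d * wedge u v i l := by
  simp only [wedge, Pi.smul_apply, smul_eq_mul]; ring

namespace Potential

variable {P : Potential} {σ : ℝ} {qb : ℂ}

theorem regular_isOpen : IsOpen P.regular :=
  (isOpen_ne (x := (0 : ℂ))).inter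
    ((isOpen_ne (x := (P.q0 : ℂ))).inter (isOpen_ne (x := -(P.q0 : ℂ))))

theorem differentiable_Ginv (h : P.IsSolution) (x t : ℝ) :
    Differentiable ℂ fun k => P.Ginv x t k := by
  intro k
  have e : (fun k => P.Ginv x t k) = fun k => Ring.inverse (P.G x t k) := by
    funext k
    exact (Ring.inverse_unit ⟨P.G x t k, P.Ginv x t k, h.G_mul_Ginv x t k,
      h.Ginv_mul_G x t k⟩).symm
  rw [e]
  have h1 := differentiableAt_inverse (𝕜 := ℂ) (x := P.G x t k)
    (Units.isUnit ⟨P.G x t k, P.Ginv x t k, h.G_mul_Ginv x t k, h.Ginv_mul_G x t k⟩)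
  exact h1.comp k (h.differentiable_G x t k)

theorem differentiableAt_E {z : ℂ} (hz : z ≠ 0) : DifferentiableAt ℂ (fun z => E qb z) z :=
  differentiableAt_matrix_iff.2 fun i j =>
    (differentiableOn_E qb i j).differentiableAt (isOpen_ne.mem_nhds hz)

theorem differentiableAt_Einv (hq : ‖qb‖ = P.q0) {z : ℂ} (hz : z ∈ P.regular) :
    DifferentiableAt ℂ (fun z => (E qb z)⁻¹) z :=
  differentiableAt_matrix_iff.2 fun i j =>
    (differentiableOn_Einv hq i j).differentiableAt (regular_isOpen.mem_nhds hz)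

theorem differentiableAt_V (h : P.IsSolution) {z : ℂ} (hz : z ≠ 0) (a : ℝ) :
    DifferentiableAt ℂ (fun z => P.V σ qb z a) z := by
  have h1 : DifferentiableAt ℂ (fun z => P.Ginv (σ * a) 0 (P.k z)) z :=
    (differentiable_Ginv h (σ * a) 0 _).comp z (differentiableAt_k hz)
  have h2 : DifferentiableAt ℂ (fun z => (Matrix.diagonal fun j =>
      Complex.exp (P.ev z j * (σ * a : ℝ)) : Mat4)) z := by
    refine differentiableAt_matrix_iff.2 fun i j => ?_
    by_cases hij : i = j
    · subst hij
      simp only [Matrix.diagonal_apply_eq]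
      exact ((differentiableAt_ev hz i).mul_const _).cexp
    · simp only [Matrix.diagonal_apply_ne _ hij]
      exact differentiableAt_const _
  exact h1.fun_mul ((differentiableAt_E hz).fun_mul h2)

theorem differentiableAt_prop_zero (h : P.IsSolution) (he : P.IsEnd σ qb) {z : ℂ}
    (hz : z ∈ P.regular) (a : ℝ) : DifferentiableAt ℂ (fun z => P.prop σ qb z a 0) z := by
  simp only [prop_zero]
  exact (differentiableAt_Einv he.norm hz).fun_mul (differentiableAt_V h hz.1 a)

theorem V_col (he : P.IsEnd σ qb) {z : ℂ} (hz : z ∈ P.regular) (a : ℝ) (j : Fin 4) :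
    (P.V σ qb z a).col j = (E qb z).mulVec ((P.prop σ qb z a 0).col j) := by
  rw [V_eq he hz]; rfl

theorem prop_col (z : ℂ) (a τ : ℝ) (j : Fin 4) :
    (P.prop σ qb z a τ).col j = Complex.exp (P.ev z j * (-(σ * τ) : ℝ)) •
      ((E qb z)⁻¹ * P.G (σ * τ) 0 (P.k z)).mulVec ((P.V σ qb z a).col j) := by
  funext i
  rw [Matrix.col_apply, prop_eq, Matrix.mul_diagonal, mul_comm]
  rfl

/-- The limits of the columns `V_j` along which the growth rate is extreme. They do not vanish, since
they are close to the eigenvectors of the asymptotic system far away. -/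
theorem exists_col_limit (hsol : P.IsSolution) (he : P.IsEnd σ qb) {S : Set ℂ}
    (hS : S ⊆ P.regular) (j : Fin 4)
    (hre : ∀ z ∈ S, ∀ i, ((σ : ℂ) * (P.ev z i - P.ev z j)).re ≤ 0) :
    ∃ f : ℂ → Fin 4 → ℂ,
      (∀ z ∈ S, Tendsto (fun n : ℕ => (P.V σ qb z (-(n : ℝ))).col j) atTop (𝓝 (f z))) ∧
      ContinuousOn f S ∧ (∀ U ⊆ S, IsOpen U → DifferentiableOn ℂ f U) ∧ ∀ z ∈ S, f z ≠ 0 := by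
  have H := family_col hsol he hS j hre
  obtain ⟨g, hg, hgu⟩ := H.exists_limit
  have hpd : ∀ (n : ℕ), ∀ z ∈ S,
      DifferentiableAt ℂ (fun z i => P.prop σ qb z (-(n : ℝ)) 0 i j) z := fun n z hz =>
    differentiableAt_pi.2 fun i =>
      differentiableAt_matrix_iff.1 (differentiableAt_prop_zero hsol he (hS hz) _) i j
  have hgc : ContinuousOn g S := hgu.continuousOn (Frequently.of_forall fun n z hz =>
    (hpd n z hz).continuousAt.continuousWithinAt)
  have hgd : ∀ U ⊆ S, IsOpen U → DifferentiableOn ℂ g U := fun U hU hUo =>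
    (hgu.mono hU).differentiableOn (Eventually.of_forall fun n z hz =>
      (hpd n z (hU hz)).differentiableWithinAt) hUo
  have hlim : ∀ z ∈ S, Tendsto (fun n : ℕ => (P.V σ qb z (-(n : ℝ))).col j) atTop
      (𝓝 ((E qb z).mulVec (g z))) := by
    intro z hz
    have h1 : Continuous fun v : Fin 4 → ℂ => (E qb z).mulVec v :=
      continuous_const.matrix_mulVec continuous_id
    have h2 := (h1.tendsto (g z)).comp (hg z hz)
    refine h2.congr fun n => ?_
    rw [V_col he (hS hz)]
    rfl
  refine ⟨fun z => (E qb z).mulVec (g z), hlim, ?_, ?_, ?_⟩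
  · refine continuousOn_pi.2 fun i => ?_
    simp only [Matrix.mulVec, dotProduct]
    refine continuousOn_finsetSum _ fun l _ => ContinuousOn.mul ?_ (continuousOn_pi.1 hgc l)
    exact (differentiableOn_E qb i l).continuousOn.mono fun z hz => (hS hz).1
  · intro U hU hUo
    refine differentiableOn_pi.2 fun i => ?_
    simp only [Matrix.mulVec, dotProduct]
    refine DifferentiableOn.fun_sum fun l _ =>
      DifferentiableOn.fun_mul ?_ (differentiableOn_pi.1 (hgd U hU hUo) l)
    exact (differentiableOn_E qb i l).mono fun z hz => (hS (hU hz)).1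
  · intro z hz h0
    obtain ⟨b, hb, hdev⟩ := H.deviation hz
    obtain ⟨τ, hτb, hτ0⟩ := ((hb.eventually (gt_mem_nhds one_pos)).and
      (eventually_le_atBot (0 : ℝ))).exists
    have h1 : Tendsto (fun n : ℕ => (P.prop σ qb z (-(n : ℝ)) τ).col j) atTop (𝓝 0) := by
      simp only [prop_col]
      have h0 : (E qb z).mulVec (g z) = 0 := h0
      have h2 := hlim z hz
      rw [h0] at h2
      have h3 : Continuous fun v : Fin 4 → ℂ => Complex.exp (P.ev z j * (-(σ * τ) : ℝ)) •
          ((E qb z)⁻¹ * P.G (σ * τ) 0 (P.k z)).mulVec v :=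
        (Continuous.matrix_mulVec continuous_const continuous_id).fun_const_smul _
      have h4 := (h3.tendsto 0).comp h2
      rw [Matrix.mulVec_zero, smul_zero] at h4
      exact h4
    have h5 : ‖(0 : ℂ) - 1‖ ≤ b τ := by
      refine le_of_tendsto (((tendsto_pi_nhds.1 h1 j).sub_const 1).norm) ?_
      filter_upwards [(tendsto_natCast_atTop_atTop (R := ℝ)).eventually_ge_atTop (-τ)] with n hn
      have := hdev τ hτ0 (-(n : ℝ)) (by linarith) j
      rwa [Pi.single_eq_same] at this
    rw [zero_sub, norm_neg, norm_one] at h5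
    linarith

/-- The limits of the exterior products `V_j ∧ V_m` along which the growth rate is extreme. -/
theorem exists_wedge_limit (hsol : P.IsSolution) (he : P.IsEnd σ qb) {S : Set ℂ}
    (hS : S ⊆ P.regular) {j m : Fin 4} (hjm : j ≠ m)
    (hre : ∀ z ∈ S, ∀ i l, i ≠ l →
      ((σ : ℂ) * (P.ev z i + P.ev z l - P.ev z j - P.ev z m)).re ≤ 0) :
    ∃ f : ℂ → Fin 4 → Fin 4 → ℂ,
      (∀ z ∈ S, Tendsto (fun n : ℕ =>
        wedge ((P.V σ qb z (-(n : ℝ))).col j) ((P.V σ qb z (-(n : ℝ))).col m)) atTop (𝓝 (f z))) ∧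
      ContinuousOn f S ∧ (∀ U ⊆ S, IsOpen U → DifferentiableOn ℂ f U) ∧ ∀ z ∈ S, f z ≠ 0 := by
  have H := family_wedge hsol he hS j m hre
  obtain ⟨g, hg, hgu⟩ := H.exists_limit
  have hpd : ∀ (n : ℕ), ∀ z ∈ S, DifferentiableAt ℂ (fun z (p : Fin 4 × Fin 4) =>
      wedge ((P.prop σ qb z (-(n : ℝ)) 0).col j) ((P.prop σ qb z (-(n : ℝ)) 0).col m) p.1 p.2) z := by
    intro n z hz
    have h := differentiableAt_matrix_iff.1
      (differentiableAt_prop_zero hsol he (hS hz) (-(n : ℝ)))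
    exact differentiableAt_pi.2 fun p =>
      ((h p.1 j).fun_mul (h p.2 m)).fun_sub ((h p.2 j).fun_mul (h p.1 m))
  have hgc : ContinuousOn g S := hgu.continuousOn (Frequently.of_forall fun n z hz =>
    (hpd n z hz).continuousAt.continuousWithinAt)
  have hgd : ∀ U ⊆ S, IsOpen U → DifferentiableOn ℂ g U := fun U hU hUo =>
    (hgu.mono hU).differentiableOn (Eventually.of_forall fun n z hz =>
      (hpd n z (hU hz)).differentiableWithinAt) hUo
  set f : ℂ → Fin 4 → Fin 4 → ℂ := fun z i l => ∑ a, ∑ b, E qb z i a * E qb z l b * g z (a, b)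
    with hf
  have hlim : ∀ z ∈ S, Tendsto (fun n : ℕ =>
      wedge ((P.V σ qb z (-(n : ℝ))).col j) ((P.V σ qb z (-(n : ℝ))).col m)) atTop (𝓝 (f z)) := by
    intro z hz
    refine tendsto_pi_nhds.2 fun i => tendsto_pi_nhds.2 fun l => ?_
    simp only [V_col he (hS hz), wedge_mulVec]
    exact tendsto_finsetSum _ fun a _ => tendsto_finsetSum _ fun b _ =>
      (tendsto_pi_nhds.1 (hg z hz) (a, b)).const_mul _
  refine ⟨f, hlim, ?_, ?_, ?_⟩
  · refine continuousOn_pi.2 fun i => continuousOn_pi.2 fun l => ?_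
    refine continuousOn_finsetSum _ fun a _ => continuousOn_finsetSum _ fun b _ =>
      ContinuousOn.mul (ContinuousOn.mul ?_ ?_) (continuousOn_pi.1 hgc (a, b))
    · exact (differentiableOn_E qb i a).continuousOn.mono fun z hz => (hS hz).1
    · exact (differentiableOn_E qb l b).continuousOn.mono fun z hz => (hS hz).1
  · intro U hU hUo
    refine differentiableOn_pi.2 fun i => differentiableOn_pi.2 fun l => ?_
    refine DifferentiableOn.fun_sum fun a _ => DifferentiableOn.fun_sum fun b _ =>
      DifferentiableOn.fun_mul (DifferentiableOn.fun_mul ?_ ?_)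
        (differentiableOn_pi.1 (hgd U hU hUo) (a, b))
    · exact (differentiableOn_E qb i a).mono fun z hz => (hS (hU hz)).1
    · exact (differentiableOn_E qb l b).mono fun z hz => (hS (hU hz)).1
  · intro z hz h0
    obtain ⟨b, hb, hdev⟩ := H.deviation hz
    obtain ⟨τ, hτb, hτ0⟩ := ((hb.eventually (gt_mem_nhds one_pos)).and
      (eventually_le_atBot (0 : ℝ))).exists
    have h1 : Tendsto (fun n : ℕ => wedge ((P.prop σ qb z (-(n : ℝ)) τ).col j)
        ((P.prop σ qb z (-(n : ℝ)) τ).col m) j m) atTop (𝓝 0) := by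
      simp only [prop_col, wedge_smul_smul, wedge_mulVec]
      have h2 := hlim z hz
      rw [h0] at h2
      have h3 : Tendsto (fun n : ℕ => ∑ a, ∑ b, ((E qb z)⁻¹ * P.G (σ * τ) 0 (P.k z)) j a *
          ((E qb z)⁻¹ * P.G (σ * τ) 0 (P.k z)) m b *
          wedge ((P.V σ qb z (-(n : ℝ))).col j) ((P.V σ qb z (-(n : ℝ))).col m) a b) atTop
          (𝓝 (∑ a, ∑ b, ((E qb z)⁻¹ * P.G (σ * τ) 0 (P.k z)) j a *
          ((E qb z)⁻¹ * P.G (σ * τ) 0 (P.k z)) m b * (0 : Fin 4 → Fin 4 → ℂ) a b)) :=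
        tendsto_finsetSum _ fun a _ => tendsto_finsetSum _ fun b _ =>
          (tendsto_pi_nhds.1 (tendsto_pi_nhds.1 h2 a) b).const_mul _
      have h4 := h3.const_mul
        (Complex.exp (P.ev z j * (-(σ * τ) : ℝ)) * Complex.exp (P.ev z m * (-(σ * τ) : ℝ)))
      simpa using h4
    have h5 : ‖(0 : ℂ) - 1‖ ≤ b τ := by
      refine le_of_tendsto ((h1.sub_const 1).norm) ?_
      filter_upwards [(tendsto_natCast_atTop_atTop (R := ℝ)).eventually_ge_atTop (-τ)] with n hn
      have := hdev τ hτ0 (-(n : ℝ)) (by linarith) (j, m)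
      have e : wedge (Pi.single j 1) (Pi.single m 1) j m = 1 := by
        simp [wedge, hjm, hjm.symm]
      rwa [e] at this
    rw [zero_sub, norm_neg, norm_one] at h5
    linarith

/-- On the continuous spectrum all columns converge. -/
theorem exists_real_limit (hsol : P.IsSolution) (he : P.IsEnd σ qb) {s : ℝ}
    (hs : (s : ℂ) ∈ P.regular) :
    ∃ C : Mat4, Tendsto (fun n : ℕ => P.V σ qb s (-(n : ℝ))) atTop (𝓝 C) ∧
      Tendsto (fun τ : ℝ => (E qb s)⁻¹ * P.G (σ * τ) 0 (P.k s) * C *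
        Matrix.diagonal fun j => Complex.exp (P.ev s j * (-(σ * τ) : ℝ))) atBot (𝓝 1) := by
  have hS : ({(s : ℂ)} : Set ℂ) ⊆ P.regular := Set.singleton_subset_iff.2 hs
  have hre : ∀ j, ∀ z ∈ ({(s : ℂ)} : Set ℂ), ∀ i,
      ((σ : ℂ) * (P.ev z i - P.ev z j)).re ≤ 0 := by
    rintro j z rfl i
    rw [Complex.re_ofReal_mul, Complex.sub_re, ev_re_of_real, ev_re_of_real]
    simp
  have H := fun j => family_col hsol he hS j (hre j)
  have h1 := fun j => exists_col_limit hsol he hS j (hre j)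
  choose f hf _ _ _ using h1
  have hlim : Tendsto (fun n : ℕ => P.V σ qb s (-(n : ℝ))) atTop
      (𝓝 (Matrix.of fun i j => f j s i)) :=
    tendsto_pi_nhds.2 fun i => tendsto_pi_nhds.2 fun j =>
      tendsto_pi_nhds.1 (hf j s rfl) i
  refine ⟨_, hlim, ?_⟩
  refine tendsto_pi_nhds.2 fun i => tendsto_pi_nhds.2 fun j => ?_
  obtain ⟨b, hb, hdev⟩ := (H j).deviation (z := (s : ℂ)) rfl
  rw [tendsto_iff_norm_sub_tendsto_zero]
  refine tendsto_of_tendsto_of_tendsto_of_le_of_le' tendsto_const_nhds hb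
    (Eventually.of_forall fun _ => norm_nonneg _) ?_
  filter_upwards [eventually_le_atBot (0 : ℝ)] with τ hτ
  have h2 : Tendsto (fun n : ℕ => P.prop σ qb s (-(n : ℝ)) τ) atTop
      (𝓝 ((E qb s)⁻¹ * P.G (σ * τ) 0 (P.k s) * (Matrix.of fun i j => f j s i) *
        Matrix.diagonal fun j => Complex.exp (P.ev s j * (-(σ * τ) : ℝ)))) := by
    simp only [prop_eq]
    exact (hlim.const_mul _).mul_const _
  have h3 := ((tendsto_pi_nhds.1 (tendsto_pi_nhds.1 h2 i) j).sub_const ((1 : Mat4) i j)).norm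
  refine le_of_tendsto h3 ?_
  filter_upwards [(tendsto_natCast_atTop_atTop (R := ℝ)).eventually_ge_atTop (-τ)] with n hn
  have := hdev τ hτ (-(n : ℝ)) (by linarith) i
  rwa [Pi.single_apply, ← Matrix.one_apply] at this

end Potential

end

end VNLS

/-! ### Jost eigenfunctions on the continuous spectrum -/

namespace VNLS

noncomputable section

open LinearODE Damped

attribute [local instance] Matrix.linftyOpNormedRing Matrix.linftyOpNormedAlgebra

theorem tendsto_diagonal_mul {l : Filter ℝ} {u : ℝ → Fin 4 → ℂ} (hu : ∀ x i, ‖u x i‖ = 1)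
    {f : ℝ → Mat4} (hf : Tendsto f l (𝓝 0)) :
    Tendsto (fun x => Matrix.diagonal (u x) * f x) l (𝓝 0) := by
  refine tendsto_pi_nhds.2 fun i => tendsto_pi_nhds.2 fun j => ?_
  have h := (tendsto_pi_nhds.1 (tendsto_pi_nhds.1 hf i) j).norm
  refine squeeze_zero_norm (fun x => le_of_eq ?_) (by simpa using h)
  rw [Matrix.diagonal_mul, norm_mul, hu, one_mul]

theorem tendsto_mul_diagonal {l : Filter ℝ} {u : ℝ → Fin 4 → ℂ} (hu : ∀ x i, ‖u x i‖ = 1)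
    {f : ℝ → Mat4} (hf : Tendsto f l (𝓝 0)) :
    Tendsto (fun x => f x * Matrix.diagonal (u x)) l (𝓝 0) := by
  refine tendsto_pi_nhds.2 fun i => tendsto_pi_nhds.2 fun j => ?_
  have h := (tendsto_pi_nhds.1 (tendsto_pi_nhds.1 hf i) j).norm
  refine squeeze_zero_norm (fun x => le_of_eq ?_) (by simpa using h)
  rw [Matrix.mul_diagonal, norm_mul, hu, mul_one]

namespace Potential

variable {P : Potential} {σ : ℝ} {qb : ℂ}

theorem k_im_of_real (s : ℝ) : (P.k s).im = 0 := by rw [k]; norm_cast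

theorem lam_im_of_real (s : ℝ) : (P.lam s).im = 0 := by rw [lam]; norm_cast

theorem conj_k_of_real (s : ℝ) : star (P.k s) = P.k s := Complex.conj_eq_iff_im.2 (k_im_of_real s)

/-- `Γ = diag(γ, -1, -1, -γ)`, the common value of `φ_±^† J φ_±` on the continuous spectrum. -/
def Γ (P : Potential) (z : ℂ) : Mat4 := Matrix.diagonal ![P.γ z, -1, -1, -P.γ z]

theorem E_conj_J_E (hq : ‖qb‖ = P.q0) (s : ℝ) (hs : s ≠ 0) :
    (E qb s).conjTranspose * J * E qb s = P.Γ s := by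
  have h := star_mul_self_of_norm hq
  rw [Complex.star_def] at h
  have hs' : (s : ℂ) ≠ 0 := Complex.ofReal_ne_zero.2 hs
  have hI := Complex.I_mul_I
  rw [E_eq]
  ext i j
  rw [Matrix.mul_apply, Fin.sum_univ_four]
  fin_cases i <;> fin_cases j <;> simp [Matrix.mul_apply, Fin.sum_univ_four, J, Γ, γ]
  · field_simp; linear_combination (-1) * h + (starRingEnd ℂ) qb * qb * hI
  · ring
  · ring
  · field_simp; linear_combination h - (starRingEnd ℂ) qb * qb * hI

theorem hasDerivAt_G_conj (h : P.IsSolution) (s x : ℝ) :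
    HasDerivAt (fun x => (P.G x 0 (P.k s)).conjTranspose * J * P.G x 0 (P.k s)) 0 x := by
  have h1 := h.hasDerivAt_G_x x 0 (P.k s)
  have h2 := ((hasDerivAt_conjTranspose h1).mul_const J).fun_mul h1
  refine h2.congr_deriv ?_
  have hX : (Xval (P.q x 0) (P.k s)).conjTranspose * J + J * Xval (P.q x 0) (P.k s) = 0 := by
    have hk := conj_k_of_real (P := P) s
    rw [Complex.star_def] at hk
    ext i j
    rw [Matrix.add_apply, Matrix.mul_apply, Matrix.mul_apply, Fin.sum_univ_four, Fin.sum_univ_four]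
    fin_cases i <;> fin_cases j <;> simp [Xval, J, Qmat, hk]
  rw [Matrix.conjTranspose_mul]
  have e : ∀ (A X B : Mat4), A * X.conjTranspose * J * B + A * J * (X * B) =
      A * (X.conjTranspose * J + J * X) * B := fun A X B => by noncomm_ring
  rw [e, hX]; simp

theorem G_conj_J_G (h : P.IsSolution) (s x : ℝ) :
    (P.G x 0 (P.k s)).conjTranspose * J * P.G x 0 (P.k s) = J := by
  have := matrix_eq_of_deriv_zero (hasDerivAt_G_conj h s) x 0
  simpa [G_zero] using this

theorem Ginv_conj_J_Ginv (h : P.IsSolution) (s x : ℝ) :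
    (P.Ginv x 0 (P.k s)).conjTranspose * J * P.Ginv x 0 (P.k s) = J := by
  have h1 := h.G_mul_Ginv x 0 (P.k s)
  have h2 : (P.Ginv x 0 (P.k s)).conjTranspose * (P.G x 0 (P.k s)).conjTranspose = 1 := by
    rw [← Matrix.conjTranspose_mul, h1, Matrix.conjTranspose_one]
  calc _ = (P.Ginv x 0 (P.k s)).conjTranspose * ((P.G x 0 (P.k s)).conjTranspose * J *
        P.G x 0 (P.k s)) * P.Ginv x 0 (P.k s) := by rw [G_conj_J_G h]
    _ = ((P.Ginv x 0 (P.k s)).conjTranspose * (P.G x 0 (P.k s)).conjTranspose) * J *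
        (P.G x 0 (P.k s) * P.Ginv x 0 (P.k s)) := by simp only [mul_assoc]
    _ = J := by rw [h1, h2]; simp

theorem norm_exp_ev_of_real (s r : ℝ) (j : Fin 4) : ‖Complex.exp (P.ev s j * (r : ℝ))‖ = 1 := by
  rw [Complex.norm_exp, Complex.re_mul_ofReal, ev_re_of_real, zero_mul, Real.exp_zero]

/-- The conserved form: on the real line `X` is skew with respect to `J`. -/
theorem V_conj_J_V (h : P.IsSolution) (hq : ‖qb‖ = P.q0) {s : ℝ} (hs : s ≠ 0) (a : ℝ) :
    (P.V σ qb s a).conjTranspose * J * P.V σ qb s a = P.Γ s := by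
  set D : Mat4 := Matrix.diagonal fun j => Complex.exp (P.ev s j * (σ * a : ℝ)) with hD
  have h1 : (P.V σ qb s a).conjTranspose * J * P.V σ qb s a =
      D.conjTranspose * ((E qb s).conjTranspose * ((P.Ginv (σ * a) 0 (P.k s)).conjTranspose * J *
        P.Ginv (σ * a) 0 (P.k s)) * E qb s) * D := by
    rw [V, Matrix.conjTranspose_mul, Matrix.conjTranspose_mul]
    simp only [mul_assoc, hD]
  rw [h1, Ginv_conj_J_Ginv h, E_conj_J_E hq s hs, Γ, hD, Matrix.diagonal_conjTranspose,
    Matrix.diagonal_mul_diagonal, Matrix.diagonal_mul_diagonal]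
  congr 1
  funext j
  have := norm_exp_ev_of_real (P := P) s (σ * a) j
  have e : star (Complex.exp (P.ev s j * (σ * a : ℝ))) * Complex.exp (P.ev s j * (σ * a : ℝ)) = 1 := by
    rw [Complex.star_def, Complex.conj_mul', this]; simp
  rw [Pi.star_apply, mul_right_comm, e, one_mul]

theorem det_V (h : P.IsSolution) (hq : ‖qb‖ = P.q0) (z : ℂ) (a : ℝ) :
    (P.V σ qb z a).det = P.γ z := by
  have h1 : (P.Ginv (σ * a) 0 (P.k z)).det * (P.G (σ * a) 0 (P.k z)).det = 1 := by
    rw [← Matrix.det_mul, h.Ginv_mul_G, Matrix.det_one]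
  rw [h.det_G_x] at h1
  rw [V, Matrix.det_mul, Matrix.det_mul, det_E_eq hq, Matrix.det_diagonal, ← Complex.exp_sum]
  have e : ∑ j, P.ev z j * ((σ * a : ℝ) : ℂ) = 2 * Complex.I * P.k z * (σ * a : ℝ) := by
    simp [Fin.sum_univ_four, ev]; ring
  rw [e]
  linear_combination P.γ z * h1

end Potential

end

end VNLS

/-! ### Evolution in time of the normalization -/

namespace VNLS

noncomputable section

open LinearODE Damped

attribute [local instance] Matrix.linftyOpNormedRing Matrix.linftyOpNormedAlgebra

namespace Potential

variable {P : Potential} {σ : ℝ} {qb : ℂ}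

/-- The time frequencies of the asymptotic Lax pair, `∂_t (iΘ)`. -/
def tev (P : Potential) (z : ℂ) : Fin 4 → ℂ :=
  ![2 * Complex.I * P.k z * P.lam z, -(Complex.I * (P.k z ^ 2 + P.lam z ^ 2)),
    -(Complex.I * (P.k z ^ 2 + P.lam z ^ 2)), -(2 * Complex.I * P.k z * P.lam z)]

theorem I_mul_Θ (x t : ℝ) (z : ℂ) (j : Fin 4) :
    Complex.I * P.Θ x t z j = P.ev z j * x + P.tev z j * t := by
  fin_cases j <;> simp [Θ, θ₁, θ₂, ev, tev] <;> ring

/-- The columns of `E` are eigenvectors of the limit of `T`. -/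
theorem Tval_mul_E (hq : ‖qb‖ = P.q0) {z : ℂ} (hz : z ≠ 0) :
    Tval P.q0 ![0, 0, qb] 0 (P.k z) * E qb z = E qb z * Matrix.diagonal (P.tev z) := by
  have h := star_mul_self_of_norm hq
  rw [Complex.star_def] at h
  have hI := Complex.I_mul_I
  have hT : Tval P.q0 ![0, 0, qb] 0 (P.k z) =
      !![2 * Complex.I * P.k z ^ 2, 0, 0, -(2 * P.k z * (starRingEnd ℂ) qb);
        0, Complex.I * ((P.q0 : ℂ) ^ 2 - 2 * P.k z ^ 2), 0, 0;
        0, 0, Complex.I * ((P.q0 : ℂ) ^ 2 - 2 * P.k z ^ 2), 0;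
        -(2 * P.k z * qb), 0, 0, -(2 * Complex.I * P.k z ^ 2)] := by
    ext i j
    fin_cases i <;> fin_cases j <;>
      simp [Tval, J, Qmat, pow_two, Matrix.mul_apply, Fin.sum_univ_four, Matrix.one_apply] <;>
      first
      | ring1
      | linear_combination h
      | linear_combination -h
  rw [hT, E_eq, Complex.star_def]
  ext i j
  rw [Matrix.mul_diagonal, Matrix.mul_apply, Fin.sum_univ_four]
  fin_cases i <;> fin_cases j <;> simp [tev, k, lam] <;> field_simp
  · linear_combination (-(2 * z ^ 2) - 2 * (P.q0 : ℂ) ^ 2) * h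
  · linear_combination (-(2 * z ^ 2 * (P.q0 : ℂ) ^ 2) - 2 * z ^ 4) * (starRingEnd ℂ) qb * hI
  · ring
  · ring
  · linear_combination (-(2 * z ^ 2 * (P.q0 : ℂ) ^ 2) - 2 * z ^ 4) * qb * hI
  · linear_combination (2 * z ^ 2 + 2 * (P.q0 : ℂ) ^ 2) * h

theorem Einv_mul_Tval (hq : ‖qb‖ = P.q0) {z : ℂ} (hz : z ∈ P.regular) :
    (E qb z)⁻¹ * Tval P.q0 ![0, 0, qb] 0 (P.k z) = Matrix.diagonal (P.tev z) * (E qb z)⁻¹ := by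
  have h := congrArg (fun M => (E qb z)⁻¹ * M * (E qb z)⁻¹) (Tval_mul_E hq hz.1)
  simp only [mul_assoc, E_mul_Einv hq hz, mul_one] at h
  rw [h, ← mul_assoc, Einv_mul_E hq hz, one_mul]

theorem norm_exp_Θ_of_real (s x t : ℝ) (j : Fin 4) : ‖Complex.exp (Complex.I * P.Θ x t s j)‖ = 1 := by
  have h1 : (P.Θ x t s j).im = 0 := by
    have hk := conj_k_of_real (P := P) s
    have hl : star (P.lam s) = P.lam s := Complex.conj_eq_iff_im.2 (lam_im_of_real s)
    rw [Complex.star_def] at hk hl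
    refine Complex.conj_eq_iff_im.1 ?_
    fin_cases j <;> simp [Θ, θ₁, θ₂, hk, hl, map_ofNat (starRingEnd ℂ) 2]
  rw [Complex.norm_exp, Complex.I_mul_re, h1]; simp

theorem norm_exp_neg_Θ_of_real (s x t : ℝ) (j : Fin 4) :
    ‖Complex.exp (-(Complex.I * P.Θ x t s j))‖ = 1 := by
  rw [Complex.exp_neg, norm_inv, norm_exp_Θ_of_real, inv_one]

/-- `e^{-iΘ} E⁻¹ G C`: the solution `G C` of the Lax pair relative to the asymptotic one. -/
def rel (P : Potential) (qb : ℂ) (C : Mat4) (s x t : ℝ) : Mat4 :=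
  (Matrix.diagonal fun j => Complex.exp (-(Complex.I * P.Θ x t s j))) *
    ((E qb s)⁻¹ * (P.G x t (P.k s) * C))

/-- The deviation of the matrix `T` of the Lax pair from its limit. -/
def Tgap (P : Potential) (qb : ℂ) (s x t : ℝ) : Mat4 :=
  Tval P.q0 (P.q x t) (dx P.q x t) (P.k s) - Tval P.q0 ![0, 0, qb] 0 (P.k s)

theorem hasDerivAt_rel (hsol : P.IsSolution) (hq : ‖qb‖ = P.q0) {s : ℝ}
    (hs : (s : ℂ) ∈ P.regular) (C : Mat4) (x t : ℝ) :
    HasDerivAt (fun t => P.rel qb C s x t)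
      ((Matrix.diagonal fun j => Complex.exp (-(Complex.I * P.Θ x t s j))) *
        ((E qb s)⁻¹ * P.Tgap qb s x t * E qb s) *
        (Matrix.diagonal fun j => Complex.exp (Complex.I * P.Θ x t s j)) * P.rel qb C s x t) t := by
  set D : ℝ → Mat4 := fun t => Matrix.diagonal fun j => Complex.exp (-(Complex.I * P.Θ x t s j))
    with hD
  have hDd : HasDerivAt D (-(D t * Matrix.diagonal (P.tev s))) t := by
    refine hasDerivAt_matrix_iff.2 fun i j => ?_
    rw [hD, Matrix.diagonal_mul_diagonal]
    by_cases hij : i = j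
    · subst hij
      simp only [Matrix.neg_apply, Matrix.diagonal_apply_eq, I_mul_Θ]
      have e1 : HasDerivAt (fun t : ℝ => -(P.ev s i * x + P.tev s i * (t : ℂ)))
          (-(P.tev s i * 1)) t :=
        (((hasDerivAt_id t).ofReal_comp.const_mul (P.tev s i)).const_add _).fun_neg
      refine e1.cexp.congr_deriv ?_
      ring
    · simp only [Matrix.neg_apply, Matrix.diagonal_apply_ne _ hij, neg_zero]
      exact hasDerivAt_const _ _
  have hDD : (Matrix.diagonal fun j => Complex.exp (Complex.I * P.Θ x t s j)) * D t = 1 := by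
    rw [hD, Matrix.diagonal_mul_diagonal, ← Matrix.diagonal_one]
    congr 1
    funext j
    rw [← Complex.exp_add, add_neg_cancel, Complex.exp_zero]
  have h1 := hDd.fun_mul (((hsol.hasDerivAt_G_t x t (P.k s)).mul_const C).const_mul ((E qb s)⁻¹))
  refine h1.congr_deriv ?_
  have hT : Tval P.q0 (P.q x t) (dx P.q x t) (P.k s) =
      Tval P.q0 ![0, 0, qb] 0 (P.k s) + P.Tgap qb s x t := by rw [Tgap]; abel
  have e1 : (E qb s)⁻¹ * (Tval P.q0 (P.q x t) (dx P.q x t) (P.k s) * P.G x t (P.k s) * C) =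
      Matrix.diagonal (P.tev s) * ((E qb s)⁻¹ * (P.G x t (P.k s) * C)) +
        (E qb s)⁻¹ * P.Tgap qb s x t * (P.G x t (P.k s) * C) := by
    rw [hT, add_mul, add_mul, mul_add, ← mul_assoc _ ((E qb s)⁻¹) _, ← Einv_mul_Tval hq hs]
    simp only [mul_assoc]
  have e2 : (Matrix.diagonal fun j => Complex.exp (Complex.I * P.Θ x t s j)) * P.rel qb C s x t =
      (E qb s)⁻¹ * (P.G x t (P.k s) * C) := by
    rw [rel, ← mul_assoc]
    exact (congrArg (· * _) hDD).trans (one_mul _)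
  have e3 : (E qb s)⁻¹ * P.Tgap qb s x t * E qb s * ((E qb s)⁻¹ * (P.G x t (P.k s) * C)) =
      (E qb s)⁻¹ * P.Tgap qb s x t * (P.G x t (P.k s) * C) := by
    rw [mul_assoc _ (E qb s), ← mul_assoc (E qb s), E_mul_Einv hq hs, one_mul]
  have e4 : D t * ((E qb s)⁻¹ * P.Tgap qb s x t * E qb s) *
      (Matrix.diagonal fun j => Complex.exp (Complex.I * P.Θ x t s j)) * P.rel qb C s x t =
      D t * ((E qb s)⁻¹ * P.Tgap qb s x t * (P.G x t (P.k s) * C)) := by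
    rw [mul_assoc, e2, mul_assoc, e3]
  refine Eq.trans ?_ e4.symm
  rw [e1, mul_add, neg_mul, mul_assoc (D t)]
  abel

end Potential

end

end VNLS

namespace VNLS

noncomputable section

open LinearODE Damped

attribute [local instance] Matrix.linftyOpNormedRing Matrix.linftyOpNormedAlgebra

namespace Potential

variable {P : Potential} {σ : ℝ} {qb : ℂ}

theorem continuous_Tval (q0 : ℝ) (k : ℂ) :
    Continuous fun p : (Fin 3 → ℂ) × (Fin 3 → ℂ) => Tval q0 p.1 p.2 k := by
  have h1 := continuous_Qmat.comp (continuous_fst (X := Fin 3 → ℂ) (Y := Fin 3 → ℂ))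
  have h2 := continuous_Qmat.comp (continuous_snd (X := Fin 3 → ℂ) (Y := Fin 3 → ℂ))
  simp only [Function.comp_def] at h1 h2
  unfold Tval
  fun_prop

/-- Size of the deviation of `T` from its limit. -/
def Tsize (P : Potential) (qb : ℂ) (s x t : ℝ) : ℝ := ∑ a, ∑ b, ‖P.Tgap qb s x t a b‖

theorem continuous_Tsize (hsol : P.IsSolution) (s x : ℝ) : Continuous (P.Tsize qb s x) := by
  have e : Continuous fun t : ℝ => ((x, t) : ℝ × ℝ) := by fun_prop
  have h1 : Continuous fun t => (P.q x t, dx P.q x t) :=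
    (hsol.continuous_q.comp e).prodMk (hsol.continuous_x.comp e)
  have h2 : Continuous fun t => P.Tgap qb s x t :=
    ((continuous_Tval P.q0 (P.k s)).comp h1).sub continuous_const
  unfold Tsize
  exact continuous_finsetSum _ fun a _ => continuous_finsetSum _ fun b _ =>
    (h2.matrix_elem a b).norm

theorem eventually_Tsize_le (he : P.IsEnd σ qb) (s T : ℝ) {ε : ℝ} (hε : 0 < ε) :
    ∀ᶠ y in atBot, ∀ t ∈ Set.Icc (-T) T, P.Tsize qb s (σ * y) t ≤ ε := by
  set F : (Fin 3 → ℂ) × (Fin 3 → ℂ) → ℝ := fun p => ∑ a, ∑ b,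
    ‖(Tval P.q0 p.1 p.2 (P.k s) - Tval P.q0 ![0, 0, qb] 0 (P.k s)) a b‖ with hF
  have hFc : Continuous F :=
    continuous_finsetSum _ fun a _ => continuous_finsetSum _ fun b _ =>
      (((continuous_Tval P.q0 (P.k s)).sub continuous_const).matrix_elem a b).norm
  have hF0 : F (![0, 0, qb], 0) = 0 := by simp [hF]
  have hev : ∀ᶠ p in 𝓝 ((![0, 0, qb], 0) : (Fin 3 → ℂ) × (Fin 3 → ℂ)), F p < ε := by
    have := hFc.tendsto (![0, 0, qb], 0)
    rw [hF0] at this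
    exact this.eventually (gt_mem_nhds hε)
  obtain ⟨r, hr, hball⟩ := Metric.eventually_nhds_iff.1 hev
  have u1 := (tendstoLocallyUniformlyOn_iff_tendstoUniformlyOn_of_compact
    (isCompact_Icc (a := -T) (b := T))).1 he.tendsto.tendstoLocallyUniformlyOn
  have u2 := (tendstoLocallyUniformlyOn_iff_tendstoUniformlyOn_of_compact
    (isCompact_Icc (a := -T) (b := T))).1 he.tendsto_dx.tendstoLocallyUniformlyOn
  filter_upwards [Metric.tendstoUniformlyOn_iff.1 u1 r hr,
    Metric.tendstoUniformlyOn_iff.1 u2 r hr] with y h1 h2 t ht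
  have := hball (y := (P.q (σ * y) t, dx P.q (σ * y) t)) (by
    rw [Prod.dist_eq, max_lt_iff]
    exact ⟨by rw [dist_comm]; exact h1 t ht, by rw [dist_comm]; exact h2 t ht⟩)
  exact this.le

theorem isLinSol_rel (hsol : P.IsSolution) (hq : ‖qb‖ = P.q0) {s : ℝ}
    (hs : (s : ℂ) ∈ P.regular) (C : Mat4) (x t : ℝ) (j : Fin 4) :
    ∃ R : ℝ → Fin 4 → Fin 4 → ℂ,
      (∀ τ i l, ‖R τ i l‖ ≤ |t| * (condE qb s * P.Tsize qb s x (τ * t))) ∧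
      IsLinSol (fun _ => 0) R (fun τ i => P.rel qb C s x (τ * t) i j) := by
  obtain ⟨M, hM⟩ : ∃ M : ℝ → Mat4, ∀ τ, M τ = (Matrix.diagonal fun j =>
      Complex.exp (-(Complex.I * P.Θ x (τ * t) s j))) *
        ((E qb s)⁻¹ * P.Tgap qb s x (τ * t) * E qb s) *
        (Matrix.diagonal fun j => Complex.exp (Complex.I * P.Θ x (τ * t) s j)) :=
    ⟨_, fun _ => rfl⟩
  refine ⟨fun τ i l => (t : ℂ) * M τ i l, fun τ i l => ?_, fun τ i => ?_, fun i => Or.inl (by simp)⟩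
  · have e : ‖M τ i l‖ = ‖((E qb s)⁻¹ * P.Tgap qb s x (τ * t) * E qb s) i l‖ := by
      rw [hM, Matrix.mul_diagonal, Matrix.diagonal_mul, norm_mul, norm_mul,
        norm_exp_neg_Θ_of_real, norm_exp_Θ_of_real, one_mul, mul_one]
    change ‖(t : ℂ) * M τ i l‖ ≤ _
    rw [norm_mul, Complex.norm_real, Real.norm_eq_abs, e]
    refine mul_le_mul_of_nonneg_left (norm_conj_le (fun a b => ?_) i l) (abs_nonneg t)
    refine le_trans ?_ (Finset.single_le_sum (f := fun a => ∑ b,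
      ‖P.Tgap qb s x (τ * t) a b‖) (fun a _ => by positivity) (Finset.mem_univ a))
    exact Finset.single_le_sum (f := fun b => ‖P.Tgap qb s x (τ * t) a b‖)
      (fun b _ => by positivity) (Finset.mem_univ b)
  · have h1 := hasDerivAt_matrix_iff.1 (hasDerivAt_rel hsol hq hs C x (τ * t)) i j
    rw [← hM] at h1
    have h2 := h1.scomp τ ((hasDerivAt_id τ).mul_const t)
    refine h2.congr_deriv ?_
    rw [one_mul, zero_mul, zero_add, Matrix.mul_apply, Finset.smul_sum]
    refine Finset.sum_congr rfl fun l _ => ?_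
    rw [Complex.real_smul, mul_assoc]

/-- The normalization at `x = ±∞` propagates from `t = 0` to all `t`, since `T` converges to its
limit uniformly for bounded `t`. -/
theorem tendsto_rel (hsol : P.IsSolution) (he : P.IsEnd σ qb) {s : ℝ}
    (hs : (s : ℂ) ∈ P.regular) {C : Mat4}
    (h0 : Tendsto (fun y => P.rel qb C s (σ * y) 0) atBot (𝓝 1)) (t : ℝ) :
    Tendsto (fun y => P.rel qb C s (σ * y) t) atBot (𝓝 1) := by
  set I : ℝ → ℝ := fun y =>
    ∫ τ in (0 : ℝ)..1, |t| * (condE qb s * P.Tsize qb s (σ * y) (τ * t)) with hI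
  have hTs : ∀ x t, 0 ≤ P.Tsize qb s x t := fun x t =>
    Finset.sum_nonneg fun a _ => Finset.sum_nonneg fun b _ => norm_nonneg _
  have hcE := condE_nonneg (qb := qb) (s : ℂ)
  have hcont : ∀ y, Continuous fun τ =>
      |t| * (condE qb s * P.Tsize qb s (σ * y) (τ * t)) := fun y =>
    (((continuous_Tsize hsol s (σ * y)).comp (continuous_mul_const t)).const_mul _).const_mul _
  have hI0 : Tendsto I atBot (𝓝 0) := by
    rw [Metric.tendsto_nhds]
    intro ε hε
    have hpos : 0 < |t| * condE qb s + 1 := by positivity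
    filter_upwards [eventually_Tsize_le he s |t| (div_pos hε (mul_pos two_pos hpos))] with y hy
    have hnn : 0 ≤ I y := intervalIntegral.integral_nonneg zero_le_one fun τ _ => by
      have := hTs (σ * y) (τ * t); positivity
    rw [Real.dist_eq, sub_zero, abs_of_nonneg hnn]
    have h1 : I y ≤ ∫ _τ in (0 : ℝ)..1,
        |t| * (condE qb s * (ε / (2 * (|t| * condE qb s + 1)))) := by
      refine intervalIntegral.integral_mono_on zero_le_one ((hcont y).intervalIntegrable _ _)
        (continuous_const.intervalIntegrable _ _) fun τ hτ => ?_
      have h2 := hy (τ * t) (abs_le.1 (by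
        rw [abs_mul, abs_of_nonneg hτ.1]
        exact mul_le_of_le_one_left (abs_nonneg t) hτ.2))
      gcongr
    rw [intervalIntegral.integral_const, sub_zero, one_smul] at h1
    refine h1.trans_lt ?_
    have h3 : |t| * (condE qb s * (ε / (2 * (|t| * condE qb s + 1)))) =
        (|t| * condE qb s / (|t| * condE qb s + 1)) * (ε / 2) := by
      field_simp
    rw [h3]
    have h4 : |t| * condE qb s / (|t| * condE qb s + 1) ≤ 1 := by
      rw [div_le_one hpos]; linarith
    nlinarith
  refine tendsto_pi_nhds.2 fun i => tendsto_pi_nhds.2 fun j => ?_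
  have h0' : ∀ i, Tendsto (fun y => P.rel qb C s (σ * y) 0 i j) atBot (𝓝 ((1 : Mat4) i j)) :=
    fun i => tendsto_pi_nhds.1 (tendsto_pi_nhds.1 h0 i) j
  have hb : Tendsto (fun y => (Fintype.card (Fin 4) * (∑ i, ‖P.rel qb C s (σ * y) 0 i j‖) *
      Real.exp (Fintype.card (Fin 4) * I y)) * I y) atBot (𝓝 0) := by
    have h1 := (((tendsto_finsetSum Finset.univ fun i _ => (h0' i).norm).const_mul
      (Fintype.card (Fin 4) : ℝ)).mul
      ((Real.continuous_exp.tendsto _).comp (hI0.const_mul (Fintype.card (Fin 4) : ℝ)))).mul hI0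
    rw [mul_zero] at h1
    exact h1
  have hd : Tendsto (fun y => P.rel qb C s (σ * y) t i j - P.rel qb C s (σ * y) 0 i j) atBot
      (𝓝 0) := by
    refine squeeze_zero_norm (fun y => ?_) hb
    obtain ⟨R, hR, hsolR⟩ := isLinSol_rel hsol he.norm hs C (σ * y) t j
    have := (hsolR.isSol hR).norm_sub_le (hcont y)
      (fun τ => by have := hTs (σ * y) (τ * t); positivity) zero_le_one
      (fun i => by simp) i
    simpa only [one_mul, zero_mul] using this
  simpa using hd.add (h0' i)

/-- Existence and uniqueness of the Jost eigenfunctions on the continuous spectrum. -/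
theorem exists_jost (hsol : P.IsSolution) (he : P.IsEnd σ qb) {s : ℝ}
    (hs : (s : ℂ) ∈ P.regular) :
    ∃ C : Mat4, Tendsto (fun n : ℕ => P.V σ qb s (-(n : ℝ))) atTop (𝓝 C) ∧
      C.conjTranspose * J * C = P.Γ s ∧ C.det = P.γ s ∧
      P.IsJost (map (fun y => σ * y) atBot) qb s (fun x t => P.G x t (P.k s) * C) ∧
      ∀ Φ, P.IsJost (map (fun y => σ * y) atBot) qb s Φ →
        ∀ x t, Φ x t = P.G x t (P.k s) * C := by
  obtain ⟨C, hC, hC1⟩ := exists_real_limit hsol he hs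
  have hs0 : s ≠ 0 := Complex.ofReal_ne_zero.1 hs.1
  have hdet : C.det = P.γ s := by
    refine tendsto_nhds_unique ((continuous_id.matrix_det.tendsto C).comp hC) ?_
    simp only [Function.comp_def, id_eq, det_V hsol he.norm]
    exact tendsto_const_nhds
  have hΓ : C.conjTranspose * J * C = P.Γ s := by
    have hc : Continuous fun C : Mat4 => C.conjTranspose * J * C :=
      (continuous_id.matrix_conjTranspose.mul continuous_const).mul continuous_id
    refine tendsto_nhds_unique ((hc.tendsto C).comp hC) ?_
    simp only [Function.comp_def, V_conj_J_V hsol he.norm hs0]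
    exact tendsto_const_nhds
  have hrel0 : Tendsto (fun y => P.rel qb C s (σ * y) 0) atBot (𝓝 1) := by
    have h1 : Tendsto (fun y : ℝ => (E qb s)⁻¹ * P.G (σ * y) 0 (P.k s) * C *
        (Matrix.diagonal fun j => Complex.exp (P.ev s j * (-(σ * y) : ℝ))) - 1) atBot (𝓝 0) := by
      simpa using hC1.sub_const 1
    have h2 := tendsto_mul_diagonal (u := fun y j => Complex.exp (P.ev s j * (σ * y : ℝ)))
      (fun y j => norm_exp_ev_of_real s _ j) (tendsto_diagonal_mul
      (u := fun y j => Complex.exp (P.ev s j * (-(σ * y) : ℝ)))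
      (fun y j => norm_exp_ev_of_real s _ j) h1)
    have h3 : Tendsto (fun y => P.rel qb C s (σ * y) 0 - 1) atBot (𝓝 0) := by
      refine h2.congr fun y => ?_
      have e1 : (Matrix.diagonal fun j => Complex.exp (P.ev s j * (-(σ * y) : ℝ)) : Mat4) *
          (Matrix.diagonal fun j => Complex.exp (P.ev s j * (σ * y : ℝ))) = 1 := by
        rw [Matrix.diagonal_mul_diagonal, ← Matrix.diagonal_one]
        congr 1
        funext j
        rw [← Complex.exp_add, ← mul_add]
        simp
      have e2 : (Matrix.diagonal fun j => Complex.exp (-(Complex.I * P.Θ (σ * y) 0 s j)) : Mat4) =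
          Matrix.diagonal fun j => Complex.exp (P.ev s j * (-(σ * y) : ℝ)) := by
        congr 1
        funext j
        rw [I_mul_Θ]
        congr 1
        push_cast
        ring
      rw [rel, e2, mul_sub, sub_mul, mul_one, e1]
      congr 1
      simp only [mul_assoc]
      rw [e1, mul_one]
    simpa using h3.add_const 1
  have hI : ∀ x t, (Matrix.diagonal fun j => Complex.exp (Complex.I * P.Θ x t s j)) *
      (Matrix.diagonal fun j => Complex.exp (-(Complex.I * P.Θ x t s j))) = (1 : Mat4) := by
    intro x t
    rw [Matrix.diagonal_mul_diagonal, ← Matrix.diagonal_one]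
    congr 1
    funext j
    rw [← Complex.exp_add, add_neg_cancel, Complex.exp_zero]
  have hrec : ∀ (C : Mat4) x t, E qb s * ((Matrix.diagonal fun j =>
      Complex.exp (Complex.I * P.Θ x t s j)) * (P.rel qb C s x t - 1)) =
      P.G x t (P.k s) * C -
        E qb s * Matrix.diagonal fun j => Complex.exp (Complex.I * P.Θ x t s j) := by
    intro C x t
    rw [mul_sub, mul_one, mul_sub, rel, ← mul_assoc (Matrix.diagonal _), hI, one_mul, ← mul_assoc,
      E_mul_Einv he.norm hs, one_mul]
  refine ⟨C, hC, hΓ, hdet, ⟨fun x t i j => ?_, fun x t i j => ?_, fun t i j => ?_⟩, ?_⟩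
  · have := (hsol.hasDerivAt_G_x x t (P.k s)).mul_const C
    rw [mul_assoc] at this
    exact hasDerivAt_matrix_iff.1 this i j
  · have := (hsol.hasDerivAt_G_t x t (P.k s)).mul_const C
    rw [mul_assoc] at this
    exact hasDerivAt_matrix_iff.1 this i j
  · rw [tendsto_map'_iff]
    have h1 := (tendsto_rel hsol he hs hrel0 t).sub_const 1
    rw [sub_self] at h1
    have h2 := (tendsto_diagonal_mul (u := fun y j =>
      Complex.exp (Complex.I * P.Θ (σ * y) t s j))
      (fun y j => norm_exp_Θ_of_real s _ _ j) h1).const_mul (E qb s)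
    simp only [hrec, mul_zero] at h2
    exact tendsto_pi_nhds.1 (tendsto_pi_nhds.1 h2 i) j
  · intro Φ hΦ
    have hG : ∀ x t, Φ x t = P.G x t (P.k s) * Φ 0 0 := hsol.eq_G_mul
      (fun x t => hasDerivAt_matrix_iff.2 (hΦ.x_part x t))
      (fun t => hasDerivAt_matrix_iff.2 (hΦ.t_part 0 t))
    have h1 : Tendsto (fun y => Φ (σ * y) 0 - E qb s * Matrix.diagonal fun a =>
        Complex.exp (Complex.I * P.Θ (σ * y) 0 s a)) atBot (𝓝 0) :=
      tendsto_pi_nhds.2 fun i => tendsto_pi_nhds.2 fun j => tendsto_map'_iff.1 (hΦ.asymp 0 i j)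
    have h2 := tendsto_diagonal_mul (u := fun y j =>
      Complex.exp (-(Complex.I * P.Θ (σ * y) 0 s j)))
      (fun y j => norm_exp_neg_Θ_of_real s _ _ j) (by simpa using h1.const_mul ((E qb s)⁻¹))
    have hI' : ∀ x t, (Matrix.diagonal fun j => Complex.exp (-(Complex.I * P.Θ x t s j))) *
        (Matrix.diagonal fun j => Complex.exp (Complex.I * P.Θ x t s j)) = (1 : Mat4) :=
      fun x t => mul_eq_one_comm.1 (hI x t)
    have h3 : Tendsto (fun y => P.rel qb (Φ 0 0) s (σ * y) 0 - 1) atBot (𝓝 0) := by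
      refine h2.congr fun y => ?_
      rw [hG, rel, mul_sub, mul_sub, ← mul_assoc ((E qb s)⁻¹) (E qb s), Einv_mul_E he.norm hs,
        one_mul, hI']
    have h4 : Tendsto (fun y => P.rel qb C s (σ * y) 0 * (C⁻¹ * Φ 0 0)) atBot
        (𝓝 (1 * (C⁻¹ * Φ 0 0))) := hrel0.mul_const _
    have hCC : C * C⁻¹ = 1 := Matrix.mul_nonsing_inv _ (by
      rw [hdet]; exact (γ_ne_zero hs).isUnit)
    have h5 : ∀ y, P.rel qb C s (σ * y) 0 * (C⁻¹ * Φ 0 0) = P.rel qb (Φ 0 0) s (σ * y) 0 := by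
      intro y
      simp only [rel, mul_assoc]
      rw [← mul_assoc C, hCC, one_mul]
    simp only [h5, one_mul] at h4
    have h6 : C⁻¹ * Φ 0 0 = 1 := tendsto_nhds_unique h4 (by simpa using h3.add_const 1)
    have h7 : Φ 0 0 = C := by
      rw [← one_mul (Φ 0 0), ← hCC, mul_assoc, h6, mul_one]
    intro x t
    rw [hG, h7]

end Potential

end

end VNLS

/-! ### Uniqueness of analytic extensions from the real line -/

namespace VNLS

noncomputable section

theorem isOpen_upper : IsOpen upper := isOpen_lt continuous_const Complex.continuous_im

theorem isOpen_lower : IsOpen lower := isOpen_lt Complex.continuous_im continuous_const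

/-- An analytic function on the upper half plane vanishes if its boundary values vanish on a ray.
On a square resting on that ray, the product of the four functions obtained by rotating the square
by multiples of a right angle vanishes on the boundary, hence at the centre. -/
theorem eqOn_zero_of_boundary {f : ℂ → ℂ} {q0 : ℝ} (hd : DifferentiableOn ℂ f upper)
    (hb : ∀ s : ℝ, q0 < s → Tendsto f (𝓝[upper] (s : ℂ)) (𝓝 0)) : Set.EqOn f 0 upper := by
  classical
  set F : ℂ → ℂ := fun z => if 0 < z.im then f z else 0 with hF
  set D : Set ℂ := {z | 0 ≤ z.im ∧ q0 < z.re} with hD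
  have hFup : ∀ z, 0 < z.im → F =ᶠ[𝓝 z] f := fun z hz => by
    filter_upwards [isOpen_upper.mem_nhds hz] with w hw
    exact if_pos hw
  have hF0 : ∀ z : ℂ, z.im = 0 → F z = 0 := fun z hz => if_neg (by simp [hz])
  have hFd : ∀ z : ℂ, 0 < z.im → DifferentiableAt ℂ F z := fun z hz =>
    ((hd z hz).differentiableAt (isOpen_upper.mem_nhds hz)).congr_of_eventuallyEq (hFup z hz)
  have hFc : ContinuousOn F D := by
    intro z hz
    rcases hz.1.lt_or_eq with h | h
    · exact (hFd z h).continuousAt.continuousWithinAt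
    · have hzr : z = (z.re : ℂ) := Complex.ext (by simp) (by simp [← h])
      have h1 : Tendsto F (𝓝[upper] z) (𝓝 0) := by
        rw [hzr]
        refine (hb z.re hz.2).congr' ?_
        filter_upwards [self_mem_nhdsWithin] with w hw
        exact (if_pos hw).symm
      have h2 : Tendsto F (𝓝[{w : ℂ | w.im = 0}] z) (𝓝 0) := by
        refine tendsto_const_nhds.congr' ?_
        filter_upwards [self_mem_nhdsWithin] with w hw
        exact (hF0 w hw).symm
      have h3 : Tendsto F (𝓝[upper ∪ {w : ℂ | w.im = 0}] z) (𝓝 0) := by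
        rw [nhdsWithin_union]; exact h1.sup h2
      rw [ContinuousWithinAt, hF0 z h.symm]
      refine h3.mono_left (nhdsWithin_mono _ fun w hw => ?_)
      rcases hw.1.lt_or_eq with h | h
      · exact Or.inl h
      · exact Or.inr h.symm
  have key : ∀ c : ℂ, 0 < c.im → q0 < c.re - c.im → f c = 0 := by
    intro c hc hq
    set r := c.im with hr
    set U : Set ℂ := Set.Ioo (-r) r ×ℂ Set.Ioo (-r) r with hU
    have hUo : IsOpen U := isOpen_Ioo.reProdIm isOpen_Ioo
    have hUb : Bornology.IsBounded U :=
      (Metric.isBounded_Ioo (-r) r).reProdIm (Metric.isBounded_Ioo (-r) r)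
    have hUcl : closure U = Set.Icc (-r) r ×ℂ Set.Icc (-r) r := by
      rw [hU, Complex.closure_reProdIm, closure_Ioo (by linarith)]
    set rot : Fin 4 → ℂ := ![1, -1, Complex.I, -Complex.I] with hrot
    have hin : ∀ i, ∀ w ∈ closure U, c + rot i * w ∈ D := by
      intro i w hw
      rw [hUcl, Complex.mem_reProdIm] at hw
      obtain ⟨⟨h1, h2⟩, h3, h4⟩ := hw
      fin_cases i <;> simp [hrot, hD, ← hr] <;> constructor <;> linarith
    have hin' : ∀ i, ∀ w ∈ U, 0 < (c + rot i * w).im := by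
      intro i w hw
      rw [hU, Complex.mem_reProdIm] at hw
      obtain ⟨⟨h1, h2⟩, h3, h4⟩ := hw
      fin_cases i <;> simp [hrot, ← hr] <;> linarith
    set H : ℂ → ℂ := fun w => ∏ i, F (c + rot i * w) with hH
    have hHd : DiffContOnCl ℂ H U := by
      refine ⟨fun w hw => ?_, ?_⟩
      · refine DifferentiableAt.differentiableWithinAt ?_
        refine DifferentiableAt.fun_finsetProd fun i _ => ?_
        exact DifferentiableAt.comp (g := F) (f := fun w => c + rot i * w) w (hFd _ (hin' i w hw))
          (by fun_prop)
      · refine continuousOn_finsetProd _ fun i _ => ?_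
        exact hFc.comp (by fun_prop) (fun w hw => hin i w hw)
    have hfr : ∀ w ∈ frontier U, ‖H w‖ ≤ 0 := by
      intro w hw
      have hcl := frontier_subset_closure hw
      rw [hUo.frontier_eq, hUcl] at hw
      obtain ⟨hw1, hw2⟩ := hw
      rw [Complex.mem_reProdIm] at hw1 hw2
      obtain ⟨⟨h1, h2⟩, h3, h4⟩ := hw1
      have : ∃ i, (c + rot i * w).im = 0 := by
        by_contra! hne
        have e0 := hne 0
        have e1 := hne 1
        have e2 := hne 2
        have e3 := hne 3
        simp [hrot, ← hr] at e0 e1 e2 e3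
        exact hw2 ⟨⟨lt_of_le_of_ne h1 fun h => e2 (by linarith),
          lt_of_le_of_ne h2 fun h => e3 (by linarith)⟩,
          lt_of_le_of_ne h3 fun h => e0 (by linarith),
          lt_of_le_of_ne h4 fun h => e1 (by linarith)⟩
      obtain ⟨i, hi⟩ := this
      rw [norm_le_zero_iff]
      exact Finset.prod_eq_zero (Finset.mem_univ i) (hF0 _ hi)
    have h0 : (0 : ℂ) ∈ closure U := subset_closure (by
      rw [hU, Complex.mem_reProdIm]; simp [hc])
    have h1 := Complex.norm_le_of_forall_mem_frontier_norm_le hUb hHd hfr h0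
    rw [norm_le_zero_iff] at h1
    simp only [hH, mul_zero, add_zero, Finset.prod_const] at h1
    have h2 : F c = 0 := eq_zero_of_pow_eq_zero h1
    exact (if_pos hc).symm.trans h2
  have hA : AnalyticOnNhd ℂ f upper := hd.analyticOnNhd isOpen_upper
  have hconv : Convex ℝ upper := convex_halfSpace_im_gt 0
  set c0 : ℂ := ⟨q0 + 2, 1⟩ with hc0
  have hnhds : f =ᶠ[𝓝 c0] 0 := by
    have ho : IsOpen {c : ℂ | 0 < c.im ∧ q0 < c.re - c.im} :=
      isOpen_upper.inter (isOpen_lt continuous_const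
        (Complex.continuous_re.sub Complex.continuous_im))
    filter_upwards [ho.mem_nhds (show c0 ∈ _ from ⟨by simp [hc0], by simp [hc0]; linarith⟩)]
      with c hc
    exact key c hc.1 hc.2
  exact hA.eqOn_zero_of_preconnected_of_eventuallyEq_zero hconv.isPreconnected
    (show c0 ∈ upper by simp [hc0, upper]) hnhds

variable {V : Type} [NormedAddCommGroup V] [NormedSpace ℂ V]

/-- Analytic extensions to the upper half plane are unique. -/
theorem IsAnalyticExtension.eqOn_upper {q0 : ℝ} {g : ℝ → V} {f₁ f₂ : ℂ → V} (hq : 0 < q0)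
    (h₁ : IsAnalyticExtension upper q0 g f₁) (h₂ : IsAnalyticExtension upper q0 g f₂) :
    Set.EqOn f₁ f₂ upper := by
  intro z hz
  rw [← sub_eq_zero]
  refine SeparatingDual.eq_zero_of_forall_dual_eq_zero (R := ℂ) fun φ => ?_
  refine eqOn_zero_of_boundary (q0 := q0) (f := fun z => φ (f₁ z - f₂ z))
    (φ.differentiable.comp_differentiableOn (h₁.1.sub h₂.1)) (fun s hs => ?_) hz
  have h := (h₁.2 s (by linarith) (by linarith) (by linarith)).sub
    (h₂.2 s (by linarith) (by linarith) (by linarith))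
  rw [sub_self] at h
  have h' := (φ.continuous.tendsto 0).comp h
  rwa [map_zero] at h'

theorem tendsto_neg_upper (s : ℝ) : Tendsto (fun z : ℂ => -z) (𝓝[upper] (s : ℂ))
    (𝓝[lower] ((-s : ℝ) : ℂ)) := by
  refine tendsto_nhdsWithin_iff.2 ⟨?_, ?_⟩
  · rw [Complex.ofReal_neg]
    exact (continuous_neg.tendsto _).mono_left nhdsWithin_le_nhds
  · filter_upwards [self_mem_nhdsWithin] with z hz
    have hz : 0 < z.im := hz
    show (-z).im < 0
    simpa using hz

theorem IsAnalyticExtension.neg_arg {q0 : ℝ} {g : ℝ → V} {f : ℂ → V}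
    (h : IsAnalyticExtension lower q0 g f) :
    IsAnalyticExtension upper q0 (fun s => g (-s)) (fun z => f (-z)) := by
  refine ⟨h.1.comp differentiable_neg.differentiableOn fun z hz => ?_, fun s h0 h1 h2 =>
    (h.2 (-s) (neg_ne_zero.2 h0) (fun h => h2 (by linarith)) fun h => h1 (by linarith)).comp
      (tendsto_neg_upper s)⟩
  have hz : 0 < z.im := hz
  show (-z).im < 0
  simpa using hz

theorem IsAnalyticExtension.eqOn_lower {q0 : ℝ} {g : ℝ → V} {f₁ f₂ : ℂ → V} (hq : 0 < q0)
    (h₁ : IsAnalyticExtension lower q0 g f₁) (h₂ : IsAnalyticExtension lower q0 g f₂) :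
    Set.EqOn f₁ f₂ lower := by
  intro z hz
  have hz' : -z ∈ upper := by
    have hz : z.im < 0 := hz
    show 0 < (-z).im
    simpa using hz
  simpa using h₁.neg_arg.eqOn_upper hq h₂.neg_arg hz'

theorem analyticExt_spec {U : Set ℂ} {q0 : ℝ} {g : ℝ → V} {f : ℂ → V}
    (h : IsAnalyticExtension U q0 g f) : IsAnalyticExtension U q0 g (analyticExt U q0 g) := by
  have h' : ∃ f, IsAnalyticExtension U q0 g f := ⟨f, h⟩
  rw [analyticExt, dif_pos h']
  exact h'.choose_spec

theorem IsAnalyticExtension.analyticExt_upper {q0 : ℝ} {g : ℝ → V} {f : ℂ → V} (hq : 0 < q0)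
    (h : IsAnalyticExtension upper q0 g f) : Set.EqOn (analyticExt upper q0 g) f upper :=
  (analyticExt_spec h).eqOn_upper hq h

theorem IsAnalyticExtension.analyticExt_lower {q0 : ℝ} {g : ℝ → V} {f : ℂ → V} (hq : 0 < q0)
    (h : IsAnalyticExtension lower q0 g f) : Set.EqOn (analyticExt lower q0 g) f lower :=
  (analyticExt_spec h).eqOn_lower hq h

namespace Potential

variable {P : Potential}

theorem upper_subset_closedUpper : upper ⊆ P.closedUpper := by
  intro z hz
  have hz' : 0 < z.im := hz
  refine ⟨hz'.le, ?_, ?_, ?_⟩ <;> rintro rfl <;> simp at hz'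

theorem upper_subset_regular : upper ⊆ P.regular := fun _ hz => (upper_subset_closedUpper hz).2

theorem ofReal_mem_regular {s : ℝ} : (s : ℂ) ∈ P.regular ↔ s ≠ 0 ∧ s ≠ P.q0 ∧ s ≠ -P.q0 := by
  simp only [regular, Set.mem_ofPred_eq]
  norm_cast

theorem ofReal_mem_closedUpper {s : ℝ} (hs : (s : ℂ) ∈ P.regular) : (s : ℂ) ∈ P.closedUpper :=
  ⟨by simp, hs⟩

/-- `f` is continuous on the closed upper half plane without `0, ±q_o`, and analytic inside. -/
def HolUp (P : Potential) (f : ℂ → V) : Prop :=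
  ContinuousOn f P.closedUpper ∧ DifferentiableOn ℂ f upper

namespace HolUp

variable {f g : ℂ → V} {u v : ℂ → ℂ}

theorem isAnalyticExtension (hf : P.HolUp f) {g : ℝ → V}
    (hg : ∀ s : ℝ, (s : ℂ) ∈ P.regular → f s = g s) : IsAnalyticExtension upper P.q0 g f := by
  refine ⟨hf.2, fun s h0 h1 h2 => ?_⟩
  have hs : (s : ℂ) ∈ P.regular := ofReal_mem_regular.2 ⟨h0, h1, h2⟩
  rw [← hg s hs]
  exact (hf.1 s (ofReal_mem_closedUpper hs)).mono upper_subset_closedUpper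

theorem eqOn (hq : 0 < P.q0) (hf : P.HolUp f) (hg : P.HolUp g)
    (h : ∀ s : ℝ, (s : ℂ) ∈ P.regular → f s = g s) : Set.EqOn f g upper :=
  (hf.isAnalyticExtension (g := fun s => g s) h).eqOn_upper hq
    (hg.isAnalyticExtension fun _ _ => rfl)

theorem add (hf : P.HolUp f) (hg : P.HolUp g) : P.HolUp fun z => f z + g z :=
  ⟨hf.1.add hg.1, hf.2.add hg.2⟩

theorem sub (hf : P.HolUp f) (hg : P.HolUp g) : P.HolUp fun z => f z - g z :=
  ⟨hf.1.sub hg.1, hf.2.sub hg.2⟩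

theorem smul (hu : P.HolUp u) (hf : P.HolUp f) : P.HolUp fun z => u z • f z :=
  ⟨hu.1.smul hf.1, hu.2.smul hf.2⟩

theorem mul (hu : P.HolUp u) (hv : P.HolUp v) : P.HolUp fun z => u z * v z :=
  ⟨hu.1.mul hv.1, hu.2.mul hv.2⟩

theorem const (c : V) : P.HolUp fun _ => c := ⟨continuousOn_const, differentiableOn_const c⟩

theorem sum {ι : Type} {s : Finset ι} {f : ι → ℂ → V} (h : ∀ i ∈ s, P.HolUp (f i)) :
    P.HolUp fun z => ∑ i ∈ s, f i z :=
  ⟨continuousOn_finsetSum _ fun i hi => (h i hi).1, DifferentiableOn.fun_sum fun i hi => (h i hi).2⟩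

theorem pi {ι : Type} [Fintype ι] {f : ℂ → ι → V} (h : ∀ i, P.HolUp fun z => f z i) :
    P.HolUp f :=
  ⟨continuousOn_pi.2 fun i => (h i).1, differentiableOn_pi.2 fun i => (h i).2⟩

theorem apply {ι : Type} [Fintype ι] {f : ℂ → ι → V} (h : P.HolUp f) (i : ι) :
    P.HolUp fun z => f z i :=
  ⟨continuousOn_pi.1 h.1 i, differentiableOn_pi.1 h.2 i⟩

theorem of_differentiableOn (h : DifferentiableOn ℂ f P.regular) : P.HolUp f :=
  ⟨h.continuousOn.mono fun _ hz => hz.2, h.mono upper_subset_regular⟩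

end HolUp

theorem mem_regular_div (hq : 0 < P.q0) {z : ℂ} (hz : z ∈ P.regular) :
    (P.q0 : ℂ) ^ 2 / z ∈ P.regular := by
  have hq' : (P.q0 : ℂ) ≠ 0 := Complex.ofReal_ne_zero.2 hq.ne'
  obtain ⟨h0, h1, h2⟩ := hz
  refine ⟨div_ne_zero (pow_ne_zero 2 hq') h0, fun h => h1 ?_, fun h => h2 ?_⟩
  · rw [div_eq_iff h0, sq] at h
    exact (mul_left_cancel₀ hq' h).symm
  · rw [div_eq_iff h0, sq] at h
    have := mul_left_cancel₀ hq' (h.trans (neg_mul_comm _ _))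
    rw [this, neg_neg]

theorem div_mem_upper_of_lower (hq : 0 < P.q0) {z : ℂ} (hz : z ∈ lower) :
    (P.q0 : ℂ) ^ 2 / z ∈ upper := by
  have hz : z.im < 0 := hz
  have h0 : 0 < Complex.normSq z := Complex.normSq_pos.2 (by rintro rfl; simp at hz)
  show 0 < ((P.q0 : ℂ) ^ 2 / z).im
  rw [im_div_eq]
  have : 0 < P.q0 ^ 2 * (-z.im) / Complex.normSq z := by
    have : 0 < -z.im := by linarith
    positivity
  linear_combination this

theorem hat_mem_regular (hq : 0 < P.q0) {z : ℂ} (hz : z ∈ P.regular) : P.hat z ∈ P.regular := by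
  refine mem_regular_div hq ?_
  obtain ⟨h0, h1, h2⟩ := hz
  refine ⟨star_ne_zero.2 h0, fun h => h1 ?_, fun h => h2 ?_⟩
  · rw [← star_star z, h, Complex.star_def, Complex.conj_ofReal]
  · rw [← star_star z, h, Complex.star_def, map_neg, Complex.conj_ofReal]

theorem hat_im (z : ℂ) : (P.hat z).im = P.q0 ^ 2 * z.im / Complex.normSq z := by
  rw [hat, im_div_eq, Complex.star_def, Complex.conj_im, Complex.normSq_conj]; ring

theorem hat_mem_upper (hq : 0 < P.q0) {z : ℂ} (hz : z ∈ upper) : P.hat z ∈ upper := by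
  have hz : 0 < z.im := hz
  have h0 : 0 < Complex.normSq z := Complex.normSq_pos.2 (by rintro rfl; simp at hz)
  show 0 < (P.hat z).im
  rw [hat_im]
  positivity

theorem hat_mem_closedUpper (hq : 0 < P.q0) {z : ℂ} (hz : z ∈ P.closedUpper) :
    P.hat z ∈ P.closedUpper := by
  refine ⟨?_, hat_mem_regular hq hz.2⟩
  rw [hat_im]
  have := hz.1
  have := Complex.normSq_nonneg z
  positivity

theorem hat_hat (hq : 0 < P.q0) {z : ℂ} (hz : z ≠ 0) : P.hat (P.hat z) = z := by
  have hq' : (P.q0 : ℂ) ≠ 0 := Complex.ofReal_ne_zero.2 hq.ne'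
  have hz' : (starRingEnd ℂ) z ≠ 0 := by simpa using hz
  simp only [hat, Complex.star_def, map_div₀, map_pow, Complex.conj_ofReal, Complex.conj_conj]
  field_simp

theorem hat_ofReal (s : ℝ) : P.hat s = ((P.q0 ^ 2 / s : ℝ) : ℂ) := by
  simp [hat]

theorem continuousOn_hat : ContinuousOn P.hat P.regular := by
  have : Continuous (star : ℂ → ℂ) := continuous_star
  exact continuousOn_const.div this.continuousOn fun z hz => star_ne_zero.2 hz.1

/-- The reflection `f ↦ conj ∘ f ∘ hat` of scalar functions. -/
theorem HolUp.star_hat (hq : 0 < P.q0) {f : ℂ → ℂ} (hf : P.HolUp f) :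
    P.HolUp fun z => star (f (P.hat z)) := by
  refine ⟨continuous_star.comp_continuousOn (hf.1.comp (continuousOn_hat.mono fun z hz => hz.2)
    fun z hz => hat_mem_closedUpper hq hz), fun z hz => ?_⟩
  have hz0 : z ≠ 0 := (upper_subset_regular (P := P) hz).1
  have h1 : DifferentiableAt ℂ f (P.hat z) :=
    hf.2.differentiableAt (isOpen_upper.mem_nhds (hat_mem_upper hq hz))
  have h2 : DifferentiableAt ℂ (fun w => star (f (star w))) (star (P.hat z)) := by
    exact h1.conj_conj
  have h3 : DifferentiableAt ℂ (fun w : ℂ => (P.q0 : ℂ) ^ 2 / w) z := by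
    fun_prop (disch := assumption)
  have e : ∀ w, (P.q0 : ℂ) ^ 2 / w = star (P.hat w) := fun w => by simp [hat]
  rw [← e z] at h2
  have h4 := h2.comp z h3
  refine DifferentiableAt.differentiableWithinAt (h4.congr_of_eventuallyEq (Eventually.of_forall
    fun w => ?_))
  simp only [Function.comp_apply, e, star_star]

/-- Pulling back along `z ↦ q_o² / z` gives extensions to the lower half plane. -/
theorem HolUp.isAnalyticExtension_lower (hq : 0 < P.q0) {f : ℂ → V} (hf : P.HolUp f) {g : ℝ → V}
    (hg : ∀ s : ℝ, (s : ℂ) ∈ P.regular → f ((P.q0 ^ 2 / s : ℝ) : ℂ) = g s) :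
    IsAnalyticExtension lower P.q0 g fun z => f ((P.q0 : ℂ) ^ 2 / z) := by
  refine ⟨hf.2.comp (fun z hz => ?_) fun z hz => div_mem_upper_of_lower hq hz,
    fun s h0 h1 h2 => ?_⟩
  · have hz0 : z ≠ 0 := by rintro rfl; simp [lower] at hz
    have : DifferentiableAt ℂ (fun w : ℂ => (P.q0 : ℂ) ^ 2 / w) z := by
      fun_prop (disch := assumption)
    exact this.differentiableWithinAt
  · have hs : (s : ℂ) ∈ P.regular := ofReal_mem_regular.2 ⟨h0, h1, h2⟩
    have hs' := mem_regular_div hq hs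
    have e : ((P.q0 ^ 2 / s : ℝ) : ℂ) = (P.q0 : ℂ) ^ 2 / s := by push_cast; ring
    rw [← hg s hs, e]
    rw [← e] at hs'
    have h3 := (hf.1 _ (ofReal_mem_closedUpper hs')).mono upper_subset_closedUpper
    rw [e] at h3
    refine Tendsto.comp h3 (tendsto_nhdsWithin_iff.2 ⟨?_, ?_⟩)
    · have hs0 : (s : ℂ) ≠ 0 := hs.1
      have : ContinuousAt (fun w : ℂ => (P.q0 : ℂ) ^ 2 / w) s :=
        continuousAt_const.div continuousAt_id hs0
      exact this.tendsto.mono_left nhdsWithin_le_nhds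
    · filter_upwards [self_mem_nhdsWithin] with z hz
      exact div_mem_upper_of_lower hq hz

end Potential

end

end VNLS

/-! ### The Jost eigenfunctions at the base point -/

namespace VNLS

noncomputable section

open LinearODE Damped

attribute [local instance] Matrix.linftyOpNormedRing Matrix.linftyOpNormedAlgebra

namespace Potential

variable {P : Potential} {σ : ℝ} {qb : ℂ}

/-- The eigenfunctions `φ_-` at the base point `(0,0)`, and their transport to `(x,t)`. -/
theorem φm_spec (hsol : P.IsSolution) (hbc : P.HasNZBC) {s : ℝ} (hs : (s : ℂ) ∈ P.regular) :
    Tendsto (fun n : ℕ => P.V 1 P.qm s (-(n : ℝ))) atTop (𝓝 (P.φm 0 0 s)) ∧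
      (P.φm 0 0 s).conjTranspose * J * P.φm 0 0 s = P.Γ s ∧ (P.φm 0 0 s).det = P.γ s ∧
      ∀ x t, P.φm x t s = P.G x t (P.k s) * P.φm 0 0 s := by
  obtain ⟨C, h1, h2, h3, h4, h5⟩ := exists_jost hsol hbc.isEnd_left hs
  have e : map (fun y : ℝ => 1 * y) atBot = atBot := by simp
  rw [e] at h4 h5
  have h : ∃ Φ, P.IsJost atBot P.qm s Φ := ⟨_, h4⟩
  have h6 : ∀ x t, P.φm x t s = P.G x t (P.k s) * C := fun x t => by
    simp only [φm, dif_pos h]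
    exact h5 _ h.choose_spec x t
  have h7 : P.φm 0 0 s = C := by rw [h6, G_zero, one_mul]
  rw [h7]
  exact ⟨h1, h2, h3, h6⟩

/-- The eigenfunctions `φ_+` at the base point `(0,0)`, and their transport to `(x,t)`. -/
theorem φp_spec (hsol : P.IsSolution) (hbc : P.HasNZBC) {s : ℝ} (hs : (s : ℂ) ∈ P.regular) :
    Tendsto (fun n : ℕ => P.V (-1) P.qp s (-(n : ℝ))) atTop (𝓝 (P.φp 0 0 s)) ∧
      (P.φp 0 0 s).conjTranspose * J * P.φp 0 0 s = P.Γ s ∧ (P.φp 0 0 s).det = P.γ s ∧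
      ∀ x t, P.φp x t s = P.G x t (P.k s) * P.φp 0 0 s := by
  obtain ⟨C, h1, h2, h3, h4, h5⟩ := exists_jost hsol hbc.isEnd_right hs
  have e : map (fun y : ℝ => -1 * y) atBot = atTop := by
    simp only [neg_one_mul]
    exact Filter.map_neg_atBot
  rw [e] at h4 h5
  have h : ∃ Φ, P.IsJost atTop P.qp s Φ := ⟨_, h4⟩
  have h6 : ∀ x t, P.φp x t s = P.G x t (P.k s) * C := fun x t => by
    simp only [φp, dif_pos h]
    exact h5 _ h.choose_spec x t
  have h7 : P.φp 0 0 s = C := by rw [h6, G_zero, one_mul]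
  rw [h7]
  exact ⟨h1, h2, h3, h6⟩

/-- The matrix relating the eigenvectors at `q_o² / z` to those at `z`. -/
def hatSwap (P : Potential) (qb z : ℂ) : Mat4 :=
  !![0, 0, 0, -(Complex.I * star qb * z / (P.q0 : ℂ) ^ 2); 0, 1, 0, 0; 0, 0, 1, 0;
    Complex.I * qb * z / (P.q0 : ℂ) ^ 2, 0, 0, 0]

theorem k_hat (hq : 0 < P.q0) {z : ℂ} (hz : z ≠ 0) : P.k ((P.q0 : ℂ) ^ 2 / z) = P.k z := by
  have hq' : (P.q0 : ℂ) ≠ 0 := Complex.ofReal_ne_zero.2 hq.ne'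
  rw [k, k]; field_simp; ring

theorem lam_hat (hq : 0 < P.q0) {z : ℂ} (hz : z ≠ 0) : P.lam ((P.q0 : ℂ) ^ 2 / z) = -P.lam z := by
  have hq' : (P.q0 : ℂ) ≠ 0 := Complex.ofReal_ne_zero.2 hq.ne'
  rw [lam, lam]; field_simp; ring

/-- The symmetry `z ↦ q_o² / z`: it fixes `k`, changes the sign of `λ`, and interchanges the first
and fourth columns up to factors. -/
theorem V_hat (hq : 0 < P.q0) (hqb : ‖qb‖ = P.q0) {z : ℂ} (hz : z ≠ 0) (a : ℝ) :
    P.V σ qb ((P.q0 : ℂ) ^ 2 / z) a = P.V σ qb z a * P.hatSwap qb z := by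
  have hq' : (P.q0 : ℂ) ≠ 0 := Complex.ofReal_ne_zero.2 hq.ne'
  have h := star_mul_self_of_norm hqb
  rw [Complex.star_def] at h
  have hE : E qb ((P.q0 : ℂ) ^ 2 / z) = E qb z * P.hatSwap qb z := by
    have hI := Complex.I_sq
    rw [E_eq, E_eq, hatSwap]
    ext i j
    rw [Matrix.mul_apply, Fin.sum_univ_four]
    fin_cases i <;> fin_cases j <;> simp <;> field_simp
    · linear_combination (-1) * h + (starRingEnd ℂ) qb * qb * hI
    · linear_combination (-1) * h + (starRingEnd ℂ) qb * qb * hI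
  have hD : P.hatSwap qb z * (Matrix.diagonal fun j =>
      Complex.exp (P.ev ((P.q0 : ℂ) ^ 2 / z) j * (σ * a : ℝ))) =
      (Matrix.diagonal fun j => Complex.exp (P.ev z j * (σ * a : ℝ))) * P.hatSwap qb z := by
    ext i j
    rw [Matrix.mul_diagonal, Matrix.diagonal_mul]
    simp only [ev, k_hat hq hz, lam_hat hq hz]
    fin_cases i <;> fin_cases j <;> simp [hatSwap, mul_comm]
  rw [V, V, k_hat hq hz, hE, mul_assoc (E qb z), hD]
  simp only [mul_assoc]

theorem φm_hat (hsol : P.IsSolution) (hbc : P.HasNZBC) {s : ℝ} (hs : (s : ℂ) ∈ P.regular) :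
    P.φm 0 0 (P.q0 ^ 2 / s) = P.φm 0 0 s * P.hatSwap P.qm s := by
  have e : ((P.q0 ^ 2 / s : ℝ) : ℂ) = (P.q0 : ℂ) ^ 2 / s := by push_cast; ring
  have h1 := (φm_spec hsol hbc (s := P.q0 ^ 2 / s)
    (by rw [e]; exact mem_regular_div hbc.q0_pos hs)).1
  have h2 := ((φm_spec hsol hbc hs).1).mul_const (P.hatSwap P.qm s)
  refine tendsto_nhds_unique h1 (h2.congr fun n => ?_)
  rw [e, V_hat hbc.q0_pos hbc.norm_qm hs.1]

theorem φp_hat (hsol : P.IsSolution) (hbc : P.HasNZBC) {s : ℝ} (hs : (s : ℂ) ∈ P.regular) :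
    P.φp 0 0 (P.q0 ^ 2 / s) = P.φp 0 0 s * P.hatSwap P.qp s := by
  have e : ((P.q0 ^ 2 / s : ℝ) : ℂ) = (P.q0 : ℂ) ^ 2 / s := by push_cast; ring
  have h1 := (φp_spec hsol hbc (s := P.q0 ^ 2 / s)
    (by rw [e]; exact mem_regular_div hbc.q0_pos hs)).1
  have h2 := ((φp_spec hsol hbc hs).1).mul_const (P.hatSwap P.qp s)
  refine tendsto_nhds_unique h1 (h2.congr fun n => ?_)
  rw [e, V_hat hbc.q0_pos hbc.norm_qp hs.1]

theorem tendsto_col {F : ℕ → Mat4} {C : Mat4} (h : Tendsto F atTop (𝓝 C)) (j : Fin 4) :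
    Tendsto (fun n => (F n).col j) atTop (𝓝 (C.col j)) :=
  tendsto_pi_nhds.2 fun i => tendsto_pi_nhds.1 (tendsto_pi_nhds.1 h i) j

theorem tendsto_wedge {u v : ℕ → Fin 4 → ℂ} {u₀ v₀ : Fin 4 → ℂ} (hu : Tendsto u atTop (𝓝 u₀))
    (hv : Tendsto v atTop (𝓝 v₀)) : Tendsto (fun n => wedge (u n) (v n)) atTop (𝓝 (wedge u₀ v₀)) :=
  tendsto_pi_nhds.2 fun i => tendsto_pi_nhds.2 fun l =>
    ((tendsto_pi_nhds.1 hu i).mul (tendsto_pi_nhds.1 hv l)).sub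
      ((tendsto_pi_nhds.1 hu l).mul (tendsto_pi_nhds.1 hv i))

theorem ev_re_bounds {z : ℂ} (hz : z ∈ P.closedUpper) (i : Fin 4) :
    |(P.ev z i).re| ≤ (P.lam z).im := by
  have h := abs_im_k_le (P := P) hz.1
  have h' : |(P.lam z).im| ≤ (P.lam z).im := by
    rw [abs_of_nonneg ((abs_nonneg _).trans h)]
  obtain ⟨e0, e1, e2, e3⟩ := ev_re (P := P) z
  fin_cases i
  · simpa only [Fin.zero_eta, e0] using h'
  · simpa only [Fin.mk_one, e1, abs_neg] using h
  · simpa only [Fin.reduceFinMk, e2, abs_neg] using h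
  · simpa only [Fin.reduceFinMk, e3, abs_neg] using h'

/-- The extension of `φ_{-,1}` at the base point. -/
theorem exists_col_left (hsol : P.IsSolution) (hbc : P.HasNZBC) :
    ∃ a : ℂ → Fin 4 → ℂ, P.HolUp a ∧ (∀ s : ℝ, (s : ℂ) ∈ P.regular → a s = (P.φm 0 0 s).col 0) ∧
      ∀ z ∈ P.closedUpper, a z ≠ 0 := by
  obtain ⟨a, h1, h2, h3, h4⟩ := exists_col_limit (σ := 1) hsol hbc.isEnd_left
    (S := P.closedUpper) (fun z hz => hz.2) 0 (fun z hz i => by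
      rw [Complex.ofReal_one, one_mul, Complex.sub_re, (ev_re z).1]
      linarith [(abs_le.1 (ev_re_bounds hz i)).2])
  exact ⟨a, ⟨h2, h3 _ upper_subset_closedUpper isOpen_upper⟩, fun s hs =>
    tendsto_nhds_unique (h1 s (ofReal_mem_closedUpper hs)) (tendsto_col (φm_spec hsol hbc hs).1 0), h4⟩

/-- The extension of `φ_{+,4}` at the base point. -/
theorem exists_col_right (hsol : P.IsSolution) (hbc : P.HasNZBC) :
    ∃ b : ℂ → Fin 4 → ℂ, P.HolUp b ∧ (∀ s : ℝ, (s : ℂ) ∈ P.regular → b s = (P.φp 0 0 s).col 3) ∧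
      ∀ z ∈ P.closedUpper, b z ≠ 0 := by
  obtain ⟨a, h1, h2, h3, h4⟩ := exists_col_limit (σ := -1) hsol hbc.isEnd_right
    (S := P.closedUpper) (fun z hz => hz.2) 3 (fun z hz i => by
      rw [Complex.ofReal_neg, Complex.ofReal_one, neg_one_mul, Complex.neg_re, Complex.sub_re,
        (ev_re z).2.2.2]
      linarith [(abs_le.1 (ev_re_bounds hz i)).1])
  exact ⟨a, ⟨h2, h3 _ upper_subset_closedUpper isOpen_upper⟩, fun s hs =>
    tendsto_nhds_unique (h1 s (ofReal_mem_closedUpper hs)) (tendsto_col (φp_spec hsol hbc hs).1 3), h4⟩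

/-- The extension of `φ_{-,1} ∧ φ_{-,m}` at the base point. -/
theorem exists_wedge_left (hsol : P.IsSolution) (hbc : P.HasNZBC) {m : Fin 4}
    (hm : m = 1 ∨ m = 2) :
    ∃ F : ℂ → Fin 4 → Fin 4 → ℂ, P.HolUp F ∧ (∀ s : ℝ, (s : ℂ) ∈ P.regular →
      F s = wedge ((P.φm 0 0 s).col 0) ((P.φm 0 0 s).col m)) ∧ ∀ z ∈ P.closedUpper, F z ≠ 0 := by
  have hm0 : (0 : Fin 4) ≠ m := by rcases hm with rfl | rfl <;> decide
  obtain ⟨F, h1, h2, h3, h4⟩ := exists_wedge_limit (σ := 1) hsol hbc.isEnd_left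
    (S := P.closedUpper) (fun z hz => hz.2) hm0 (fun z hz i l hil => by
      rw [Complex.ofReal_one, one_mul, Complex.sub_re, Complex.sub_re, Complex.add_re]
      obtain ⟨e0, e1, e2, e3⟩ := ev_re (P := P) z
      obtain ⟨h5, h6⟩ := abs_le.1 (abs_im_k_le (P := P) hz.1)
      rcases hm with rfl | rfl <;> fin_cases i <;> fin_cases l <;>
        simp only [Fin.zero_eta, Fin.mk_one, Fin.reduceFinMk, e0, e1, e2, e3] <;>
        first | linarith | exact absurd rfl hil)
  exact ⟨F, ⟨h2, h3 _ upper_subset_closedUpper isOpen_upper⟩, fun s hs =>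
    tendsto_nhds_unique (h1 s (ofReal_mem_closedUpper hs))
      (tendsto_wedge (tendsto_col (φm_spec hsol hbc hs).1 0)
        (tendsto_col (φm_spec hsol hbc hs).1 m)), h4⟩

/-- The extension of `φ_{+,m} ∧ φ_{+,4}` at the base point. -/
theorem exists_wedge_right (hsol : P.IsSolution) (hbc : P.HasNZBC) {m : Fin 4}
    (hm : m = 1 ∨ m = 2) :
    ∃ F : ℂ → Fin 4 → Fin 4 → ℂ, P.HolUp F ∧ (∀ s : ℝ, (s : ℂ) ∈ P.regular →
      F s = wedge ((P.φp 0 0 s).col m) ((P.φp 0 0 s).col 3)) ∧ ∀ z ∈ P.closedUpper, F z ≠ 0 := by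
  have hm0 : m ≠ (3 : Fin 4) := by rcases hm with rfl | rfl <;> decide
  obtain ⟨F, h1, h2, h3, h4⟩ := exists_wedge_limit (σ := -1) hsol hbc.isEnd_right
    (S := P.closedUpper) (fun z hz => hz.2) hm0 (fun z hz i l hil => by
      rw [Complex.ofReal_neg, Complex.ofReal_one, neg_one_mul, Complex.neg_re, Complex.sub_re,
        Complex.sub_re, Complex.add_re]
      obtain ⟨e0, e1, e2, e3⟩ := ev_re (P := P) z
      obtain ⟨h5, h6⟩ := abs_le.1 (abs_im_k_le (P := P) hz.1)
      rcases hm with rfl | rfl <;> fin_cases i <;> fin_cases l <;>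
        simp only [Fin.zero_eta, Fin.mk_one, Fin.reduceFinMk, e0, e1, e2, e3] <;>
        first | linarith | exact absurd rfl hil)
  exact ⟨F, ⟨h2, h3 _ upper_subset_closedUpper isOpen_upper⟩, fun s hs =>
    tendsto_nhds_unique (h1 s (ofReal_mem_closedUpper hs))
      (tendsto_wedge (tendsto_col (φp_spec hsol hbc hs).1 m)
        (tendsto_col (φp_spec hsol hbc hs).1 3)), h4⟩

end Potential

end

end VNLS

/-! ### Algebra of the scattering matrix on the continuous spectrum -/

namespace VNLS

noncomputable section

/-- The vector `χ^m = A₀₀ Ψ_m - A₀ₘ Ψ₀`, with indices starting from `0`. -/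
def chi (A Ψ : Mat4) (m : Fin 4) : Fin 4 → ℂ := A 0 0 • Ψ.col m - A 0 m • Ψ.col 0

/-- The minor with rows `0, n` and columns `0, m`. -/
def pmin (A : Mat4) (n m : Fin 4) : ℂ := (A.submatrix ![0, n] ![0, m]).det

/-- The vector obtained by expanding, along the columns of `Ψ`, the minor with rows `0, n` of the
columns `0, n, m`. -/
def psi (A Ψ : Mat4) (n m : Fin 4) : Fin 4 → ℂ :=
  pmin A n n • Ψ.col m - pmin A n m • Ψ.col n + (A.submatrix ![0, n] ![n, m]).det • Ψ.col 0

/-- The minor with rows and columns `0, 1, 2`. -/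
def pthree (A : Mat4) : ℂ := (A.submatrix ![0, 1, 2] ![0, 1, 2]).det

/-- The pairing of bivectors given by the volume form. -/
def pairing (F G : Fin 4 → Fin 4 → ℂ) : ℂ :=
  F 0 1 * G 2 3 - F 0 2 * G 1 3 + F 0 3 * G 1 2 + F 1 2 * G 0 3 - F 1 3 * G 0 2 + F 2 3 * G 0 1

theorem pairing_wedge (u v w x : Fin 4 → ℂ) :
    pairing (wedge u v) (wedge w x) = (Matrix.of ![u, v, w, x]).det := by
  rw [Matrix.det_succ_row_zero]
  simp [Fin.sum_univ_succ, Matrix.det_fin_three, Fin.succAbove, pairing, wedge]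
  ring

theorem det_submatrix_two (A : Mat4) (a b c d : Fin 4) :
    (A.submatrix ![a, b] ![c, d]).det = A a c * A b d - A a d * A b c := by
  rw [Matrix.det_fin_two]; rfl

theorem det_submatrix_three (A : Mat4) (a b c a' b' c' : Fin 4) :
    (A.submatrix ![a, b, c] ![a', b', c']).det = A a a' * (A b b' * A c c' - A b c' * A c b')
      - A a b' * (A b a' * A c c' - A b c' * A c a')
      + A a c' * (A b a' * A c b' - A b b' * A c a') := by
  rw [Matrix.det_fin_three]
  simp only [Matrix.submatrix_apply, Matrix.cons_val]
  ring

theorem det_of_mulVec (M : Mat4) (u v w x : Fin 4 → ℂ) :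
    (Matrix.of ![M.mulVec u, M.mulVec v, M.mulVec w, M.mulVec x]).det =
      M.det * (Matrix.of ![u, v, w, x]).det := by
  rw [← Matrix.det_transpose M, mul_comm, ← Matrix.det_mul]
  congr 1
  ext i j
  rw [Matrix.mul_apply]
  fin_cases i <;> simp [Matrix.mulVec, dotProduct, mul_comm]

theorem pmin_eq (A : Mat4) (n m : Fin 4) : pmin A n m = A 0 0 * A n m - A 0 m * A n 0 := by
  rw [pmin, det_submatrix_two]

theorem psi_eq (A Ψ : Mat4) (n m : Fin 4) : psi A Ψ n m = pmin A n n • Ψ.col m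
    - pmin A n m • Ψ.col n + (A 0 n * A n m - A 0 m * A n n) • Ψ.col 0 := by
  rw [psi, det_submatrix_two]

theorem pthree_eq (A : Mat4) : pthree A = A 0 0 * (A 1 1 * A 2 2 - A 1 2 * A 2 1)
    - A 0 1 * (A 1 0 * A 2 2 - A 1 2 * A 2 0) + A 0 2 * (A 1 0 * A 2 1 - A 1 1 * A 2 0) := by
  rw [pthree, det_submatrix_three]

theorem wedge_col_chi (A Ψ : Mat4) (m : Fin 4) :
    wedge (Ψ.col 0) (chi A Ψ m) = A 0 0 • wedge (Ψ.col 0) (Ψ.col m) := by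
  funext i l
  simp only [wedge, chi, Pi.sub_apply, Pi.smul_apply, smul_eq_mul]
  ring

/-- Sylvester's determinant identity. -/
theorem pmin_mul_sub_mul (A : Mat4) {n m : Fin 4} (hnm : n = 1 ∧ m = 2 ∨ n = 2 ∧ m = 1) :
    pmin A m m * pmin A n n - pmin A m n * pmin A n m = A 0 0 * pthree A := by
  rcases hnm with ⟨rfl, rfl⟩ | ⟨rfl, rfl⟩ <;> simp only [pmin_eq, pthree_eq] <;> ring

theorem smul_psi (A Ψ : Mat4) (n m : Fin 4) :
    A 0 0 • psi A Ψ n m = pmin A n n • chi A Ψ m - pmin A n m • chi A Ψ n := by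
  funext i
  simp only [psi_eq, chi, pmin_eq, Pi.sub_apply, Pi.add_apply, Pi.smul_apply, smul_eq_mul]
  ring

theorem smul_chi (A Ψ : Mat4) {n m : Fin 4} (hnm : n = 1 ∧ m = 2 ∨ n = 2 ∧ m = 1) :
    pthree A • chi A Ψ m = pmin A m m • psi A Ψ n m + pmin A n m • psi A Ψ m n := by
  funext i
  rcases hnm with ⟨rfl, rfl⟩ | ⟨rfl, rfl⟩ <;>
  · simp only [psi_eq, chi, pmin_eq, pthree_eq, Pi.sub_apply, Pi.add_apply, Pi.smul_apply,
      smul_eq_mul]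
    ring

/-- `ψ^m` has no components along the first column of `Φ` and along the column `n`, because the
corresponding minors have two equal rows. -/
theorem psi_mul (A Φ : Mat4) {n m : Fin 4} (hnm : n = 1 ∧ m = 2 ∨ n = 2 ∧ m = 1) :
    psi A (Φ * A) n m = pthree A • Φ.col m +
      (A.submatrix ![0, n, 3] ![0, n, m]).det • Φ.col 3 := by
  funext i
  rcases hnm with ⟨rfl, rfl⟩ | ⟨rfl, rfl⟩ <;>
  · simp only [psi_eq, pmin_eq, pthree_eq, det_submatrix_three, Matrix.mul_apply,
      Fin.sum_univ_four, Pi.sub_apply, Pi.add_apply, Pi.smul_apply, smul_eq_mul, Matrix.col_apply]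
    ring

/-- The properties of the two eigenfunction matrices `Φ = φ_+`, `Ψ = φ_-` and of the scattering
matrix at a point of the continuous spectrum; `g` is the value of `γ`. -/
structure IsScattering (g : ℂ) (Φ Ψ A : Mat4) : Prop where
  ne : g ≠ 0
  eq : Ψ = Φ * A
  conj_left : Φ.conjTranspose * J * Φ = Matrix.diagonal ![g, -1, -1, -g]
  conj_right : Ψ.conjTranspose * J * Ψ = Matrix.diagonal ![g, -1, -1, -g]
  det_left : Φ.det = g
  det_right : Ψ.det = g

namespace IsScattering

variable {g : ℂ} {Φ Ψ A : Mat4}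

theorem det_eq_one (h : IsScattering g Φ Ψ A) : A.det = 1 := by
  have := h.det_right
  rw [h.eq, Matrix.det_mul, h.det_left] at this
  exact mul_left_cancel₀ h.ne (this.trans (mul_one g).symm)

theorem gram (h : IsScattering g Φ Ψ A) :
    Φ.conjTranspose * J * Ψ = Matrix.diagonal ![g, -1, -1, -g] * A := by
  rw [h.eq, ← mul_assoc, h.conj_left]

theorem gram' (h : IsScattering g Φ Ψ A) :
    Ψ.conjTranspose * J * Φ = A.conjTranspose * Matrix.diagonal ![g, -1, -1, -g] := by
  rw [h.eq, Matrix.conjTranspose_mul, ← h.conj_left]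
  simp only [mul_assoc]

/-- `A` is unitary with respect to `diag(g, -1, -1, -g)` and has determinant `1`, so its cofactors
are, up to the weights, the complex conjugates of its entries. -/
theorem diagonal_mul_adjugate (h : IsScattering g Φ Ψ A) :
    Matrix.diagonal ![g, -1, -1, -g] * A.adjugate =
      A.conjTranspose * Matrix.diagonal ![g, -1, -1, -g] := by
  have h1 : A.conjTranspose * Matrix.diagonal ![g, -1, -1, -g] * A =
      Matrix.diagonal ![g, -1, -1, -g] := by
    rw [← h.gram', mul_assoc, ← h.eq, h.conj_right]
  calc _ = A.conjTranspose * Matrix.diagonal ![g, -1, -1, -g] * A * A.adjugate := by rw [h1]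
    _ = _ := by rw [mul_assoc, Matrix.mul_adjugate, h.det_eq_one, one_smul, mul_one]

/-- The cofactor identity for the last diagonal entry. -/
theorem pthree_eq_star (h : IsScattering g Φ Ψ A) : pthree A = star (A 3 3) := by
  have h1 := congrFun (congrFun h.diagonal_mul_adjugate 3) 3
  rw [Matrix.diagonal_mul, Matrix.mul_diagonal, Matrix.adjugate_fin_succ_eq_det_submatrix] at h1
  simp [Matrix.det_fin_three, Fin.succAbove] at h1
  rw [pthree_eq, Complex.star_def]
  refine mul_left_cancel₀ h.ne ?_
  linear_combination h1

theorem mul_minor (h : IsScattering g Φ Ψ A) {n m : Fin 4}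
    (hnm : n = 1 ∧ m = 2 ∨ n = 2 ∧ m = 1) :
    g * (A.submatrix ![0, n, 3] ![0, n, m]).det = - star (A m 3) := by
  have h1 := congrFun (congrFun h.diagonal_mul_adjugate 3) m
  rw [Matrix.diagonal_mul, Matrix.mul_diagonal, Matrix.adjugate_fin_succ_eq_det_submatrix] at h1
  rcases hnm with ⟨rfl, rfl⟩ | ⟨rfl, rfl⟩
  · simp [Matrix.det_fin_three, Fin.succAbove] at h1
    rw [det_submatrix_three, Complex.star_def]
    linear_combination (-1) * h1
  · simp [Matrix.det_fin_three, Fin.succAbove] at h1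
    rw [det_submatrix_three, Complex.star_def]
    linear_combination (-1) * h1

/-- `χ^m` in terms of the bivector `Ψ₀ ∧ Ψ_m` and of the complex conjugate of the column `Φ₀`. -/
theorem chi_eq (h : IsScattering g Φ Ψ A) (m j : Fin 4) :
    chi A Ψ m j = g⁻¹ * ∑ i, star (Φ i 0) * J i i * wedge (Ψ.col 0) (Ψ.col m) i j := by
  have e : ∀ l, g * A 0 l = ∑ i, star (Φ i 0) * J i i * Ψ i l := by
    intro l
    have h1 := congrFun (congrFun h.gram 0) l
    rw [Matrix.diagonal_mul, Matrix.mul_apply] at h1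
    simp only [J, Matrix.mul_diagonal, Matrix.conjTranspose_apply, Matrix.diagonal_apply_eq] at h1 ⊢
    exact h1.symm
  rw [eq_inv_mul_iff_mul_eq₀ h.ne]
  simp only [wedge, mul_sub, Finset.sum_sub_distrib, ← mul_assoc, chi, Pi.sub_apply, Pi.smul_apply,
    smul_eq_mul, Matrix.col_apply]
  rw [e, e, Finset.sum_mul, Finset.sum_mul]
  congr 1
  exact Finset.sum_congr rfl fun i _ => by ring

theorem apply_zero_zero (h : IsScattering g Φ Ψ A) :
    A 0 0 = g⁻¹ * ∑ i, star (Φ i 0) * J i i * Ψ i 0 := by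
  have h1 := congrFun (congrFun h.gram 0) 0
  rw [Matrix.diagonal_mul, Matrix.mul_apply] at h1
  simp only [J, Matrix.mul_diagonal, Matrix.conjTranspose_apply, Matrix.diagonal_apply_eq] at h1 ⊢
  rw [h1]
  simp [h.ne]

/-- `ψ^m` in terms of the bivector `Φ_m ∧ Φ₃` and of the complex conjugate of `Ψ₃`. -/
theorem psi_eq_sum (h : IsScattering g Φ Ψ A) {n m : Fin 4}
    (hnm : n = 1 ∧ m = 2 ∨ n = 2 ∧ m = 1) (j : Fin 4) :
    psi A Ψ n m j = g⁻¹ * ∑ i, star (Ψ i 3) * J i i * wedge (Φ.col m) (Φ.col 3) i j := by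
  have e : ∀ l, star (A l 3) * (![g, -1, -1, -g] : Fin 4 → ℂ) l =
      ∑ i, star (Ψ i 3) * J i i * Φ i l := by
    intro l
    have h1 := congrFun (congrFun h.gram' 3) l
    rw [Matrix.mul_diagonal, Matrix.mul_apply] at h1
    simp only [J, Matrix.mul_diagonal, Matrix.conjTranspose_apply, Matrix.diagonal_apply_eq] at h1 ⊢
    exact h1.symm
  have e3 := e 3
  have em := e m
  have hm : (![g, -1, -1, -g] : Fin 4 → ℂ) m = -1 := by
    rcases hnm with ⟨-, rfl⟩ | ⟨-, rfl⟩ <;> simp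
  rw [hm] at em
  simp only [Matrix.cons_val] at e3
  have h2 : ∑ i, star (Ψ i 3) * J i i * wedge (Φ.col m) (Φ.col 3) i j =
      (∑ i, star (Ψ i 3) * J i i * Φ i m) * Φ j 3 -
        (∑ i, star (Ψ i 3) * J i i * Φ i 3) * Φ j m := by
    simp only [wedge, mul_sub, Finset.sum_sub_distrib, Finset.sum_mul, Matrix.col_apply]
    congr 1 <;> exact Finset.sum_congr rfl fun i _ => by ring
  have hpsi : psi A Ψ n m j = pthree A * Φ j m +
      (A.submatrix ![0, n, 3] ![0, n, m]).det * Φ j 3 := by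
    rw [h.eq, psi_mul A Φ hnm]; rfl
  rw [eq_inv_mul_iff_mul_eq₀ h.ne, h2, ← e3, ← em, hpsi, h.pthree_eq_star]
  linear_combination Φ j 3 * h.mul_minor hnm

theorem wedge_psi_col (h : IsScattering g Φ Ψ A) {n m : Fin 4}
    (hnm : n = 1 ∧ m = 2 ∨ n = 2 ∧ m = 1) :
    wedge (psi A Ψ n m) (Φ.col 3) = pthree A • wedge (Φ.col m) (Φ.col 3) := by
  rw [h.eq, psi_mul A Φ hnm]
  funext i l
  simp only [wedge, Pi.add_apply, Pi.smul_apply, smul_eq_mul]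
  ring

/-- The minors with rows `0, n` and columns `0, m` in terms of bivectors. -/
theorem pmin_eq_pairing (h : IsScattering g Φ Ψ A) {n n' : Fin 4}
    (hnn : n = 1 ∧ n' = 2 ∨ n = 2 ∧ n' = 1) (m : Fin 4) :
    pmin A n m = (if n = 1 then 1 else -1) * (g⁻¹ *
      pairing (wedge (Ψ.col 0) (Ψ.col m)) (wedge (Φ.col n') (Φ.col 3))) := by
  have e1 : ∀ l, Ψ.col l = Φ.mulVec (A.col l) := fun l => by
    rw [h.eq]; rfl
  have e2 : ∀ l, Φ.col l = Φ.mulVec (Pi.single l 1) := fun l => by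
    rw [Matrix.mulVec_single_one]
  rw [pairing_wedge, e1, e1, e2 n', e2 3, det_of_mulVec, h.det_left, inv_mul_cancel_left₀ h.ne,
    pmin_eq, Matrix.det_succ_row_zero]
  rcases hnn with ⟨rfl, rfl⟩ | ⟨rfl, rfl⟩
  · simp [Fin.sum_univ_succ, Matrix.det_fin_three, Fin.succAbove, Pi.single_apply]
    ring
  · simp [Fin.sum_univ_succ, Matrix.det_fin_three, Fin.succAbove, Pi.single_apply]
    ring

/-- Complementary minors of the scattering matrix are complex conjugate. -/
theorem pmin_eq_star (h : IsScattering g Φ Ψ A) {n n' : Fin 4}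
    (hnn : n = 1 ∧ n' = 2 ∨ n = 2 ∧ n' = 1) :
    pmin A n n = star (A 3 3 * A n' n' - A 3 n' * A n' 3) := by
  set B := A.adjugate with hB
  have hAB : ∀ l, A.mulVec (B.col l) = Pi.single l 1 := fun l => by
    have h1 : A * B = 1 := by rw [hB, Matrix.mul_adjugate, h.det_eq_one, one_smul]
    have h2 : A.mulVec (B.col l) = (A * B).col l := rfl
    rw [h2, h1]
    funext i
    simp [Matrix.one_apply, Pi.single_apply]
  have hA0 : ∀ l, A.mulVec (Pi.single l 1) = A.col l := fun l => Matrix.mulVec_single_one _ _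
  have h1 : (Matrix.of ![A.mulVec (Pi.single 0 1), A.mulVec (Pi.single n 1), A.mulVec (B.col n'),
      A.mulVec (B.col 3)]).det =
      (Matrix.of ![Pi.single 0 1, Pi.single n 1, B.col n', B.col 3] : Mat4).det := by
    rw [det_of_mulVec, h.det_eq_one, one_mul]
  rw [hA0, hA0, hAB, hAB] at h1
  have hBe : ∀ i j, (![g, -1, -1, -g] : Fin 4 → ℂ) i * B i j =
      star (A j i) * (![g, -1, -1, -g] : Fin 4 → ℂ) j := fun i j => by
    have h1 := congrFun (congrFun h.diagonal_mul_adjugate i) j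
    rwa [Matrix.diagonal_mul, Matrix.mul_diagonal] at h1
  have b33 := hBe 3 3
  have b3 := hBe 3 n'
  have b'3 := hBe n' 3
  have b' := hBe n' n'
  have hg := h.ne
  rw [Matrix.det_succ_row_zero, Matrix.det_succ_row_zero] at h1
  rw [pmin_eq]
  have key : A 0 0 * A n n - A 0 n * A n 0 = B 3 3 * B n' n' - B 3 n' * B n' 3 := by
    rcases hnn with ⟨rfl, rfl⟩ | ⟨rfl, rfl⟩ <;>
    · simp [Fin.sum_univ_succ, Matrix.det_fin_three, Fin.succAbove, Pi.single_apply] at h1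
      first | linear_combination h1 | linear_combination (-1) * h1
  rw [key]
  have hn' : (![g, -1, -1, -g] : Fin 4 → ℂ) n' = -1 := by
    rcases hnn with ⟨-, rfl⟩ | ⟨-, rfl⟩ <;> simp
  rw [hn'] at b' b3 b'3
  simp only [Matrix.cons_val] at b33 b3 b'3
  simp only [Complex.star_def, map_sub, map_mul] at b33 b3 b'3 b' ⊢
  refine mul_left_cancel₀ hg ?_
  have e33 : B 3 3 = (starRingEnd ℂ) (A 3 3) := mul_left_cancel₀ hg (by linear_combination (-1)*b33)
  have e' : B n' n' = (starRingEnd ℂ) (A n' n') := by linear_combination (-1) * b'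
  have e'3 : B n' 3 = g * (starRingEnd ℂ) (A 3 n') := by linear_combination (-1) * b'3
  rw [e33, e', e'3]
  linear_combination g * (starRingEnd ℂ) (A 3 n') * b3

end IsScattering

/-- The relation between the scattering matrices `A` at `s` and `A'` at `q_o² / s`. -/
structure IsReflected (ρ κ κ' : ℂ) (A A' : Mat4) : Prop where
  mul : κ * κ' = ρ
  apply_33 : A 3 3 = ρ * A' 0 0
  apply_3 : ∀ m, m = 1 ∨ m = 2 → A 3 m = κ' * A' 0 m
  apply_m3 : ∀ m, m = 1 ∨ m = 2 → A m 3 = κ * A' m 0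
  apply_mn : ∀ m n, m = 1 ∨ m = 2 → n = 1 ∨ n = 2 → A m n = A' m n

namespace IsReflected

variable {ρ κ κ' : ℂ} {A A' Ψ Ψ' : Mat4}

theorem minor_mn (h : IsReflected ρ κ κ' A A') {m n : Fin 4} (hm : m = 1 ∨ m = 2)
    (hn : n = 1 ∨ n = 2) : A m n * A 3 3 - A m 3 * A 3 n = ρ * pmin A' m n := by
  rw [h.apply_33, h.apply_3 n hn, h.apply_m3 m hm, h.apply_mn m n hm hn, pmin_eq, ← h.mul]
  ring

theorem minor_three (h : IsReflected ρ κ κ' A A') :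
    (A.submatrix ![1, 2, 3] ![1, 2, 3]).det = ρ * pthree A' := by
  have h1 : (1 : Fin 4) = 1 ∨ (1 : Fin 4) = 2 := Or.inl rfl
  have h2 : (2 : Fin 4) = 1 ∨ (2 : Fin 4) = 2 := Or.inr rfl
  rw [det_submatrix_three, pthree_eq, h.apply_33, h.apply_3 1 h1, h.apply_3 2 h2, h.apply_m3 1 h1, h.apply_m3 2 h2,
    h.apply_mn 1 1 h1 h1, h.apply_mn 1 2 h1 h2, h.apply_mn 2 1 h2 h1, h.apply_mn 2 2 h2 h2, ← h.mul]
  ring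

theorem chi_lower (h : IsReflected ρ κ κ' A A') (hΨ : Ψ.col 2 = Ψ'.col 2)
    (hΨ3 : Ψ.col 3 = κ • Ψ'.col 0) :
    A 3 3 • Ψ.col 2 - A 3 2 • Ψ.col 3 = ρ • chi A' Ψ' 2 := by
  rw [h.apply_33, h.apply_3 2 (Or.inr rfl), hΨ, hΨ3, chi, smul_sub, smul_smul, smul_smul, smul_smul,
    ← h.mul]
  congr 2
  ring

theorem psi_lower (h : IsReflected ρ κ κ' A A') (hΨ1 : Ψ.col 1 = Ψ'.col 1)
    (hΨ : Ψ.col 2 = Ψ'.col 2) (hΨ3 : Ψ.col 3 = κ • Ψ'.col 0) :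
    (A.submatrix ![2, 3] ![2, 3]).det • Ψ.col 1 - (A.submatrix ![2, 3] ![1, 3]).det • Ψ.col 2
      + (A.submatrix ![2, 3] ![1, 2]).det • Ψ.col 3 = ρ • psi A' Ψ' 2 1 := by
  have h1 : (1 : Fin 4) = 1 ∨ (1 : Fin 4) = 2 := Or.inl rfl
  have h2 : (2 : Fin 4) = 1 ∨ (2 : Fin 4) = 2 := Or.inr rfl
  have e1 : (A.submatrix ![2, 3] ![2, 3]).det = ρ * pmin A' 2 2 := by
    rw [← h.minor_mn h2 h2]; rw [det_submatrix_two]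
  have e2 : (A.submatrix ![2, 3] ![1, 3]).det = ρ * pmin A' 2 1 := by
    rw [← h.minor_mn h2 h1]; rw [det_submatrix_two]
  have e3 : (A.submatrix ![2, 3] ![1, 2]).det = κ' * (A' 0 2 * A' 2 1 - A' 0 1 * A' 2 2) := by
    rw [det_submatrix_two, h.apply_3 1 h1, h.apply_3 2 h2, h.apply_mn 2 1 h2 h1, h.apply_mn 2 2 h2 h2]
    ring
  rw [e1, e2, e3, hΨ1, hΨ, hΨ3, psi_eq, ← h.mul]
  funext i
  simp only [Pi.add_apply, Pi.sub_apply, Pi.smul_apply, smul_eq_mul]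
  ring

end IsReflected

end

end VNLS

/-! ### Extension of the scattering data to the upper half plane -/

namespace VNLS

noncomputable section

attribute [local instance] Matrix.linftyOpNormedRing Matrix.linftyOpNormedAlgebra

/-- The transposition of the two middle indices `1` and `2`. -/
def oth : Fin 4 → Fin 4 := ![0, 2, 1, 3]

theorem oth_cases {m : Fin 4} (hm : m = 1 ∨ m = 2) : oth m = 1 ∧ m = 2 ∨ oth m = 2 ∧ m = 1 := by
  rcases hm with rfl | rfl
  · exact Or.inr ⟨rfl, rfl⟩
  · exact Or.inl ⟨rfl, rfl⟩

theorem oth_cases' {m : Fin 4} (hm : m = 1 ∨ m = 2) : m = 1 ∧ oth m = 2 ∨ m = 2 ∧ oth m = 1 := by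
  rcases hm with rfl | rfl
  · exact Or.inl ⟨rfl, rfl⟩
  · exact Or.inr ⟨rfl, rfl⟩

theorem oth_mem {m : Fin 4} (hm : m = 1 ∨ m = 2) : oth m = 1 ∨ oth m = 2 := by
  rcases hm with rfl | rfl
  · exact Or.inr rfl
  · exact Or.inl rfl

theorem oth_oth (m : Fin 4) : oth (oth m) = m := by fin_cases m <;> rfl

namespace Potential

variable {P : Potential}

theorem isScattering (hsol : P.IsSolution) (hbc : P.HasNZBC) {s : ℝ} (hs : (s : ℂ) ∈ P.regular) :
    IsScattering (P.γ s) (P.φp 0 0 s) (P.φm 0 0 s) (P.A s) := by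
  obtain ⟨-, h1, h2, -⟩ := φm_spec hsol hbc hs
  obtain ⟨-, h3, h4, -⟩ := φp_spec hsol hbc hs
  refine ⟨γ_ne_zero hs, ?_, h3, h1, h4, h2⟩
  rw [A, ← mul_assoc, Matrix.mul_nonsing_inv _ (by rw [h4]; exact (γ_ne_zero hs).isUnit), one_mul]

theorem ne_zero_of_norm {q : ℂ} (hq : 0 < P.q0) (h : ‖q‖ = P.q0) : q ≠ 0 :=
  norm_pos_iff.1 (by rw [h]; exact hq)

/-- The scattering matrices at `s` and `q_o² / s`, related through the symmetry of the
eigenfunctions. -/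
theorem isReflected (hsol : P.IsSolution) (hbc : P.HasNZBC) {s : ℝ} (hs : (s : ℂ) ∈ P.regular) :
    IsReflected (P.qp / P.qm) (Complex.I * P.qm * s / (P.q0 : ℂ) ^ 2)⁻¹
      (Complex.I * P.qp * s / (P.q0 : ℂ) ^ 2) (P.A s) (P.A (P.q0 ^ 2 / s)) := by
  have hq' : (P.q0 : ℂ) ≠ 0 := Complex.ofReal_ne_zero.2 hbc.q0_pos.ne'
  have hs0 : (s : ℂ) ≠ 0 := hs.1
  have hm := ne_zero_of_norm hbc.q0_pos hbc.norm_qm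
  have hI := Complex.I_ne_zero
  have hs' : ((P.q0 ^ 2 / s : ℝ) : ℂ) ∈ P.regular := by
    have e : ((P.q0 ^ 2 / s : ℝ) : ℂ) = (P.q0 : ℂ) ^ 2 / s := by push_cast; ring
    rw [e]; exact mem_regular_div hbc.q0_pos hs
  have h1 := isScattering hsol hbc hs
  have h2 := (isScattering hsol hbc hs').eq
  rw [φm_hat hsol hbc hs, φp_hat hsol hbc hs, h1.eq, mul_assoc, mul_assoc] at h2
  have h3 : P.A s * P.hatSwap P.qm s = P.hatSwap P.qp s * P.A (P.q0 ^ 2 / s) := by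
    have hu : IsUnit (P.φp 0 0 s).det := by rw [h1.det_left]; exact h1.ne.isUnit
    have := congrArg (fun M => (P.φp 0 0 s)⁻¹ * M) h2
    simpa only [← mul_assoc, Matrix.nonsing_inv_mul _ hu, one_mul] using this
  have h4 := fun i j => congrFun (congrFun h3 i) j
  simp only [Matrix.mul_apply, Fin.sum_univ_four] at h4
  have hκ : Complex.I * P.qm * s / (P.q0 : ℂ) ^ 2 ≠ 0 := by positivity
  refine ⟨?_, ?_, ?_, ?_, ?_⟩
  · field_simp
  · have := h4 3 0
    simp [hatSwap] at this
    field_simp at this ⊢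
    exact this
  · rintro m (rfl | rfl)
    · have := h4 3 1
      simpa [hatSwap] using this
    · have := h4 3 2
      simpa [hatSwap] using this
  · intro m hm
    rw [eq_inv_mul_iff_mul_eq₀ hκ, mul_comm]
    rcases hm with rfl | rfl
    · have := h4 1 0
      simpa [hatSwap] using this
    · have := h4 2 0
      simpa [hatSwap] using this
  · rintro m n (rfl | rfl) (rfl | rfl)
    · have := h4 1 1
      simpa [hatSwap] using this
    · have := h4 1 2
      simpa [hatSwap] using this
    · have := h4 2 1
      simpa [hatSwap] using this
    · have := h4 2 2
      simpa [hatSwap] using this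

theorem φm_col_three (hsol : P.IsSolution) (hbc : P.HasNZBC) {s : ℝ} (hs : (s : ℂ) ∈ P.regular) :
    (P.φm 0 0 s).col 3 = (Complex.I * P.qm * s / (P.q0 : ℂ) ^ 2)⁻¹ •
      (P.φm 0 0 (P.q0 ^ 2 / s)).col 0 := by
  have hq' : (P.q0 : ℂ) ≠ 0 := Complex.ofReal_ne_zero.2 hbc.q0_pos.ne'
  have hs0 : (s : ℂ) ≠ 0 := hs.1
  have hm := ne_zero_of_norm hbc.q0_pos hbc.norm_qm
  have hI := Complex.I_ne_zero
  have hκ : Complex.I * P.qm * s / (P.q0 : ℂ) ^ 2 ≠ 0 := by positivity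
  rw [eq_inv_smul_iff₀ hκ, φm_hat hsol hbc hs]
  funext i
  simp [Matrix.mul_apply, Fin.sum_univ_four, hatSwap, mul_comm]

theorem φm_col_mid (hsol : P.IsSolution) (hbc : P.HasNZBC) {s : ℝ} (hs : (s : ℂ) ∈ P.regular)
    {m : Fin 4} (hm : m = 1 ∨ m = 2) :
    (P.φm 0 0 s).col m = (P.φm 0 0 (P.q0 ^ 2 / s)).col m := by
  rw [φm_hat hsol hbc hs]
  funext i
  rcases hm with rfl | rfl <;> simp [Matrix.mul_apply, Fin.sum_univ_four, hatSwap]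

theorem φp_col_zero (hsol : P.IsSolution) (hbc : P.HasNZBC) {s : ℝ} (hs : (s : ℂ) ∈ P.regular) :
    (P.φp 0 0 s).col 0 = (Complex.I * P.qp / s) • (P.φp 0 0 (P.q0 ^ 2 / s)).col 3 := by
  have hq' : (P.q0 : ℂ) ≠ 0 := Complex.ofReal_ne_zero.2 hbc.q0_pos.ne'
  have hs0 : (s : ℂ) ≠ 0 := hs.1
  have h := star_mul_self_of_norm hbc.norm_qp
  rw [Complex.star_def] at h
  rw [φp_hat hsol hbc hs]
  funext i
  simp [Matrix.mul_apply, Fin.sum_univ_four, hatSwap]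
  field_simp
  linear_combination (-1) * (P.φp 0 0 s i 0) * h + (P.φp 0 0 s i 0) * P.qp *
    (starRingEnd ℂ) P.qp * Complex.I_sq

/-- The scattering data, extended to the upper half plane, together with the identities between
them. At the base point `(0,0)`, `a` and `b` are the extensions of `φ_{-,1}` and `φ_{+,4}`, and
`χ m`, `ψ m` those of the vectors `chi` and `psi`; the scalars `p1`, `p3` and `p n m` extend
`A_{[1]}`, `A_{[1,2,3]}` and the minors `pmin`. The fields with names ending in `real` give the
boundary values. Only the values `1` and `2` of the indices `n`, `m` are meaningful; `oth`
interchanges them. -/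
structure UpperData (P : Potential) where
  a : ℂ → Fin 4 → ℂ
  b : ℂ → Fin 4 → ℂ
  χ : Fin 4 → ℂ → Fin 4 → ℂ
  ψ : Fin 4 → ℂ → Fin 4 → ℂ
  p1 : ℂ → ℂ
  p3 : ℂ → ℂ
  p : Fin 4 → Fin 4 → ℂ → ℂ
  hol_a : P.HolUp a
  hol_b : P.HolUp b
  hol_χ : ∀ m, m = 1 ∨ m = 2 → P.HolUp (χ m)
  hol_ψ : ∀ m, m = 1 ∨ m = 2 → P.HolUp (ψ m)
  hol_p1 : P.HolUp p1
  hol_p3 : P.HolUp p3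
  hol_p : ∀ n m, n = 1 ∨ n = 2 → m = 1 ∨ m = 2 → P.HolUp (p n m)
  a_real : ∀ s : ℝ, (s : ℂ) ∈ P.regular → a s = (P.φm 0 0 s).col 0
  b_real : ∀ s : ℝ, (s : ℂ) ∈ P.regular → b s = (P.φp 0 0 s).col 3
  χ_real : ∀ m, m = 1 ∨ m = 2 → ∀ s : ℝ, (s : ℂ) ∈ P.regular →
    χ m s = chi (P.A s) (P.φm 0 0 s) m
  ψ_real : ∀ m, m = 1 ∨ m = 2 → ∀ s : ℝ, (s : ℂ) ∈ P.regular →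
    ψ m s = psi (P.A s) (P.φm 0 0 s) (oth m) m
  p1_real : ∀ s : ℝ, (s : ℂ) ∈ P.regular → p1 s = P.A s 0 0
  p3_real : ∀ s : ℝ, (s : ℂ) ∈ P.regular → p3 s = pthree (P.A s)
  p_real : ∀ n m, n = 1 ∨ n = 2 → m = 1 ∨ m = 2 → ∀ s : ℝ, (s : ℂ) ∈ P.regular →
    p n m s = pmin (P.A s) n m
  a_ne : ∀ z ∈ upper, a z ≠ 0
  b_ne : ∀ z ∈ upper, b z ≠ 0
  wedge_χ : ∀ m, m = 1 ∨ m = 2 → ∀ z ∈ upper, wedge (a z) (χ m z) = 0 ↔ p1 z = 0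
  wedge_ψ : ∀ m, m = 1 ∨ m = 2 → ∀ z ∈ upper, wedge (ψ m z) (b z) = 0 ↔ p3 z = 0
  p3_hat : ∀ z ∈ upper, p3 z = star (P.qp / P.qm) * star (p1 (P.hat z))
  p_hat : ∀ m, m = 1 ∨ m = 2 → ∀ z ∈ upper,
    p m m z = star (P.qp / P.qm) * star (p (oth m) (oth m) (P.hat z))
  p_mul_p : ∀ m, m = 1 ∨ m = 2 → ∀ z ∈ upper,
    p m m z * p (oth m) (oth m) z - p m (oth m) z * p (oth m) m z = p1 z * p3 z
  smul_ψ : ∀ m, m = 1 ∨ m = 2 → ∀ z ∈ upper,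
    p1 z • ψ m z = p (oth m) (oth m) z • χ m z - p (oth m) m z • χ (oth m) z
  smul_χ : ∀ m, m = 1 ∨ m = 2 → ∀ z ∈ upper,
    p3 z • χ m z = p m m z • ψ m z + p (oth m) m z • ψ (oth m) z

theorem holUp_inv_γ : P.HolUp fun z => (P.γ z)⁻¹ :=
  HolUp.of_differentiableOn ((differentiableOn_γ.mono fun _ hz => hz.1).fun_inv fun _ hz =>
    γ_ne_zero hz)

theorem holUp_const_div (c : ℂ) : P.HolUp fun z => c / z :=
  HolUp.of_differentiableOn fun z hz => by
    have hz0 : z ≠ 0 := hz.1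
    have : DifferentiableAt ℂ (fun w : ℂ => c / w) z := by fun_prop (disch := assumption)
    exact this.differentiableWithinAt

theorem HolUp.wedge {u v : ℂ → Fin 4 → ℂ} (hu : P.HolUp u) (hv : P.HolUp v) :
    P.HolUp fun z => wedge (u z) (v z) :=
  HolUp.pi fun i => HolUp.pi fun l =>
    ((hu.apply i).mul (hv.apply l)).sub ((hu.apply l).mul (hv.apply i))

theorem HolUp.pairing {F G : ℂ → Fin 4 → Fin 4 → ℂ} (hF : P.HolUp F) (hG : P.HolUp G) :
    P.HolUp fun z => pairing (F z) (G z) := by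
  have f := fun i j => (hF.apply i).apply j
  have g := fun i j => (hG.apply i).apply j
  exact (((((f 0 1).mul (g 2 3)).sub ((f 0 2).mul (g 1 3))).add ((f 0 3).mul (g 1 2))).add
    ((f 1 2).mul (g 0 3))).sub ((f 1 3).mul (g 0 2)) |>.add ((f 2 3).mul (g 0 1))

set_option maxHeartbeats 1000000 in
/-- All data are built from the four kinds of nonvanishing limits and their reflections by explicit
formulas that hold on the real line; the identities extend from there by uniqueness. -/
theorem exists_upperData (hsol : P.IsSolution) (hbc : P.HasNZBC) : Nonempty (UpperData P) := by
  have hq := hbc.q0_pos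
  have hq' : (P.q0 : ℂ) ≠ 0 := Complex.ofReal_ne_zero.2 hq.ne'
  obtain ⟨a, ha, har, ha0⟩ := exists_col_left hsol hbc
  obtain ⟨b, hb, hbr, hb0⟩ := exists_col_right hsol hbc
  have hF' : ∀ m : Fin 4, ∃ F : ℂ → Fin 4 → Fin 4 → ℂ, m = 1 ∨ m = 2 → P.HolUp F ∧
      (∀ s : ℝ, (s : ℂ) ∈ P.regular → F s = wedge ((P.φm 0 0 s).col 0) ((P.φm 0 0 s).col m)) ∧
      ∀ z ∈ P.closedUpper, F z ≠ 0 := fun m => by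
    by_cases hm : m = 1 ∨ m = 2
    · obtain ⟨F, hF⟩ := exists_wedge_left hsol hbc hm
      exact ⟨F, fun _ => hF⟩
    · exact ⟨0, fun h => absurd h hm⟩
  have hG' : ∀ m : Fin 4, ∃ F : ℂ → Fin 4 → Fin 4 → ℂ, m = 1 ∨ m = 2 → P.HolUp F ∧
      (∀ s : ℝ, (s : ℂ) ∈ P.regular → F s = wedge ((P.φp 0 0 s).col m) ((P.φp 0 0 s).col 3)) ∧
      ∀ z ∈ P.closedUpper, F z ≠ 0 := fun m => by
    by_cases hm : m = 1 ∨ m = 2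
    · obtain ⟨F, hF⟩ := exists_wedge_right hsol hbc hm
      exact ⟨F, fun _ => hF⟩
    · exact ⟨0, fun h => absurd h hm⟩
  choose F hF using hF'
  choose G hG using hG'
  have hS := fun (s : ℝ) (hs : (s : ℂ) ∈ P.regular) => isScattering hsol hbc hs
  have hR := fun (s : ℝ) (hs : (s : ℂ) ∈ P.regular) => isReflected hsol hbc hs
  have hs' : ∀ s : ℝ, (s : ℂ) ∈ P.regular → ((P.q0 ^ 2 / s : ℝ) : ℂ) ∈ P.regular := by
    intro s hs
    rw [← hat_ofReal]; exact hat_mem_regular hq hs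
  -- extensions of the complex conjugates of the first column of `φ_+` and the last one of `φ_-`,
  -- by reflection of `b` and `a`
  set α : ℂ → Fin 4 → ℂ := fun z i => -(Complex.I * star P.qp) / z * star (b (P.hat z) i) with hα
  set β : ℂ → Fin 4 → ℂ := fun z i => (Complex.I * P.qm) / z * star (a (P.hat z) i) with hβ
  have hαh : ∀ i, P.HolUp fun z => α z i := fun i =>
    (holUp_const_div _).mul ((hb.apply i).star_hat hq)
  have hβh : ∀ i, P.HolUp fun z => β z i := fun i =>
    (holUp_const_div _).mul ((ha.apply i).star_hat hq)
  have hαr : ∀ s : ℝ, (s : ℂ) ∈ P.regular → ∀ i, α s i = star (P.φp 0 0 s i 0) := by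
    intro s hs i
    have h1 := congrFun (φp_col_zero hsol hbc hs) i
    simp only [Matrix.col_apply, Pi.smul_apply] at h1
    simp only [hα, hat_ofReal]
    rw [hbr _ (hs' s hs), h1]
    simp
  have hβr : ∀ s : ℝ, (s : ℂ) ∈ P.regular → ∀ i, β s i = star (P.φm 0 0 s i 3) := by
    intro s hs i
    have h1 := congrFun (φm_col_three hsol hbc hs) i
    simp only [Matrix.col_apply, Pi.smul_apply] at h1
    simp only [hβ, hat_ofReal]
    rw [har _ (hs' s hs), h1]
    have hs0 : (s : ℂ) ≠ 0 := hs.1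
    have hm := ne_zero_of_norm hbc.q0_pos hbc.norm_qm
    have hm' : (starRingEnd ℂ) P.qm ≠ 0 := by simpa using hm
    have h := star_mul_self_of_norm hbc.norm_qm
    rw [Complex.star_def] at h
    have e : (starRingEnd ℂ) (Complex.I * P.qm * s / (P.q0 : ℂ) ^ 2)⁻¹ = Complex.I * P.qm / s := by
      simp
      field_simp
      rw [← h]
      linear_combination ((starRingEnd ℂ) P.qm * P.qm) * (-Complex.I_sq)
    simp only [Complex.star_def, smul_eq_mul, map_mul, e, Matrix.col_apply]
  -- the right-hand sides of the formulas that hold on the real line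
  set p1 : ℂ → ℂ := fun z => (P.γ z)⁻¹ * ∑ i, α z i * J i i * a z i with hp1
  set χ : Fin 4 → ℂ → Fin 4 → ℂ := fun m z j =>
    (P.γ z)⁻¹ * ∑ i, α z i * J i i * F m z i j with hχ
  set ψ : Fin 4 → ℂ → Fin 4 → ℂ := fun m z j =>
    (P.γ z)⁻¹ * ∑ i, β z i * J i i * G m z i j with hψ
  set p : Fin 4 → Fin 4 → ℂ → ℂ := fun n m z =>
    (if n = 1 then 1 else -1) * ((P.γ z)⁻¹ * pairing (F m z) (G (oth n) z)) with hp
  set p3 : ℂ → ℂ := fun z => star (P.qp / P.qm) * star (p1 (P.hat z)) with hp3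
  have h1h : P.HolUp p1 := holUp_inv_γ.mul (HolUp.sum fun i _ =>
    ((hαh i).mul (HolUp.const _)).mul (ha.apply i))
  have h3h : P.HolUp p3 := (HolUp.const _).mul (h1h.star_hat hq)
  have hχh : ∀ m, m = 1 ∨ m = 2 → P.HolUp (χ m) := fun m hm => HolUp.pi fun j =>
    holUp_inv_γ.mul (HolUp.sum fun i _ => ((hαh i).mul (HolUp.const _)).mul
      (((hF m hm).1.apply i).apply j))
  have hψh : ∀ m, m = 1 ∨ m = 2 → P.HolUp (ψ m) := fun m hm => HolUp.pi fun j =>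
    holUp_inv_γ.mul (HolUp.sum fun i _ => ((hβh i).mul (HolUp.const _)).mul
      (((hG m hm).1.apply i).apply j))
  have hph : ∀ n m, n = 1 ∨ n = 2 → m = 1 ∨ m = 2 → P.HolUp (p n m) := fun n m hn hm =>
    (HolUp.const _).mul (holUp_inv_γ.mul ((hF m hm).1.pairing (hG (oth n) (oth_mem hn)).1))
  have h1r : ∀ s : ℝ, (s : ℂ) ∈ P.regular → p1 s = P.A s 0 0 := fun s hs => by
    rw [(hS s hs).apply_zero_zero]
    simp only [hp1, hαr s hs, har s hs, Matrix.col_apply]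
  have h3r : ∀ s : ℝ, (s : ℂ) ∈ P.regular → p3 s = pthree (P.A s) := fun s hs => by
    rw [(hS s hs).pthree_eq_star, (hR s hs).apply_33, star_mul']
    simp only [hp3]
    rw [hat_ofReal, h1r _ (hs' s hs)]
  have hχr : ∀ m, m = 1 ∨ m = 2 → ∀ s : ℝ, (s : ℂ) ∈ P.regular →
      χ m s = chi (P.A s) (P.φm 0 0 s) m := fun m hm s hs => by
    funext j
    rw [(hS s hs).chi_eq]
    simp only [hχ, hαr s hs, (hF m hm).2.1 s hs]
  have hψr : ∀ m, m = 1 ∨ m = 2 → ∀ s : ℝ, (s : ℂ) ∈ P.regular →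
      ψ m s = psi (P.A s) (P.φm 0 0 s) (oth m) m := fun m hm s hs => by
    funext j
    rw [(hS s hs).psi_eq_sum (oth_cases hm)]
    simp only [hψ, hβr s hs, (hG m hm).2.1 s hs]
  have hpr : ∀ n m, n = 1 ∨ n = 2 → m = 1 ∨ m = 2 → ∀ s : ℝ, (s : ℂ) ∈ P.regular →
      p n m s = pmin (P.A s) n m := fun n m hn hm s hs => by
    rw [(hS s hs).pmin_eq_pairing (oth_cases' hn)]
    simp only [hp, (hF m hm).2.1 s hs, (hG _ (oth_mem hn)).2.1 s hs]
  have hp3' : ∀ z, p3 z = star (P.qp / P.qm) * star (p1 (P.hat z)) := fun z => rfl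
  clear_value α β p3 p1 χ ψ p
  refine ⟨⟨a, b, χ, ψ, p1, p3, p, ha, hb, hχh, hψh, h1h, h3h, hph, har, hbr, hχr, hψr, h1r, h3r, hpr,
    fun z hz => ha0 z (upper_subset_closedUpper hz),
    fun z hz => hb0 z (upper_subset_closedUpper hz), fun m hm z hz => ?_, fun m hm z hz => ?_,
    fun z hz => hp3' z, fun m hm z hz => ?_, fun m hm z hz => ?_, fun m hm z hz => ?_,
    fun m hm z hz => ?_⟩⟩
  · have h := (ha.wedge (hχh m hm)).eqOn hq (h1h.smul (hF m hm).1) (fun s hs => by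
      rw [har s hs, hχr m hm s hs, h1r s hs, (hF m hm).2.1 s hs, wedge_col_chi]) hz
    simp only at h
    rw [h, smul_eq_zero]
    exact or_iff_left ((hF m hm).2.2 z (upper_subset_closedUpper hz))
  · have h := ((hψh m hm).wedge hb).eqOn hq (h3h.smul (hG m hm).1) (fun s hs => by
      rw [hbr s hs, hψr m hm s hs, h3r s hs, (hG m hm).2.1 s hs,
        (hS s hs).wedge_psi_col (oth_cases hm)]) hz
    simp only at h
    rw [h, smul_eq_zero]
    exact or_iff_left ((hG m hm).2.2 z (upper_subset_closedUpper hz))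
  · have hm' := oth_mem hm
    refine (hph m m hm hm).eqOn hq ((HolUp.const (star (P.qp / P.qm))).mul
      ((hph (oth m) (oth m) hm' hm').star_hat hq)) (fun s hs => ?_) hz
    rw [hat_ofReal, hpr _ _ hm hm s hs, hpr _ _ hm' hm' _ (hs' s hs), ← star_mul',
      ← (hR s hs).minor_mn hm' hm', (hS s hs).pmin_eq_star (oth_cases' hm)]
    congr 1
    ring
  · have hm' := oth_mem hm
    refine (((hph m m hm hm).mul (hph _ _ hm' hm')).sub ((hph _ _ hm hm').mul
      (hph _ _ hm' hm))).eqOn hq (h1h.mul h3h) (fun s hs => ?_) hz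
    rw [hpr _ _ hm hm s hs, hpr _ _ hm' hm' s hs, hpr _ _ hm hm' s hs, hpr _ _ hm' hm s hs,
      pmin_mul_sub_mul _ (oth_cases hm), h1r s hs, h3r s hs]
  · have hm' := oth_mem hm
    refine (h1h.smul (hψh m hm)).eqOn hq (((hph _ _ hm' hm').smul (hχh m hm)).sub
      ((hph _ _ hm' hm).smul (hχh _ hm'))) (fun s hs => ?_) hz
    rw [hpr _ _ hm' hm' s hs, hpr _ _ hm' hm s hs, h1r s hs, hψr m hm s hs, hχr m hm s hs,
      hχr _ hm' s hs, smul_psi]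
  · have hm' := oth_mem hm
    refine (h3h.smul (hχh m hm)).eqOn hq (((hph _ _ hm hm).smul (hψh m hm)).add
      ((hph _ _ hm' hm).smul (hψh _ hm'))) (fun s hs => ?_) hz
    rw [hpr _ _ hm hm s hs, hpr _ _ hm' hm s hs, h3r s hs, hψr m hm s hs, hχr m hm s hs,
      hψr _ hm' s hs, oth_oth, smul_chi _ _ (oth_cases hm)]

end Potential

end

end VNLS

/-! ### Identification of the analytic extensions -/

namespace VNLS

noncomputable section

attribute [local instance] Matrix.linftyOpNormedRing Matrix.linftyOpNormedAlgebra

namespace Potential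

variable {P : Potential}

theorem holUp_G_mulVec (hsol : P.IsSolution) (x t : ℝ) {v : ℂ → Fin 4 → ℂ} (hv : P.HolUp v) :
    P.HolUp fun z => (P.G x t (P.k z)).mulVec (v z) := by
  have h1 : ∀ i j, P.HolUp fun z => P.G x t (P.k z) i j := fun i j =>
    HolUp.of_differentiableOn fun z hz => DifferentiableAt.differentiableWithinAt
      (differentiableAt_matrix_iff.1
        ((hsol.differentiable_G x t (P.k z)).comp z (differentiableAt_k hz.1)) i j)
  refine HolUp.pi fun i => ?_
  simp only [Matrix.mulVec, dotProduct]
  exact HolUp.sum fun j _ => (h1 i j).mul (hv.apply j)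

theorem φm_col (hsol : P.IsSolution) (hbc : P.HasNZBC) {s : ℝ} (hs : (s : ℂ) ∈ P.regular)
    (x t : ℝ) (j : Fin 4) :
    (P.φm x t s).col j = (P.G x t (P.k s)).mulVec ((P.φm 0 0 s).col j) := by
  rw [(φm_spec hsol hbc hs).2.2.2 x t]; rfl

theorem φp_col (hsol : P.IsSolution) (hbc : P.HasNZBC) {s : ℝ} (hs : (s : ℂ) ∈ P.regular)
    (x t : ℝ) (j : Fin 4) :
    (P.φp x t s).col j = (P.G x t (P.k s)).mulVec ((P.φp 0 0 s).col j) := by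
  rw [(φp_spec hsol hbc hs).2.2.2 x t]; rfl

theorem minor_one (i j : Fin 4) (s : ℝ) : P.minor ![i] ![j] s = P.A s i j := by
  rw [minor, Matrix.det_fin_one]; rfl

theorem ofReal_hat (s : ℝ) : ((P.q0 ^ 2 / s : ℝ) : ℂ) = (P.q0 : ℂ) ^ 2 / s := by push_cast; ring

theorem ofReal_hat_mem (hq : 0 < P.q0) {s : ℝ} (hs : (s : ℂ) ∈ P.regular) :
    ((P.q0 ^ 2 / s : ℝ) : ℂ) ∈ P.regular := by
  rw [ofReal_hat]; exact mem_regular_div hq hs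

theorem k_ofReal_hat (hq : 0 < P.q0) {s : ℝ} (hs : (s : ℂ) ∈ P.regular) :
    P.k ((P.q0 ^ 2 / s : ℝ) : ℂ) = P.k s := by
  rw [ofReal_hat, k_hat hq hs.1]

namespace UpperData

variable (D : UpperData P)

theorem A1_eq (hbc : P.HasNZBC) : Set.EqOn P.A1 D.p1 upper :=
  (D.hol_p1.isAnalyticExtension fun s hs => by
    rw [minor_one, D.p1_real s hs]).analyticExt_upper hbc.q0_pos

theorem pmin_eq (hbc : P.HasNZBC) {n m : Fin 4} (hn : n = 1 ∨ n = 2) (hm : m = 1 ∨ m = 2) :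
    Set.EqOn (P.minorUp ![0, n] ![0, m]) (D.p n m) upper :=
  ((D.hol_p n m hn hm).isAnalyticExtension fun s hs => by
    rw [D.p_real n m hn hm s hs]; rfl).analyticExt_upper hbc.q0_pos

theorem A123_eq (hbc : P.HasNZBC) : Set.EqOn P.A123 D.p3 upper :=
  (D.hol_p3.isAnalyticExtension fun s hs => by
    rw [D.p3_real s hs]; rfl).analyticExt_upper hbc.q0_pos

theorem φm1_eq (hsol : P.IsSolution) (hbc : P.HasNZBC) (x t : ℝ) :
    Set.EqOn (P.φm1 x t) (fun z => (P.G x t (P.k z)).mulVec (D.a z)) upper :=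
  ((holUp_G_mulVec hsol x t D.hol_a).isAnalyticExtension fun s hs => by
    rw [D.a_real s hs, ← φm_col hsol hbc hs]).analyticExt_upper hbc.q0_pos

theorem φp4_eq (hsol : P.IsSolution) (hbc : P.HasNZBC) (x t : ℝ) :
    Set.EqOn (P.φp4 x t) (fun z => (P.G x t (P.k z)).mulVec (D.b z)) upper :=
  ((holUp_G_mulVec hsol x t D.hol_b).isAnalyticExtension fun s hs => by
    rw [D.b_real s hs, ← φp_col hsol hbc hs]).analyticExt_upper hbc.q0_pos

theorem χp2_eq (hsol : P.IsSolution) (hbc : P.HasNZBC) (x t : ℝ) :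
    Set.EqOn (P.χp2 x t) (fun z => (P.G x t (P.k z)).mulVec (D.χ 1 z)) upper :=
  ((holUp_G_mulVec hsol x t (D.hol_χ 1 (Or.inl rfl))).isAnalyticExtension fun s hs => by
    rw [D.χ_real 1 (Or.inl rfl) s hs, chi, Matrix.mulVec_sub, Matrix.mulVec_smul,
      Matrix.mulVec_smul, ← φm_col hsol hbc hs, ← φm_col hsol hbc hs, minor_one,
      minor_one]).analyticExt_upper hbc.q0_pos

theorem χp3_eq (hsol : P.IsSolution) (hbc : P.HasNZBC) (x t : ℝ) :
    Set.EqOn (P.χp3 x t) (fun z => (P.G x t (P.k z)).mulVec (D.ψ 2 z)) upper :=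
  ((holUp_G_mulVec hsol x t (D.hol_ψ 2 (Or.inr rfl))).isAnalyticExtension fun s hs => by
    rw [D.ψ_real 2 (Or.inr rfl) s hs, show oth 2 = 1 from rfl, psi, Matrix.mulVec_add,
      Matrix.mulVec_sub, Matrix.mulVec_smul, Matrix.mulVec_smul, Matrix.mulVec_smul,
      ← φm_col hsol hbc hs, ← φm_col hsol hbc hs, ← φm_col hsol hbc hs]
    rfl).analyticExt_upper hbc.q0_pos

theorem A4_eq (hsol : P.IsSolution) (hbc : P.HasNZBC) :
    Set.EqOn P.A4 (fun z => P.qp / P.qm * D.p1 ((P.q0 : ℂ) ^ 2 / z)) lower :=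
  (((HolUp.const (P.qp / P.qm)).mul D.hol_p1).isAnalyticExtension_lower hbc.q0_pos fun s hs => by
    rw [minor_one, (isReflected hsol hbc hs).apply_33,
      D.p1_real _ (ofReal_hat_mem hbc.q0_pos hs)]).analyticExt_lower hbc.q0_pos

theorem A34_eq (hsol : P.IsSolution) (hbc : P.HasNZBC) :
    Set.EqOn P.A34 (fun z => P.qp / P.qm * D.p 2 2 ((P.q0 : ℂ) ^ 2 / z)) lower :=
  (((HolUp.const (P.qp / P.qm)).mul (D.hol_p 2 2 (Or.inr rfl) (Or.inr rfl))
    ).isAnalyticExtension_lower hbc.q0_pos fun s hs => by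
    rw [minor, det_submatrix_two, D.p_real 2 2 (Or.inr rfl) (Or.inr rfl) _
      (ofReal_hat_mem hbc.q0_pos hs), ← (isReflected hsol hbc hs).minor_mn (Or.inr rfl)
      (Or.inr rfl)]).analyticExt_lower hbc.q0_pos

theorem A234_eq (hsol : P.IsSolution) (hbc : P.HasNZBC) :
    Set.EqOn P.A234 (fun z => P.qp / P.qm * D.p3 ((P.q0 : ℂ) ^ 2 / z)) lower :=
  (((HolUp.const (P.qp / P.qm)).mul D.hol_p3).isAnalyticExtension_lower hbc.q0_pos fun s hs => by
    rw [minor, (isReflected hsol hbc hs).minor_three,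
      D.p3_real _ (ofReal_hat_mem hbc.q0_pos hs)]).analyticExt_lower hbc.q0_pos

theorem φp1_eq (hsol : P.IsSolution) (hbc : P.HasNZBC) (x t : ℝ) :
    Set.EqOn (P.φp1 x t) (fun z => (Complex.I * P.qp / z) •
      (P.G x t (P.k z)).mulVec (D.b ((P.q0 : ℂ) ^ 2 / z))) lower := by
  have hq' : (P.q0 : ℂ) ≠ 0 := Complex.ofReal_ne_zero.2 hbc.q0_pos.ne'
  have h := (((HolUp.of_differentiableOn (P := P)
    (f := fun w : ℂ => Complex.I * P.qp * w / (P.q0 : ℂ) ^ 2)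
    (by fun_prop)).smul (holUp_G_mulVec hsol x t D.hol_b)).isAnalyticExtension_lower hbc.q0_pos
    (g := fun s => (P.φp x t s).col 0) fun s hs => by
      have hs0 : (s : ℂ) ≠ 0 := hs.1
      rw [k_ofReal_hat hbc.q0_pos hs, D.b_real _ (ofReal_hat_mem hbc.q0_pos hs),
        φp_col hsol hbc hs, φp_col_zero hsol hbc hs, Matrix.mulVec_smul, ofReal_hat]
      congr 1
      field_simp).analyticExt_lower hbc.q0_pos
  intro z hz
  have hz0 : z ≠ 0 := by rintro rfl; simp [lower] at hz
  refine (h hz).trans ?_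
  simp only
  rw [k_hat hbc.q0_pos hz0]
  congr 1
  field_simp

theorem φm4_eq (hsol : P.IsSolution) (hbc : P.HasNZBC) (x t : ℝ) :
    Set.EqOn (P.φm4 x t) (fun z => (Complex.I * P.qm * z / (P.q0 : ℂ) ^ 2)⁻¹ •
      (P.G x t (P.k z)).mulVec (D.a ((P.q0 : ℂ) ^ 2 / z))) lower := by
  have hq' : (P.q0 : ℂ) ≠ 0 := Complex.ofReal_ne_zero.2 hbc.q0_pos.ne'
  have hm := ne_zero_of_norm hbc.q0_pos hbc.norm_qm
  have hI := Complex.I_ne_zero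
  have h := (((HolUp.of_differentiableOn (P := P)
    (f := fun w : ℂ => w / (Complex.I * P.qm))
    (by fun_prop)).smul (holUp_G_mulVec hsol x t D.hol_a)).isAnalyticExtension_lower hbc.q0_pos
    (g := fun s => (P.φm x t s).col 3) fun s hs => by
      have hs0 : (s : ℂ) ≠ 0 := hs.1
      rw [k_ofReal_hat hbc.q0_pos hs, D.a_real _ (ofReal_hat_mem hbc.q0_pos hs),
        φm_col hsol hbc hs, φm_col_three hsol hbc hs, Matrix.mulVec_smul, ofReal_hat]
      congr 1
      field_simp).analyticExt_lower hbc.q0_pos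
  intro z hz
  have hz0 : z ≠ 0 := by rintro rfl; simp [lower] at hz
  refine (h hz).trans ?_
  simp only
  rw [k_hat hbc.q0_pos hz0]
  congr 1
  field_simp

theorem χm2_eq (hsol : P.IsSolution) (hbc : P.HasNZBC) (x t : ℝ) :
    Set.EqOn (P.χm2 x t) (fun z => (P.qp / P.qm) •
      (P.G x t (P.k z)).mulVec (D.ψ 1 ((P.q0 : ℂ) ^ 2 / z))) lower := by
  have h := (((HolUp.const (P.qp / P.qm)).smul (holUp_G_mulVec hsol x t
    (D.hol_ψ 1 (Or.inl rfl)))).isAnalyticExtension_lower hbc.q0_pos (g := fun s =>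
    P.minor ![2, 3] ![2, 3] s • (P.φm x t s).col 1
      - P.minor ![2, 3] ![1, 3] s • (P.φm x t s).col 2
      + P.minor ![2, 3] ![1, 2] s • (P.φm x t s).col 3) fun s hs => by
      rw [k_ofReal_hat hbc.q0_pos hs, D.ψ_real 1 (Or.inl rfl) _ (ofReal_hat_mem hbc.q0_pos hs),
        φm_col hsol hbc hs x t 1, φm_col hsol hbc hs x t 2, φm_col hsol hbc hs x t 3, ← Matrix.mulVec_smul,
        ← Matrix.mulVec_smul, ← Matrix.mulVec_smul, ← Matrix.mulVec_smul, ← Matrix.mulVec_sub,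
        ← Matrix.mulVec_add]
      congr 1
      exact ((isReflected hsol hbc hs).psi_lower (φm_col_mid hsol hbc hs (Or.inl rfl))
        (φm_col_mid hsol hbc hs (Or.inr rfl)) (φm_col_three hsol hbc hs)).symm
      ).analyticExt_lower hbc.q0_pos
  intro z hz
  have hz0 : z ≠ 0 := by rintro rfl; simp [lower] at hz
  refine (h hz).trans ?_
  simp only
  rw [k_hat hbc.q0_pos hz0]

theorem χm3_eq (hsol : P.IsSolution) (hbc : P.HasNZBC) (x t : ℝ) :
    Set.EqOn (P.χm3 x t) (fun z => (P.qp / P.qm) •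
      (P.G x t (P.k z)).mulVec (D.χ 2 ((P.q0 : ℂ) ^ 2 / z))) lower := by
  have h := (((HolUp.const (P.qp / P.qm)).smul (holUp_G_mulVec hsol x t
    (D.hol_χ 2 (Or.inr rfl)))).isAnalyticExtension_lower hbc.q0_pos (g := fun s =>
    P.minor ![3] ![3] s • (P.φm x t s).col 2 - P.minor ![3] ![2] s • (P.φm x t s).col 3)
    fun s hs => by
      rw [k_ofReal_hat hbc.q0_pos hs, D.χ_real 2 (Or.inr rfl) _ (ofReal_hat_mem hbc.q0_pos hs),
        φm_col hsol hbc hs x t 2, φm_col hsol hbc hs x t 3, ← Matrix.mulVec_smul,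
        ← Matrix.mulVec_smul, ← Matrix.mulVec_smul, ← Matrix.mulVec_sub, minor_one, minor_one]
      congr 1
      exact ((isReflected hsol hbc hs).chi_lower
        (φm_col_mid hsol hbc hs (Or.inr rfl)) (φm_col_three hsol hbc hs)).symm
      ).analyticExt_lower hbc.q0_pos
  intro z hz
  have hz0 : z ≠ 0 := by rintro rfl; simp [lower] at hz
  refine (h hz).trans ?_
  simp only
  rw [k_hat hbc.q0_pos hz0]

end UpperData

end Potential

end

end VNLS

/-! ### Principal parts at simple poles -/

namespace VNLS

noncomputable section

variable {V : Type} [NormedAddCommGroup V] [NormedSpace ℂ V] {z₀ : ℂ}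

theorem analyticAt_dslope {f : ℂ → V} (h : AnalyticAt ℂ f z₀) : AnalyticAt ℂ (dslope f z₀) z₀ := by
  obtain ⟨p, hp⟩ := h
  exact hp.has_fpower_series_dslope_fslope.analyticAt

/-- `f - v / (z - z₀)` has a removable singularity at `z₀`. The value `v = 0` is allowed. -/
def HasPrincipalPart (f : ℂ → V) (z₀ : ℂ) (v : V) : Prop :=
  ∃ g : ℂ → V, AnalyticAt ℂ g z₀ ∧ ∀ᶠ z in 𝓝[≠] z₀, f z = (z - z₀)⁻¹ • v + g z

theorem AnalyticAt.hasPrincipalPart {f : ℂ → V} (h : AnalyticAt ℂ f z₀) :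
    HasPrincipalPart f z₀ 0 :=
  ⟨f, h, Eventually.of_forall fun z => by simp⟩

theorem HasPrincipalPart.congr {f f' : ℂ → V} {v : V} (h : HasPrincipalPart f z₀ v)
    (hf : ∀ᶠ z in 𝓝[≠] z₀, f' z = f z) : HasPrincipalPart f' z₀ v := by
  obtain ⟨g, hg, hfg⟩ := h
  exact ⟨g, hg, by filter_upwards [hf, hfg] with z h1 h2; rw [h1, h2]⟩

theorem HasPrincipalPart.smul {e : ℂ → ℂ} {f : ℂ → V} {v : V} (h : HasPrincipalPart f z₀ v)
    (he : AnalyticAt ℂ e z₀) : HasPrincipalPart (fun z => e z • f z) z₀ (e z₀ • v) := by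
  obtain ⟨g, hg, hfg⟩ := h
  refine ⟨fun z => dslope e z₀ z • v + e z • g z,
    ((analyticAt_dslope he).smul analyticAt_const).add (he.smul hg), ?_⟩
  filter_upwards [hfg, self_mem_nhdsWithin] with z hz hne
  have hne' : z - z₀ ≠ 0 := sub_ne_zero.2 hne
  have h1 := sub_smul_dslope e z₀ z
  have h2 : e z = e z₀ + (z - z₀) * dslope e z₀ z := by
    rw [smul_eq_mul] at h1; rw [h1]; ring
  rw [hz, smul_add, smul_smul, smul_smul, ← add_assoc, ← add_smul]
  congr 2
  rw [h2]
  field_simp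

theorem hasPrincipalPart_inv_smul {r : ℂ → ℂ} {f : ℂ → V} (hr : AnalyticAt ℂ r z₀)
    (hf : AnalyticAt ℂ f z₀) (h0 : r z₀ = 0) (h1 : deriv r z₀ ≠ 0) :
    HasPrincipalPart (fun z => (r z)⁻¹ • f z) z₀ ((deriv r z₀)⁻¹ • f z₀) := by
  have hr1 := analyticAt_dslope hr
  have h2 : dslope r z₀ z₀ ≠ 0 := by rwa [dslope_same]
  have hid : HasPrincipalPart (fun z => (z - z₀)⁻¹ • f z₀) z₀ (f z₀) :=
    ⟨0, analyticAt_const, Eventually.of_forall fun z => by simp⟩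
  have hfp : HasPrincipalPart (fun z => (z - z₀)⁻¹ • f z) z₀ (f z₀) := by
    refine ⟨dslope f z₀, analyticAt_dslope hf, ?_⟩
    filter_upwards [self_mem_nhdsWithin] with z hne
    have hne' : z - z₀ ≠ 0 := sub_ne_zero.2 hne
    have h3 : f z = f z₀ + (z - z₀) • dslope f z₀ z := by rw [sub_smul_dslope]; abel
    rw [h3, smul_add, smul_smul, inv_mul_cancel₀ hne', one_smul]
  have h3 := hfp.smul (hr1.inv h2)
  simp only [Pi.inv_apply, dslope_same] at h3
  refine h3.congr ?_
  filter_upwards with z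
  have h4 := sub_smul_dslope r z₀ z
  rw [h0, sub_zero, smul_eq_mul] at h4
  rw [← h4, mul_inv, mul_comm, mul_smul]

theorem hasPrincipalPart_inv_smul_zero {r : ℂ → ℂ} {f : ℂ → V} (hr : AnalyticAt ℂ r z₀)
    (hf : AnalyticAt ℂ f z₀) (h0 : r z₀ ≠ 0) :
    HasPrincipalPart (fun z => (r z)⁻¹ • f z) z₀ 0 :=
  AnalyticAt.hasPrincipalPart ((hr.inv h0).smul hf)

/-- A quotient `f₁ / r₁` has a removable singularity if it agrees with a regular quotient
`f₂ / r₂`. -/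
theorem hasPrincipalPart_of_smul_eq {r₁ r₂ : ℂ → ℂ} {f₁ f₂ : ℂ → V} (hr₂ : AnalyticAt ℂ r₂ z₀)
    (hf₂ : AnalyticAt ℂ f₂ z₀) (h0 : r₂ z₀ ≠ 0) (h1 : ∀ᶠ z in 𝓝[≠] z₀, r₁ z ≠ 0)
    (h2 : ∀ᶠ z in 𝓝[≠] z₀, r₂ z • f₁ z = r₁ z • f₂ z) :
    HasPrincipalPart (fun z => (r₁ z)⁻¹ • f₁ z) z₀ 0 := by
  refine (hasPrincipalPart_inv_smul_zero hr₂ hf₂ h0).congr ?_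
  filter_upwards [h1, h2, (hr₂.continuousAt.eventually_ne h0).filter_mono nhdsWithin_le_nhds]
    with z e1 e2 e3
  rw [inv_smul_eq_iff₀ e1, smul_comm, ← e2, inv_smul_smul₀ e3]

/-- A matrix has a simple pole if exactly one of its columns has one. -/
theorem hasSimplePole_of_col {M : ℂ → Mat4} {C : Fin 4 → ℂ → Fin 4 → ℂ} {e : Fin 4 → ℂ → ℂ}
    (hM : ∀ᶠ z in 𝓝[≠] z₀, ∀ i j, M z i j = C j z i * e j z) (c : Fin 4) {v R : Fin 4 → ℂ}
    (he : ∀ j, AnalyticAt ℂ (e j) z₀) (hc : HasPrincipalPart (C c) z₀ v)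
    (hC : ∀ j, j ≠ c → HasPrincipalPart (C j) z₀ 0) (hv : v ≠ 0) (he0 : e c z₀ ≠ 0)
    (hR : R = e c z₀ • v) : HasSimplePole M z₀ (singleCol c R) := by
  have hR0 : R ≠ 0 := by rw [hR]; exact smul_ne_zero he0 hv
  refine ⟨fun h => hR0 (funext fun i => ?_), fun i j => ?_⟩
  · have := congrFun (congrFun h i) c
    simpa [singleCol] using this
  · have h : HasPrincipalPart (fun z => e j z • C j z) z₀ (if j = c then R else 0) := by
      split_ifs with hj
      · rw [hR, hj]; exact hc.smul (he c)
      · simpa using (hC j hj).smul (he j)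
    obtain ⟨g, hg, hgz⟩ := h
    refine ⟨fun z => g z i, analyticAt_pi_iff.1 hg i, ?_⟩
    filter_upwards [hM, hgz] with z h1 h2
    have h3 := congrFun h2 i
    rw [h1, mul_comm]
    simp only [Pi.smul_apply, smul_eq_mul, Pi.add_apply] at h3
    rw [h3, singleCol, Matrix.of_apply]
    split_ifs
    · rw [div_eq_inv_mul]
    · simp

theorem eventually_ne_zero_of_deriv_ne_zero {r : ℂ → ℂ} (hr : AnalyticAt ℂ r z₀)
    (h1 : deriv r z₀ ≠ 0) : ∀ᶠ z in 𝓝[≠] z₀, r z ≠ 0 :=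
  hr.differentiableAt.hasDerivAt.eventually_ne h1

end

end VNLS

/-! ### Zeros of the scattering data -/

namespace VNLS

noncomputable section

attribute [local instance] Matrix.linftyOpNormedRing Matrix.linftyOpNormedAlgebra

theorem exists_smul_of_wedge_eq_zero {u v : Fin 4 → ℂ} (hu : u ≠ 0) (h : wedge u v = 0) :
    ∃ c : ℂ, v = c • u := by
  obtain ⟨i, hi⟩ := Function.ne_iff.1 hu
  have hi : u i ≠ 0 := hi
  refine ⟨v i / u i, funext fun l => ?_⟩
  have := congrFun (congrFun h i) l
  simp only [wedge, Pi.zero_apply] at this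
  rw [Pi.smul_apply, smul_eq_mul]
  field_simp
  linear_combination this

theorem exists_smul_of_wedge_eq_zero' {u v : Fin 4 → ℂ} (hv : v ≠ 0) (h : wedge u v = 0) :
    ∃ c : ℂ, u = c • v := by
  refine exists_smul_of_wedge_eq_zero hv (funext fun i => funext fun l => ?_)
  have := congrFun (congrFun h l) i
  simp only [wedge, Pi.zero_apply] at this ⊢
  linear_combination this

theorem ne_zero_of_wedge_left {u v : Fin 4 → ℂ} (h : wedge u v ≠ 0) : u ≠ 0 := by
  rintro rfl
  exact h (funext fun i => funext fun l => by simp [wedge])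

theorem ne_zero_of_wedge_right {u v : Fin 4 → ℂ} (h : wedge u v ≠ 0) : v ≠ 0 := by
  rintro rfl
  exact h (funext fun i => funext fun l => by simp [wedge])

variable {V : Type} [NormedAddCommGroup V] [NormedSpace ℂ V]

theorem differentiableOn_analyticExt (U : Set ℂ) (q0 : ℝ) (g : ℝ → V) :
    DifferentiableOn ℂ (analyticExt U q0 g) U := by
  by_cases h : ∃ f, IsAnalyticExtension U q0 g f
  · exact (analyticExt_spec h.choose_spec).1
  · rw [analyticExt, dif_neg h]
    exact differentiableOn_const 0

theorem analyticAt_upperExt [CompleteSpace V] {q0 : ℝ} {g : ℝ → V} {z : ℂ} (hz : z ∈ upper) :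
    AnalyticAt ℂ (analyticExt upper q0 g) z :=
  (differentiableOn_analyticExt upper q0 g).analyticAt (isOpen_upper.mem_nhds hz)

theorem analyticAt_lowerExt [CompleteSpace V] {q0 : ℝ} {g : ℝ → V} {z : ℂ} (hz : z ∈ lower) :
    AnalyticAt ℂ (analyticExt lower q0 g) z :=
  (differentiableOn_analyticExt lower q0 g).analyticAt (isOpen_lower.mem_nhds hz)

namespace Potential

variable {P : Potential}

theorem HolUp.analyticAt [CompleteSpace V] {f : ℂ → V} (h : P.HolUp f) {z : ℂ} (hz : z ∈ upper) :
    AnalyticAt ℂ f z := h.2.analyticAt (isOpen_upper.mem_nhds hz)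

theorem hasDerivAt_inversion {z : ℂ} (hz : z ≠ 0) :
    HasDerivAt (fun w : ℂ => (P.q0 : ℂ) ^ 2 / w) (-(P.q0 : ℂ) ^ 2 / z ^ 2) z := by
  have := (hasDerivAt_inv hz).const_mul ((P.q0 : ℂ) ^ 2)
  refine (this.congr_deriv (by ring)).congr_of_eventuallyEq (Eventually.of_forall fun w => ?_)
  rfl

/-- Simple zeros are reflected to simple zeros by `f ↦ conj ∘ f ∘ hat`. -/
theorem deriv_star_hat_ne_zero (hq : 0 < P.q0) {f g : ℂ → ℂ} {c z : ℂ} (hz : z ∈ upper)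
    (hc : c ≠ 0) (h : ∀ w ∈ upper, f w = c * star (g (P.hat w))) (hg : DifferentiableAt ℂ g z)
    (hg' : deriv g z ≠ 0) : deriv f (P.hat z) ≠ 0 := by
  have hq' : (P.q0 : ℂ) ≠ 0 := Complex.ofReal_ne_zero.2 hq.ne'
  have hz0 : z ≠ 0 := (upper_subset_regular (P := P) hz).1
  have hh : P.hat z ∈ upper := hat_mem_upper hq hz
  have hh0 : P.hat z ≠ 0 := (upper_subset_regular (P := P) hh).1
  have e : ∀ w, (P.q0 : ℂ) ^ 2 / w = star (P.hat w) := fun w => by simp [hat]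
  have h1 := hg.hasDerivAt.conj_conj
  have e1 : (starRingEnd ℂ) z = (P.q0 : ℂ) ^ 2 / P.hat z := by
    rw [e, hat_hat hq hz0]; rfl
  rw [e1] at h1
  have h2 := ((h1.comp (P.hat z) (hasDerivAt_inversion hh0)).const_mul c).congr_of_eventuallyEq
    (f₁ := f) (by
      filter_upwards [isOpen_upper.mem_nhds hh] with w hw
      rw [h w hw]
      simp [e])
  rw [h2.deriv]
  have : (starRingEnd ℂ) (deriv g z) ≠ 0 := by simpa using hg'
  exact mul_ne_zero hc (mul_ne_zero this
    (div_ne_zero (neg_ne_zero.2 (pow_ne_zero 2 hq')) (pow_ne_zero 2 hh0)))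

/-- Simple zeros are pulled back to simple zeros by `z ↦ q_o² / z`. -/
theorem deriv_inversion_ne_zero (hq : 0 < P.q0) {f g : ℂ → ℂ} {c z : ℂ} (hz : z ∈ lower)
    (hc : c ≠ 0) (h : Set.EqOn f (fun w => c * g ((P.q0 : ℂ) ^ 2 / w)) lower)
    (hg : DifferentiableAt ℂ g ((P.q0 : ℂ) ^ 2 / z)) (hg' : deriv g ((P.q0 : ℂ) ^ 2 / z) ≠ 0) :
    deriv f z ≠ 0 := by
  have hq' : (P.q0 : ℂ) ≠ 0 := Complex.ofReal_ne_zero.2 hq.ne'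
  have hz0 : z ≠ 0 := by rintro rfl; simp [lower] at hz
  have h2 := ((hg.hasDerivAt.comp z (hasDerivAt_inversion hz0)).const_mul c).congr_of_eventuallyEq
    (f₁ := f) (by
      filter_upwards [isOpen_lower.mem_nhds hz] with w hw
      rw [h hw]; rfl)
  rw [h2.deriv]
  exact mul_ne_zero hc (mul_ne_zero hg'
    (div_ne_zero (neg_ne_zero.2 (pow_ne_zero 2 hq')) (pow_ne_zero 2 hz0)))

/-- Removable singularities are pulled back to removable singularities by `z ↦ q_o² / z`. -/
theorem HasPrincipalPart.inversion_zero (hq : 0 < P.q0) {f : ℂ → V} {z : ℂ} (hz : z ≠ 0)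
    (h : HasPrincipalPart f ((P.q0 : ℂ) ^ 2 / z) 0) :
    HasPrincipalPart (fun w => f ((P.q0 : ℂ) ^ 2 / w)) z 0 := by
  have hq' : (P.q0 : ℂ) ≠ 0 := Complex.ofReal_ne_zero.2 hq.ne'
  obtain ⟨g, hg, hfg⟩ := h
  have hi : AnalyticAt ℂ (fun w : ℂ => (P.q0 : ℂ) ^ 2 / w) z :=
    analyticAt_const.div analyticAt_id hz
  have hT : Tendsto (fun w : ℂ => (P.q0 : ℂ) ^ 2 / w) (𝓝[≠] z) (𝓝[≠] ((P.q0 : ℂ) ^ 2 / z)) := by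
    refine tendsto_nhdsWithin_iff.2
      ⟨hi.continuousAt.tendsto.mono_left nhdsWithin_le_nhds, ?_⟩
    filter_upwards [self_mem_nhdsWithin] with w hw he
    simp only [Set.mem_singleton_iff, div_eq_mul_inv] at he
    exact hw (inv_injective (mul_left_cancel₀ (pow_ne_zero 2 hq') he))
  refine ⟨fun w => g ((P.q0 : ℂ) ^ 2 / w), hg.fun_comp hi, ?_⟩
  filter_upwards [hT.eventually hfg] with w hw
  rw [hw, smul_zero, smul_zero]

namespace UpperData

/-- `z` is a simple zero of `p1` and not a zero of `p3`, and the non-principal minors vanish; `m` is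
the index for which the minor with rows and columns `0, m` does not vanish at `z`. -/
structure IsSimpleZero (D : UpperData P) (m : Fin 4) (z : ℂ) : Prop where
  mem : z ∈ upper
  off : ∀ w ∈ upper, D.p 1 2 w = 0 ∧ D.p 2 1 w = 0
  index : m = 1 ∨ m = 2
  p1_eq : D.p1 z = 0
  deriv_p1 : deriv D.p1 z ≠ 0
  p_ne : D.p m m z ≠ 0
  p3_ne : D.p3 z ≠ 0

theorem p_off (D : UpperData P) (hoff : ∀ w ∈ upper, D.p 1 2 w = 0 ∧ D.p 2 1 w = 0) {m : Fin 4}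
    (hm : m = 1 ∨ m = 2) {z : ℂ} (hz : z ∈ upper) : D.p (oth m) m z = 0 := by
  rcases hm with rfl | rfl
  · exact (hoff z hz).2
  · exact (hoff z hz).1

theorem p_mul (D : UpperData P) (hoff : ∀ w ∈ upper, D.p 1 2 w = 0 ∧ D.p 2 1 w = 0) {m : Fin 4}
    (hm : m = 1 ∨ m = 2) {z : ℂ} (hz : z ∈ upper) :
    D.p m m z * D.p (oth m) (oth m) z = D.p1 z * D.p3 z := by
  rw [← D.p_mul_p m hm z hz, D.p_off hoff hm hz, mul_zero, sub_zero]

theorem p1_smul_ψ (D : UpperData P) (hoff : ∀ w ∈ upper, D.p 1 2 w = 0 ∧ D.p 2 1 w = 0) {m : Fin 4}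
    (hm : m = 1 ∨ m = 2) {z : ℂ} (hz : z ∈ upper) :
    D.p1 z • D.ψ m z = D.p (oth m) (oth m) z • D.χ m z := by
  rw [D.smul_ψ m hm z hz, D.p_off hoff hm hz, zero_smul, sub_zero]

theorem p3_smul_χ (D : UpperData P) (hoff : ∀ w ∈ upper, D.p 1 2 w = 0 ∧ D.p 2 1 w = 0) {m : Fin 4}
    (hm : m = 1 ∨ m = 2) {z : ℂ} (hz : z ∈ upper) :
    D.p3 z • D.χ m z = D.p m m z • D.ψ m z := by
  rw [D.smul_χ m hm z hz, D.p_off hoff hm hz, zero_smul, add_zero]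

namespace IsSimpleZero

variable {D : UpperData P} {m : Fin 4} {z : ℂ}

theorem p_oth_eq (h : D.IsSimpleZero m z) : D.p (oth m) (oth m) z = 0 := by
  have h1 := D.p_mul h.off h.index h.mem
  rw [h.p1_eq, zero_mul] at h1
  exact (mul_eq_zero.1 h1).resolve_left h.p_ne

/-- The product `p m m * p m' m' = p1 * p3` has a simple zero at `z`, hence so has its second
factor. -/
theorem deriv_p_oth (h : D.IsSimpleZero m z) : deriv (D.p (oth m) (oth m)) z ≠ 0 := by
  have hm' := oth_mem h.index
  have d1 := ((D.hol_p1.analyticAt h.mem).differentiableAt).hasDerivAt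
  have d3 := ((D.hol_p3.analyticAt h.mem).differentiableAt).hasDerivAt
  have dp := (((D.hol_p m m h.index h.index).analyticAt h.mem).differentiableAt).hasDerivAt
  have dp' := (((D.hol_p _ _ hm' hm').analyticAt h.mem).differentiableAt).hasDerivAt
  have e1 := (d1.mul d3).congr_of_eventuallyEq (f₁ := fun w => D.p m m w * D.p (oth m) (oth m) w) (by
    filter_upwards [isOpen_upper.mem_nhds h.mem] with w hw
    exact D.p_mul h.off h.index hw)
  have e2 := (dp.fun_mul dp').unique e1
  rw [h.p_oth_eq, h.p1_eq, mul_zero, zero_mul, zero_add, add_zero] at e2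
  intro h0
  rw [h0, mul_zero] at e2
  exact mul_ne_zero h.deriv_p1 h.p3_ne e2.symm

theorem ψ_ne (h : D.IsSimpleZero m z) : D.ψ m z ≠ 0 :=
  ne_zero_of_wedge_left fun h0 => h.p3_ne ((D.wedge_ψ m h.index z h.mem).1 h0)

theorem χ_eq (h : D.IsSimpleZero m z) : D.χ m z = (D.p m m z / D.p3 z) • D.ψ m z := by
  rw [div_eq_inv_mul, mul_smul, ← D.p3_smul_χ h.off h.index h.mem, inv_smul_smul₀ h.p3_ne]

theorem χ_ne (h : D.IsSimpleZero m z) : D.χ m z ≠ 0 := by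
  rw [h.χ_eq]
  exact smul_ne_zero (div_ne_zero h.p_ne h.p3_ne) h.ψ_ne

theorem exists_a_eq_χ (h : D.IsSimpleZero m z) : ∃ c : ℂ, D.a z = c • D.χ m z :=
  exists_smul_of_wedge_eq_zero' h.χ_ne ((D.wedge_χ m h.index z h.mem).2 h.p1_eq)

theorem exists_a_eq_ψ (h : D.IsSimpleZero m z) : ∃ c : ℂ, D.a z = c • D.ψ m z := by
  obtain ⟨c, hc⟩ := h.exists_a_eq_χ
  exact ⟨c * (D.p m m z / D.p3 z), by rw [hc, h.χ_eq, smul_smul]⟩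

theorem hat_mem (hbc : P.HasNZBC) (h : D.IsSimpleZero m z) : P.hat z ∈ upper :=
  hat_mem_upper hbc.q0_pos h.mem

theorem hat_hat (hbc : P.HasNZBC) (h : D.IsSimpleZero m z) : P.hat (P.hat z) = z :=
  Potential.hat_hat hbc.q0_pos (upper_subset_regular (P := P) h.mem).1

theorem p1_hat_ne (h : D.IsSimpleZero m z) : D.p1 (P.hat z) ≠ 0 := by
  have h1 := h.p3_ne
  rw [D.p3_hat z h.mem] at h1
  exact star_ne_zero.1 (right_ne_zero_of_mul h1)

theorem p_oth_hat_ne (h : D.IsSimpleZero m z) : D.p (oth m) (oth m) (P.hat z) ≠ 0 := by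
  have h1 := h.p_ne
  rw [D.p_hat m h.index z h.mem] at h1
  exact star_ne_zero.1 (right_ne_zero_of_mul h1)

theorem p3_hat_eq (hbc : P.HasNZBC) (h : D.IsSimpleZero m z) : D.p3 (P.hat z) = 0 := by
  rw [D.p3_hat _ (h.hat_mem hbc), h.hat_hat hbc, h.p1_eq, star_zero, mul_zero]

theorem p_hat_eq (hbc : P.HasNZBC) (h : D.IsSimpleZero m z) : D.p m m (P.hat z) = 0 := by
  rw [D.p_hat m h.index _ (h.hat_mem hbc), h.hat_hat hbc, h.p_oth_eq, star_zero, mul_zero]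

theorem ρ_ne (hbc : P.HasNZBC) : star (P.qp / P.qm) ≠ 0 :=
  star_ne_zero.2 (div_ne_zero (ne_zero_of_norm hbc.q0_pos hbc.norm_qp)
    (ne_zero_of_norm hbc.q0_pos hbc.norm_qm))

theorem deriv_p3_hat (hbc : P.HasNZBC) (h : D.IsSimpleZero m z) : deriv D.p3 (P.hat z) ≠ 0 :=
  deriv_star_hat_ne_zero hbc.q0_pos h.mem (ρ_ne hbc) D.p3_hat
    (D.hol_p1.analyticAt h.mem).differentiableAt h.deriv_p1

theorem deriv_p_hat (hbc : P.HasNZBC) (h : D.IsSimpleZero m z) : deriv (D.p m m) (P.hat z) ≠ 0 :=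
  have hm' := oth_mem h.index
  deriv_star_hat_ne_zero hbc.q0_pos h.mem (ρ_ne hbc) (D.p_hat m h.index)
    ((D.hol_p _ _ hm' hm').analyticAt h.mem).differentiableAt h.deriv_p_oth

theorem χ_hat_ne (hbc : P.HasNZBC) (h : D.IsSimpleZero m z) : D.χ m (P.hat z) ≠ 0 :=
  ne_zero_of_wedge_right fun h0 =>
    h.p1_hat_ne ((D.wedge_χ m h.index _ (h.hat_mem hbc)).1 h0)

theorem ψ_hat_eq (hbc : P.HasNZBC) (h : D.IsSimpleZero m z) : D.ψ m (P.hat z) =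
    (D.p (oth m) (oth m) (P.hat z) / D.p1 (P.hat z)) • D.χ m (P.hat z) := by
  rw [div_eq_inv_mul, mul_smul, ← D.p1_smul_ψ h.off h.index (h.hat_mem hbc),
    inv_smul_smul₀ h.p1_hat_ne]

theorem ψ_hat_ne (hbc : P.HasNZBC) (h : D.IsSimpleZero m z) : D.ψ m (P.hat z) ≠ 0 := by
  rw [h.ψ_hat_eq hbc]
  exact smul_ne_zero (div_ne_zero h.p_oth_hat_ne h.p1_hat_ne) (h.χ_hat_ne hbc)

theorem exists_ψ_hat_eq (hbc : P.HasNZBC) (h : D.IsSimpleZero m z) : ∃ c : ℂ, D.ψ m (P.hat z) = c • D.b (P.hat z) :=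
  exists_smul_of_wedge_eq_zero' (D.b_ne _ (h.hat_mem hbc))
    ((D.wedge_ψ m h.index _ (h.hat_mem hbc)).2 (h.p3_hat_eq hbc))

theorem exists_χ_hat_eq (hbc : P.HasNZBC) (h : D.IsSimpleZero m z) :
    ∃ c : ℂ, D.χ m (P.hat z) = c • D.b (P.hat z) := by
  obtain ⟨c, hc⟩ := h.exists_ψ_hat_eq hbc
  have h1 := h.ψ_hat_eq hbc
  have h2 := div_ne_zero h.p_oth_hat_ne h.p1_hat_ne
  refine ⟨(D.p (oth m) (oth m) (P.hat z) / D.p1 (P.hat z))⁻¹ * c, ?_⟩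
  rw [mul_smul, ← hc, h1, inv_smul_smul₀ h2]

end IsSimpleZero

end UpperData

end Potential

end

end VNLS

/-! ### The columns of the meromorphic matrices -/

namespace VNLS

noncomputable section

attribute [local instance] Matrix.linftyOpNormedRing Matrix.linftyOpNormedAlgebra

/-- The residue at a simple zero `z₀` of the denominator `r` of the column `c = f / r`, expressed
through the value at `z₀` of another column `c'` proportional to `f`. -/
theorem hasSimplePole_of_proportional {M : ℂ → Mat4} {C : Fin 4 → ℂ → Fin 4 → ℂ}
    {e : Fin 4 → ℂ → ℂ} {z₀ : ℂ} (hM : ∀ᶠ z in 𝓝 z₀, ∀ i j, M z i j = C j z i * e j z)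
    (he : ∀ j, AnalyticAt ℂ (e j) z₀) (he0 : ∀ j, e j z₀ ≠ 0) (c c' : Fin 4) {r : ℂ → ℂ}
    {f : ℂ → Fin 4 → ℂ} (hc : C c = fun z => (r z)⁻¹ • f z) (hr : AnalyticAt ℂ r z₀)
    (hf : AnalyticAt ℂ f z₀) (h0 : r z₀ = 0) (h1 : deriv r z₀ ≠ 0)
    (hC : ∀ j, j ≠ c → HasPrincipalPart (C j) z₀ 0) (hf0 : f z₀ ≠ 0) {κ ε : ℂ}
    (hκ : f z₀ = κ • C c' z₀) (hε : e c z₀ = ε * e c' z₀) :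
    HasSimplePole M z₀ (singleCol c ((κ / deriv r z₀ * ε) • (M z₀).col c')) := by
  refine hasSimplePole_of_col (hM.filter_mono nhdsWithin_le_nhds) c he
    (v := (deriv r z₀)⁻¹ • f z₀) (by rw [hc]; exact hasPrincipalPart_inv_smul hr hf h0 h1) hC
    (smul_ne_zero (inv_ne_zero h1) hf0) (he0 c) ?_
  funext i
  have h2 := hM.self_of_nhds i c'
  rw [Pi.smul_apply, Matrix.col_apply, h2, hε, hκ]
  simp only [Pi.smul_apply, smul_eq_mul]
  ring

namespace Potential

variable {P : Potential}

/-- The columns of `M⁺ e^{iΘ}` when the non-principal minors vanish. -/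
def colP (P : Potential) (x t : ℝ) : Fin 4 → ℂ → Fin 4 → ℂ :=
  ![fun z => (P.A1 z)⁻¹ • P.φm1 x t z, fun z => (P.A12 z)⁻¹ • P.χp2 x t z,
    fun z => (P.A123 z)⁻¹ • P.χp3 x t z, P.φp4 x t]

/-- The columns of `M⁻ e^{iΘ}` when the non-principal minors vanish. -/
def colM (P : Potential) (x t : ℝ) : Fin 4 → ℂ → Fin 4 → ℂ :=
  ![P.φp1 x t, fun z => (P.A234 z)⁻¹ • P.χm2 x t z, fun z => (P.A34 z)⁻¹ • P.χm3 x t z,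
    fun z => (P.A4 z)⁻¹ • P.φm4 x t z]

/-- The diagonal entries of `e^{-iΘ}`. -/
def expθ (P : Potential) (x t : ℝ) (j : Fin 4) (z : ℂ) : ℂ :=
  Complex.exp (-Complex.I * P.Θ x t z j)

theorem Mp_apply {z : ℂ} (h : P.A13_12 z = 0) (x t : ℝ) (i j : Fin 4) :
    P.Mp x t z i j = P.colP x t j z i * P.expθ x t j z := by
  rw [Mp, expNegΘ, Matrix.mul_diagonal, h, zero_div, zero_smul, sub_zero]
  fin_cases j <;> rfl

theorem Mm_apply {z : ℂ} (h : P.A24_34 z = 0) (x t : ℝ) (i j : Fin 4) :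
    P.Mm x t z i j = P.colM x t j z i * P.expθ x t j z := by
  rw [Mm, expNegΘ, Matrix.mul_diagonal, h, zero_div, zero_smul, sub_zero]
  fin_cases j <;> rfl

theorem analyticAt_expθ (x t : ℝ) (j : Fin 4) {z : ℂ} (hz : z ≠ 0) :
    AnalyticAt ℂ (P.expθ x t j) z := by
  have h : DifferentiableOn ℂ (P.expθ x t j) {z | z ≠ 0} := fun w hw => by
    have hk := differentiableAt_k (P := P) hw
    have hl := differentiableAt_lam (P := P) hw
    have h1 : DifferentiableAt ℂ (fun z => P.θ₁ x t z) w := by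
      unfold θ₁; fun_prop
    have h2 : DifferentiableAt ℂ (fun z => P.θ₂ x t z) w := by
      unfold θ₂; fun_prop
    have h3 : DifferentiableAt ℂ (fun z => P.Θ x t z j) w := by
      fin_cases j
      · exact h1
      · exact h2
      · exact h2
      · exact h1.neg
    exact (h3.const_mul (-Complex.I)).cexp.differentiableWithinAt
  exact h.analyticAt (isOpen_ne.mem_nhds hz)

theorem expθ_ne (x t : ℝ) (j : Fin 4) (z : ℂ) : P.expθ x t j z ≠ 0 := Complex.exp_ne_zero _

theorem Θ_mid (x t : ℝ) (z : ℂ) {m : Fin 4} (hm : m = 1 ∨ m = 2) : P.Θ x t z m = P.θ₂ x t z := by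
  rcases hm with rfl | rfl <;> rfl

theorem θ₁_inversion (hq : 0 < P.q0) (x t : ℝ) {z : ℂ} (hz : z ≠ 0) :
    P.θ₁ x t ((P.q0 : ℂ) ^ 2 / z) = -P.θ₁ x t z := by
  rw [θ₁, θ₁, k_hat hq hz, lam_hat hq hz]; ring

theorem θ₂_inversion (hq : 0 < P.q0) (x t : ℝ) {z : ℂ} (hz : z ≠ 0) :
    P.θ₂ x t ((P.q0 : ℂ) ^ 2 / z) = P.θ₂ x t z := by
  rw [θ₂, θ₂, k_hat hq hz, lam_hat hq hz]; ring

theorem expθ_zero_eq_expm (x t : ℝ) (z : ℂ) {m : Fin 4} (hm : m = 1 ∨ m = 2) :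
    P.expθ x t 0 z = P.expm x t z * P.expθ x t m z := by
  rw [expθ, expθ, expm, ← Complex.exp_add, Θ_mid x t z hm]
  congr 1
  simp [Θ]
  ring

theorem expθ_mid_eq_expp (x t : ℝ) (z : ℂ) {m : Fin 4} (hm : m = 1 ∨ m = 2) :
    P.expθ x t m z = P.expp x t z * P.expθ x t 0 z := by
  rw [expθ, expθ, expp, ← Complex.exp_add, Θ_mid x t z hm]
  congr 1
  simp [Θ]
  ring

theorem expθ_inversion_zero (hq : 0 < P.q0) (x t : ℝ) {z : ℂ} (hz : z ≠ 0) :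
    P.expθ x t 3 ((P.q0 : ℂ) ^ 2 / z) = P.expθ x t 0 z := by
  simp [expθ, Θ, θ₁_inversion hq x t hz]

theorem expθ_inversion_mid (hq : 0 < P.q0) (x t : ℝ) {z : ℂ} (hz : z ≠ 0) {m : Fin 4}
    (hm : m = 1 ∨ m = 2) : P.expθ x t m ((P.q0 : ℂ) ^ 2 / z) = P.expθ x t m z := by
  rw [expθ, expθ, Θ_mid _ _ _ hm, Θ_mid _ _ _ hm, θ₂_inversion hq x t hz]

theorem star_mem_lower {z : ℂ} (hz : z ∈ upper) : star z ∈ lower := by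
  have hz : 0 < z.im := hz
  show (star z).im < 0
  rw [Complex.star_def, Complex.conj_im]; linarith

theorem ne_zero_of_mem_lower {z : ℂ} (hz : z ∈ lower) : z ≠ 0 := by
  rintro rfl; simp [lower] at hz

theorem G_mulVec_ne (hsol : P.IsSolution) (x t : ℝ) (k : ℂ) {v : Fin 4 → ℂ} (hv : v ≠ 0) :
    (P.G x t k).mulVec v ≠ 0 := by
  intro h
  apply hv
  rw [← Matrix.one_mulVec v, ← hsol.Ginv_mul_G x t k, ← Matrix.mulVec_mulVec, h,
    Matrix.mulVec_zero]

namespace UpperData.IsSimpleZero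

variable {D : UpperData P} {m : Fin 4} {z : ℂ}

theorem eq_oth {n m : Fin 4} (hn : n = 1 ∨ n = 2) (hm : m = 1 ∨ m = 2) (h : n ≠ m) : n = oth m := by
  rcases hn with rfl | rfl <;> rcases hm with rfl | rfl <;> simp [oth] at h ⊢

/-- If the denominator `p n n` vanishes, the quotient is rewritten as `ψ^n / p3`. -/
theorem regular_χ (hsol : P.IsSolution) (h : D.IsSimpleZero m z) (x t : ℝ) {n : Fin 4}
    (hn : n = 1 ∨ n = 2) : HasPrincipalPart
      (fun w => (D.p n n w)⁻¹ • (P.G x t (P.k w)).mulVec (D.χ n w)) z 0 := by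
  have hp := (D.hol_p n n hn hn).analyticAt h.mem
  by_cases hnm : n = m
  · exact hasPrincipalPart_inv_smul_zero hp ((holUp_G_mulVec hsol x t (D.hol_χ n hn)).analyticAt h.mem)
      (by rw [hnm]; exact h.p_ne)
  · refine hasPrincipalPart_of_smul_eq (D.hol_p3.analyticAt h.mem)
      ((holUp_G_mulVec hsol x t (D.hol_ψ n hn)).analyticAt h.mem) h.p3_ne
      (eventually_ne_zero_of_deriv_ne_zero hp ?_) ?_
    · rw [eq_oth hn h.index hnm]; exact h.deriv_p_oth
    · filter_upwards [mem_nhdsWithin_of_mem_nhds (isOpen_upper.mem_nhds h.mem)] with w hw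
      rw [← Matrix.mulVec_smul, D.p3_smul_χ h.off hn hw, Matrix.mulVec_smul]

theorem regular_ψ (hsol : P.IsSolution) (h : D.IsSimpleZero m z) (x t : ℝ) {n : Fin 4}
    (hn : n = 1 ∨ n = 2) : HasPrincipalPart
      (fun w => (D.p3 w)⁻¹ • (P.G x t (P.k w)).mulVec (D.ψ n w)) z 0 :=
  hasPrincipalPart_inv_smul_zero (D.hol_p3.analyticAt h.mem)
    ((holUp_G_mulVec hsol x t (D.hol_ψ n hn)).analyticAt h.mem) h.p3_ne

theorem regular_χ_hat (hsol : P.IsSolution) (hbc : P.HasNZBC) (h : D.IsSimpleZero m z) (x t : ℝ)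
    {n : Fin 4} (hn : n = 1 ∨ n = 2) (hnm : n ≠ m) : HasPrincipalPart
      (fun w => (D.p n n w)⁻¹ • (P.G x t (P.k w)).mulVec (D.χ n w)) (P.hat z) 0 :=
  hasPrincipalPart_inv_smul_zero ((D.hol_p n n hn hn).analyticAt (h.hat_mem hbc))
    ((holUp_G_mulVec hsol x t (D.hol_χ n hn)).analyticAt (h.hat_mem hbc))
    (by rw [eq_oth hn h.index hnm]; exact h.p_oth_hat_ne)

/-- The denominator `p3` vanishes at `ẑ`, and the quotient is rewritten as `χ^n / p n n`. -/
theorem regular_ψ_hat (hsol : P.IsSolution) (hbc : P.HasNZBC) (h : D.IsSimpleZero m z) (x t : ℝ)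
    {n : Fin 4} (hn : n = 1 ∨ n = 2) (hnm : n ≠ m) : HasPrincipalPart
      (fun w => (D.p3 w)⁻¹ • (P.G x t (P.k w)).mulVec (D.ψ n w)) (P.hat z) 0 := by
  have hz := h.hat_mem hbc
  refine hasPrincipalPart_of_smul_eq ((D.hol_p n n hn hn).analyticAt hz)
    ((holUp_G_mulVec hsol x t (D.hol_χ n hn)).analyticAt hz)
    (by rw [eq_oth hn h.index hnm]; exact h.p_oth_hat_ne)
    (eventually_ne_zero_of_deriv_ne_zero (D.hol_p3.analyticAt hz) (h.deriv_p3_hat hbc)) ?_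
  filter_upwards [mem_nhdsWithin_of_mem_nhds (isOpen_upper.mem_nhds hz)] with w hw
  rw [← Matrix.mulVec_smul, ← D.p3_smul_χ h.off hn hw, Matrix.mulVec_smul]

end UpperData.IsSimpleZero

namespace UpperData

variable (D : UpperData P) {z : ℂ}

theorem colP_one_eq (hsol : P.IsSolution) (hbc : P.HasNZBC) (x t : ℝ) {w : ℂ} (hw : w ∈ upper) :
    P.colP x t 1 w = (D.p 1 1 w)⁻¹ • (P.G x t (P.k w)).mulVec (D.χ 1 w) := by
  have h1 := D.pmin_eq hbc (Or.inl rfl : (1 : Fin 4) = 1 ∨ (1 : Fin 4) = 2)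
    (Or.inl rfl : (1 : Fin 4) = 1 ∨ (1 : Fin 4) = 2) hw
  rw [← h1]
  exact congrArg (fun v => (P.minorUp ![0, 1] ![0, 1] w)⁻¹ • v) (D.χp2_eq hsol hbc x t hw)

theorem colP_two_eq (hsol : P.IsSolution) (hbc : P.HasNZBC) (x t : ℝ) {w : ℂ} (hw : w ∈ upper) :
    P.colP x t 2 w = (D.p3 w)⁻¹ • (P.G x t (P.k w)).mulVec (D.ψ 2 w) := by
  rw [← D.A123_eq hbc hw]
  exact congrArg (fun v => (P.A123 w)⁻¹ • v) (D.χp3_eq hsol hbc x t hw)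

theorem colM_one_eq (hsol : P.IsSolution) (hbc : P.HasNZBC) (x t : ℝ) {w : ℂ} (hw : w ∈ lower) :
    P.colM x t 1 w = (D.p3 ((P.q0 : ℂ) ^ 2 / w))⁻¹ •
      (P.G x t (P.k ((P.q0 : ℂ) ^ 2 / w))).mulVec (D.ψ 1 ((P.q0 : ℂ) ^ 2 / w)) := by
  have hρ : P.qp / P.qm ≠ 0 := star_ne_zero.1 (IsSimpleZero.ρ_ne hbc)
  show (P.A234 w)⁻¹ • P.χm2 x t w = _
  rw [D.A234_eq hsol hbc hw, D.χm2_eq hsol hbc x t hw, k_hat hbc.q0_pos (ne_zero_of_mem_lower hw)]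
  simp only
  rw [mul_inv, smul_smul, mul_right_comm, inv_mul_cancel₀ hρ, one_mul]

theorem colM_two_eq (hsol : P.IsSolution) (hbc : P.HasNZBC) (x t : ℝ) {w : ℂ} (hw : w ∈ lower) :
    P.colM x t 2 w = (D.p 2 2 ((P.q0 : ℂ) ^ 2 / w))⁻¹ •
      (P.G x t (P.k ((P.q0 : ℂ) ^ 2 / w))).mulVec (D.χ 2 ((P.q0 : ℂ) ^ 2 / w)) := by
  have hρ : P.qp / P.qm ≠ 0 := star_ne_zero.1 (IsSimpleZero.ρ_ne hbc)
  show (P.A34 w)⁻¹ • P.χm3 x t w = _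
  rw [D.A34_eq hsol hbc hw, D.χm3_eq hsol hbc x t hw, k_hat hbc.q0_pos (ne_zero_of_mem_lower hw)]
  simp only
  rw [mul_inv, smul_smul, mul_right_comm, inv_mul_cancel₀ hρ, one_mul]

namespace IsSimpleZero

variable {D} {m : Fin 4}

theorem colP_regular (hsol : P.IsSolution) (hbc : P.HasNZBC) (h : D.IsSimpleZero m z) (x t : ℝ)
    (j : Fin 4) (hj : j ≠ 0) : HasPrincipalPart (P.colP x t j) z 0 := by
  have hn := mem_nhdsWithin_of_mem_nhds (t := {z}ᶜ) (isOpen_upper.mem_nhds h.mem)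
  fin_cases j
  · exact absurd rfl hj
  · exact (h.regular_χ hsol x t (Or.inl rfl)).congr (by
      filter_upwards [hn] with w hw using D.colP_one_eq hsol hbc x t hw)
  · exact (h.regular_ψ hsol x t (Or.inr rfl)).congr (by
      filter_upwards [hn] with w hw using D.colP_two_eq hsol hbc x t hw)
  · exact AnalyticAt.hasPrincipalPart (analyticAt_upperExt h.mem)

theorem colP_regular_hat (hsol : P.IsSolution) (hbc : P.HasNZBC) (h : D.IsSimpleZero m z)
    (x t : ℝ) (j : Fin 4) (hj : j ≠ m) : HasPrincipalPart (P.colP x t j) (P.hat z) 0 := by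
  have hz := h.hat_mem hbc
  have hn := mem_nhdsWithin_of_mem_nhds (t := {P.hat z}ᶜ) (isOpen_upper.mem_nhds hz)
  fin_cases j
  · refine hasPrincipalPart_inv_smul_zero (analyticAt_upperExt hz) (analyticAt_upperExt hz) ?_
    have := h.p1_hat_ne
    rw [← D.A1_eq hbc hz] at this
    exact this
  · exact (h.regular_χ_hat hsol hbc x t (Or.inl rfl) hj).congr (by
      filter_upwards [hn] with w hw using D.colP_one_eq hsol hbc x t hw)
  · exact (h.regular_ψ_hat hsol hbc x t (Or.inr rfl) hj).congr (by
      filter_upwards [hn] with w hw using D.colP_two_eq hsol hbc x t hw)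
  · exact AnalyticAt.hasPrincipalPart (analyticAt_upperExt hz)

theorem A4_star_ne (hsol : P.IsSolution) (hbc : P.HasNZBC) (h : D.IsSimpleZero m z) :
    P.A4 (star z) ≠ 0 := by
  rw [D.A4_eq hsol hbc (star_mem_lower h.mem)]
  exact mul_ne_zero (star_ne_zero.1 (ρ_ne hbc)) h.p1_hat_ne

theorem colM_regular (hsol : P.IsSolution) (hbc : P.HasNZBC) (h : D.IsSimpleZero m z) (x t : ℝ)
    (j : Fin 4) (hj : j ≠ m) : HasPrincipalPart (P.colM x t j) (star z) 0 := by
  have hz := star_mem_lower h.mem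
  have hz0 := ne_zero_of_mem_lower hz
  have hn := mem_nhdsWithin_of_mem_nhds (t := {star z}ᶜ) (isOpen_lower.mem_nhds hz)
  fin_cases j
  · exact AnalyticAt.hasPrincipalPart (analyticAt_lowerExt hz)
  · exact (HasPrincipalPart.inversion_zero hbc.q0_pos hz0
      (h.regular_ψ_hat hsol hbc x t (Or.inl rfl) hj)).congr (by
      filter_upwards [hn] with w hw using D.colM_one_eq hsol hbc x t hw)
  · exact (HasPrincipalPart.inversion_zero hbc.q0_pos hz0
      (h.regular_χ_hat hsol hbc x t (Or.inr rfl) hj)).congr (by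
      filter_upwards [hn] with w hw using D.colM_two_eq hsol hbc x t hw)
  · exact hasPrincipalPart_inv_smul_zero (analyticAt_lowerExt hz) (analyticAt_lowerExt hz)
      (h.A4_star_ne hsol hbc)

theorem colM_regular_hat (hsol : P.IsSolution) (hbc : P.HasNZBC) (h : D.IsSimpleZero m z)
    (x t : ℝ) (j : Fin 4) (hj : j ≠ 3) :
    HasPrincipalPart (P.colM x t j) (star (P.hat z)) 0 := by
  have hz := star_mem_lower (h.hat_mem hbc)
  have hz0 := ne_zero_of_mem_lower hz
  have hn := mem_nhdsWithin_of_mem_nhds (t := {star (P.hat z)}ᶜ) (isOpen_lower.mem_nhds hz)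
  have hhat : (P.q0 : ℂ) ^ 2 / star (P.hat z) = z := h.hat_hat hbc
  fin_cases j
  · exact AnalyticAt.hasPrincipalPart (analyticAt_lowerExt hz)
  · exact (HasPrincipalPart.inversion_zero hbc.q0_pos hz0
      (by rw [hhat]; exact h.regular_ψ hsol x t (Or.inl rfl))).congr (by
      filter_upwards [hn] with w hw using D.colM_one_eq hsol hbc x t hw)
  · exact (HasPrincipalPart.inversion_zero hbc.q0_pos hz0
      (by rw [hhat]; exact h.regular_χ hsol x t (Or.inr rfl))).congr (by
      filter_upwards [hn] with w hw using D.colM_two_eq hsol hbc x t hw)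
  · exact absurd rfl hj

end IsSimpleZero

end UpperData

end Potential

end

end VNLS

/-! ### Discrete eigenvalues of types I and IV -/

namespace VNLS

noncomputable section

attribute [local instance] Matrix.linftyOpNormedRing Matrix.linftyOpNormedAlgebra

namespace Potential

variable {P : Potential} {z : ℂ}

theorem deriv_eq_of_eqOn {f g : ℂ → ℂ} {U : Set ℂ} (hU : IsOpen U) (h : Set.EqOn f g U)
    (hz : z ∈ U) : deriv f z = deriv g z :=
  (eventuallyEq_of_mem (hU.mem_nhds hz) h).deriv_eq

theorem eventually_Mp_apply (hminors : P.NonPrincipalMinorsVanish) (hz : z ∈ upper) (x t : ℝ) :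
    ∀ᶠ w in 𝓝 z, ∀ i j, P.Mp x t w i j = P.colP x t j w i * P.expθ x t j w := by
  filter_upwards [isOpen_upper.mem_nhds hz] with w hw i j
  exact Mp_apply (hminors.1 w hw).1 x t i j

theorem eventually_Mm_apply (hminors : P.NonPrincipalMinorsVanish) (hz : z ∈ lower) (x t : ℝ) :
    ∀ᶠ w in 𝓝 z, ∀ i j, P.Mm x t w i j = P.colM x t j w i * P.expθ x t j w := by
  filter_upwards [isOpen_lower.mem_nhds hz] with w hw i j
  exact Mm_apply (hminors.2 w hw).1 x t i j

namespace UpperData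

variable (D : UpperData P)

theorem off_diagonal (hbc : P.HasNZBC) (hminors : P.NonPrincipalMinorsVanish) :
    ∀ w ∈ upper, D.p 1 2 w = 0 ∧ D.p 2 1 w = 0 := by
  have h1 : (1 : Fin 4) = 1 ∨ (1 : Fin 4) = 2 := Or.inl rfl
  have h2 : (2 : Fin 4) = 1 ∨ (2 : Fin 4) = 2 := Or.inr rfl
  intro w hw
  rw [← D.pmin_eq hbc h1 h2 hw, ← D.pmin_eq hbc h2 h1 hw]
  exact ⟨(hminors.1 w hw).2, (hminors.1 w hw).1⟩

theorem isSimpleZero_of_isTypeI (hbc : P.HasNZBC) (hminors : P.NonPrincipalMinorsVanish)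
    (h : P.IsTypeI z) : D.IsSimpleZero 1 z := by
  obtain ⟨hz, h1, h2, h3, h4⟩ := h
  refine ⟨hz, D.off_diagonal hbc hminors, Or.inl rfl, ?_, ?_, ?_, ?_⟩
  · rw [← D.A1_eq hbc hz, h1]
  · rwa [← deriv_eq_of_eqOn isOpen_upper (D.A1_eq hbc) hz]
  · rw [← D.pmin_eq hbc (Or.inl rfl) (Or.inl rfl) hz]; exact h3
  · rwa [← D.A123_eq hbc hz]

/-- Since `p 1 1` vanishes at an eigenvalue of type IV, `p 2 2` does not: otherwise the product `p 1
1 * p 2 2 = p1 * p3` would have a double zero. -/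
theorem isSimpleZero_of_isTypeIV (hbc : P.HasNZBC) (hminors : P.NonPrincipalMinorsVanish)
    (h : P.IsTypeIV z) : D.IsSimpleZero 2 z := by
  obtain ⟨hz, h1, h2, h3, h4⟩ := h
  have i1 : (1 : Fin 4) = 1 ∨ (1 : Fin 4) = 2 := Or.inl rfl
  have i2 : (2 : Fin 4) = 1 ∨ (2 : Fin 4) = 2 := Or.inr rfl
  have hoff := D.off_diagonal hbc hminors
  rw [D.A1_eq hbc hz] at h1
  rw [deriv_eq_of_eqOn isOpen_upper (D.A1_eq hbc) hz] at h2
  rw [D.A123_eq hbc hz] at h4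
  have h3 : D.p 1 1 z = 0 := by rw [← D.pmin_eq hbc i1 i1 hz]; exact h3
  refine ⟨hz, hoff, i2, h1, h2, fun h0 => ?_, h4⟩
  have d1 := ((D.hol_p1.analyticAt hz).differentiableAt).hasDerivAt
  have d3 := ((D.hol_p3.analyticAt hz).differentiableAt).hasDerivAt
  have dp := (((D.hol_p 1 1 i1 i1).analyticAt hz).differentiableAt).hasDerivAt
  have dp' := (((D.hol_p 2 2 i2 i2).analyticAt hz).differentiableAt).hasDerivAt
  have e1 := (d1.mul d3).congr_of_eventuallyEq (f₁ := fun w => D.p 1 1 w * D.p 2 2 w) (by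
    filter_upwards [isOpen_upper.mem_nhds hz] with w hw
    exact D.p_mul hoff i1 hw)
  have e2 := (dp.fun_mul dp').unique e1
  rw [h0, h1, h3, mul_zero, zero_mul, zero_mul, add_zero, add_zero] at e2
  exact mul_ne_zero h2 h4 e2.symm

variable {D} {m : Fin 4}

namespace IsSimpleZero

theorem φm1_ne (hsol : P.IsSolution) (hbc : P.HasNZBC) (h : D.IsSimpleZero m z) (x t : ℝ) :
    P.φm1 x t z ≠ 0 := by
  rw [D.φm1_eq hsol hbc x t h.mem]
  exact G_mulVec_ne hsol x t _ (D.a_ne z h.mem)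

theorem φm4_ne (hsol : P.IsSolution) (hbc : P.HasNZBC) (h : D.IsSimpleZero m z) (x t : ℝ) :
    P.φm4 x t (star (P.hat z)) ≠ 0 := by
  have hz := star_mem_lower (h.hat_mem hbc)
  have hq' : (P.q0 : ℂ) ≠ 0 := Complex.ofReal_ne_zero.2 hbc.q0_pos.ne'
  have hhat : (P.q0 : ℂ) ^ 2 / star (P.hat z) = z := h.hat_hat hbc
  rw [D.φm4_eq hsol hbc x t hz]
  simp only [hhat]
  exact smul_ne_zero (inv_ne_zero (div_ne_zero (mul_ne_zero (mul_ne_zero Complex.I_ne_zero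
    (ne_zero_of_norm hbc.q0_pos hbc.norm_qm)) (ne_zero_of_mem_lower hz)) (pow_ne_zero 2 hq')))
    (G_mulVec_ne hsol x t _ (D.a_ne z h.mem))

/-- `φ_{-,4}` at `ẑ^*` is the pull-back of `a`, and so inherits its relations at `z`. The factor
`q_+ / q_-` is the one in the pull-backs `χ₂⁻`, `χ₃⁻`. -/
theorem exists_φm4_eq (hsol : P.IsSolution) (hbc : P.HasNZBC) (h : D.IsSimpleZero m z)
    {u : Fin 4 → ℂ} (hu : ∃ c : ℂ, D.a z = c • u) : ∃ c : ℂ, ∀ x t : ℝ,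
      P.φm4 x t (star (P.hat z)) =
        c • (P.qp / P.qm) • (P.G x t (P.k (star (P.hat z)))).mulVec u := by
  have hz := star_mem_lower (h.hat_mem hbc)
  have hhat : (P.q0 : ℂ) ^ 2 / star (P.hat z) = z := h.hat_hat hbc
  have hρ : P.qp / P.qm ≠ 0 := star_ne_zero.1 (ρ_ne hbc)
  obtain ⟨c, hc⟩ := hu
  refine ⟨(Complex.I * P.qm * star (P.hat z) / (P.q0 : ℂ) ^ 2)⁻¹ * c * (P.qp / P.qm)⁻¹,
    fun x t => ?_⟩
  rw [D.φm4_eq hsol hbc x t hz]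
  simp only [hhat]
  rw [hc, Matrix.mulVec_smul, smul_smul, smul_smul, inv_mul_cancel_right₀ hρ]

/-- Multiples of `φ_{+,4}` at `ẑ` are multiples of `φ_{+,1}` at `z^*`. -/
theorem exists_eq_φp1 (hsol : P.IsSolution) (hbc : P.HasNZBC) (h : D.IsSimpleZero m z)
    {u : Fin 4 → ℂ} (hu : ∃ c : ℂ, u = c • D.b (P.hat z)) : ∃ c : ℂ, ∀ x t : ℝ,
      (P.qp / P.qm) • (P.G x t (P.k (star z))).mulVec u = c • P.φp1 x t (star z) := by
  have hz := star_mem_lower h.mem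
  have hhat : (P.q0 : ℂ) ^ 2 / star z = P.hat z := rfl
  have hs : Complex.I * P.qp / star z ≠ 0 := div_ne_zero (mul_ne_zero Complex.I_ne_zero
    (ne_zero_of_norm hbc.q0_pos hbc.norm_qp)) (ne_zero_of_mem_lower hz)
  obtain ⟨c, hc⟩ := hu
  refine ⟨P.qp / P.qm * c * (Complex.I * P.qp / star z)⁻¹, fun x t => ?_⟩
  rw [D.φp1_eq hsol hbc x t hz]
  simp only [hhat]
  rw [hc, Matrix.mulVec_smul, smul_smul, smul_smul, inv_mul_cancel_right₀ hs]

end IsSimpleZero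

end UpperData

open UpperData

theorem typeI (hsol : P.IsSolution) (hbc : P.HasNZBC) (hminors : P.NonPrincipalMinorsVanish)
    (hz : P.IsTypeI z) : ∃ d dcheck dbar dhat : ℂ,
      P.NormingI z d dcheck dbar dhat ∧
      ∀ x t : ℝ,
        HasSimplePole (P.Mp x t) z
          (singleCol 0 ((d / deriv P.A1 z * P.expm x t z) • (P.Mp x t z).col 1)) ∧
        HasSimplePole (P.Mp x t) (P.hat z)
          (singleCol 1 ((dhat / deriv P.A12 (P.hat z) * P.expp x t (star z)) •
              (P.Mp x t (P.hat z)).col 3)) ∧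
        HasSimplePole (P.Mm x t) (star z)
          (singleCol 1 ((dbar / deriv P.A234 (star z) * P.expp x t (star z)) •
              (P.Mm x t (star z)).col 0)) ∧
        HasSimplePole (P.Mm x t) (star (P.hat z))
          (singleCol 3 ((dcheck * P.A234 (star (P.hat z)) / deriv P.A4 (star (P.hat z)) *
            P.expm x t z) • (P.Mm x t (star (P.hat z))).col 1)) := by
  obtain ⟨D⟩ := exists_upperData hsol hbc
  have h := D.isSimpleZero_of_isTypeI hbc hminors hz
  obtain ⟨hzu, hA1, hA1', hA12, -⟩ := hz
  have i1 : (1 : Fin 4) = 1 ∨ (1 : Fin 4) = 2 := Or.inl rfl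
  have hq := hbc.q0_pos
  have hρ : P.qp / P.qm ≠ 0 := star_ne_zero.1 (IsSimpleZero.ρ_ne hbc)
  have hzh := h.hat_mem hbc
  have hzs := star_mem_lower hzu
  have hzhs := star_mem_lower hzh
  have hz0 := (upper_subset_regular (P := P) hzu).1
  have hzh0 := (upper_subset_regular (P := P) hzh).1
  have hzs0 := ne_zero_of_mem_lower hzs
  have hzhs0 := ne_zero_of_mem_lower hzhs
  have e1 : (P.q0 : ℂ) ^ 2 / star (P.hat z) = z := h.hat_hat hbc
  have e2 : (P.q0 : ℂ) ^ 2 / star z = P.hat z := rfl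
  have hχm2 : ∀ x t, P.χm2 x t (star (P.hat z)) =
      (P.qp / P.qm) • (P.G x t (P.k (star (P.hat z)))).mulVec (D.ψ 1 z) := fun x t => by
    rw [D.χm2_eq hsol hbc x t hzhs]; simp only [e1]
  have hχm2' : ∀ x t, P.χm2 x t (star z) =
      (P.qp / P.qm) • (P.G x t (P.k (star z))).mulVec (D.ψ 1 (P.hat z)) := fun x t => by
    rw [D.χm2_eq hsol hbc x t hzs]; rfl
  obtain ⟨c, hc⟩ := h.exists_a_eq_χ
  obtain ⟨dcheck, hcheck⟩ := h.exists_φm4_eq hsol hbc h.exists_a_eq_ψ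
  obtain ⟨dbar, hbar⟩ := h.exists_eq_φp1 hsol hbc (h.exists_ψ_hat_eq hbc)
  obtain ⟨dhat, hhat⟩ := h.exists_χ_hat_eq hbc
  have hN : P.NormingI z (c * P.A12 z) dcheck dbar dhat := by
    refine ⟨fun x t => ?_, fun x t => ?_, fun x t => ?_, fun x t => ?_⟩
    · rw [mul_div_cancel_right₀ _ hA12, D.φm1_eq hsol hbc x t hzu, D.χp2_eq hsol hbc x t hzu]
      simp only
      rw [hc, Matrix.mulVec_smul]
    · rw [hcheck, hχm2]
    · rw [hχm2', hbar]
    · rw [D.χp2_eq hsol hbc x t hzh, D.φp4_eq hsol hbc x t hzh]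
      simp only
      rw [hhat, Matrix.mulVec_smul]
  refine ⟨c * P.A12 z, dcheck, dbar, dhat, hN, fun x t => ⟨?_, ?_, ?_, ?_⟩⟩
  · refine hasSimplePole_of_proportional (eventually_Mp_apply hminors hzu x t)
      (fun j => analyticAt_expθ x t j hz0) (fun j => expθ_ne x t j z) 0 1 rfl
      (analyticAt_upperExt hzu) (analyticAt_upperExt hzu) hA1 hA1'
      (h.colP_regular hsol hbc x t) (h.φm1_ne hsol hbc x t) ?_ (expθ_zero_eq_expm x t z i1)
    rw [hN.main, div_eq_mul_inv, mul_smul]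
    rfl
  · refine hasSimplePole_of_proportional (eventually_Mp_apply hminors hzh x t)
      (fun j => analyticAt_expθ x t j hzh0) (fun j => expθ_ne x t j _) 1 3 rfl
      (analyticAt_upperExt hzh) (analyticAt_upperExt hzh)
      ((D.pmin_eq hbc i1 i1 hzh).trans (h.p_hat_eq hbc)) ?_
      (h.colP_regular_hat hsol hbc x t) ?_ (hN.hat x t) ?_
    · have := h.deriv_p_hat hbc
      rwa [← deriv_eq_of_eqOn isOpen_upper (D.pmin_eq hbc i1 i1) hzh] at this
    · rw [D.χp2_eq hsol hbc x t hzh]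
      exact G_mulVec_ne hsol x t _ (h.χ_hat_ne hbc)
    · rw [← e2, expθ_inversion_mid hq x t hzs0 i1, expθ_inversion_zero hq x t hzs0,
        expθ_mid_eq_expp x t _ i1]
  · refine hasSimplePole_of_proportional (eventually_Mm_apply hminors hzs x t)
      (fun j => analyticAt_expθ x t j hzs0) (fun j => expθ_ne x t j _) 1 0 rfl
      (analyticAt_lowerExt hzs) (analyticAt_lowerExt hzs) ?_ ?_
      (h.colM_regular hsol hbc x t) ?_ (hN.bar x t) (expθ_mid_eq_expp x t _ i1)
    · refine (D.A234_eq hsol hbc hzs).trans ?_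
      simp only [e2]
      rw [h.p3_hat_eq hbc, mul_zero]
    · exact deriv_inversion_ne_zero hq hzs hρ (D.A234_eq hsol hbc)
        (D.hol_p3.analyticAt hzh).differentiableAt (h.deriv_p3_hat hbc)
    · rw [hχm2']
      exact smul_ne_zero hρ (G_mulVec_ne hsol x t _ (h.ψ_hat_ne hbc))
  · have hA234 : P.A234 (star (P.hat z)) ≠ 0 := by
      rw [D.A234_eq hsol hbc hzhs]
      simp only [e1]
      exact mul_ne_zero hρ h.p3_ne
    refine hasSimplePole_of_proportional (eventually_Mm_apply hminors hzhs x t)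
      (fun j => analyticAt_expθ x t j hzhs0) (fun j => expθ_ne x t j _) 3 1 rfl
      (analyticAt_lowerExt hzhs) (analyticAt_lowerExt hzhs) ?_ ?_
      (h.colM_regular_hat hsol hbc x t) (h.φm4_ne hsol hbc x t) ?_ ?_
    · refine (D.A4_eq hsol hbc hzhs).trans ?_
      simp only [e1]
      rw [h.p1_eq, mul_zero]
    · exact deriv_inversion_ne_zero hq hzhs hρ (D.A4_eq hsol hbc)
        (by rw [e1]; exact (D.hol_p1.analyticAt hzu).differentiableAt)
        (by rw [e1]; exact h.deriv_p1)
    · show P.φm4 x t (star (P.hat z)) = (dcheck * P.A234 (star (P.hat z))) •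
        (P.A234 (star (P.hat z)))⁻¹ • P.χm2 x t (star (P.hat z))
      rw [hN.check, mul_smul, smul_inv_smul₀ hA234]
    · have e3 : star (P.hat z) = (P.q0 : ℂ) ^ 2 / z := by simp [hat]
      rw [e3, expθ_inversion_zero hq x t hz0, expθ_inversion_mid hq x t hz0 i1,
        expθ_zero_eq_expm x t z i1]

theorem typeIV (hsol : P.IsSolution) (hbc : P.HasNZBC) (hminors : P.NonPrincipalMinorsVanish)
    (hz : P.IsTypeIV z) : ∃ c ccheck cbar chat : ℂ,
      P.NormingIV z c ccheck cbar chat ∧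
      ∀ x t : ℝ,
        HasSimplePole (P.Mp x t) z
          (singleCol 0 ((c / deriv P.A1 z * P.expm x t z) • (P.Mp x t z).col 2)) ∧
        HasSimplePole (P.Mp x t) (P.hat z)
          (singleCol 2 ((chat / deriv P.A123 (P.hat z) * P.expp x t (star z)) •
              (P.Mp x t (P.hat z)).col 3)) ∧
        HasSimplePole (P.Mm x t) (star z)
          (singleCol 2 ((cbar / deriv P.A34 (star z) * P.expp x t (star z)) •
              (P.Mm x t (star z)).col 0)) ∧
        HasSimplePole (P.Mm x t) (star (P.hat z))
          (singleCol 3 ((ccheck * P.A34 (star (P.hat z)) / deriv P.A4 (star (P.hat z)) *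
            P.expm x t z) • (P.Mm x t (star (P.hat z))).col 2)) := by
  obtain ⟨D⟩ := exists_upperData hsol hbc
  have h := D.isSimpleZero_of_isTypeIV hbc hminors hz
  obtain ⟨hzu, hA1, hA1', -, hA123⟩ := hz
  have i2 : (2 : Fin 4) = 1 ∨ (2 : Fin 4) = 2 := Or.inr rfl
  have hq := hbc.q0_pos
  have hρ : P.qp / P.qm ≠ 0 := star_ne_zero.1 (IsSimpleZero.ρ_ne hbc)
  have hzh := h.hat_mem hbc
  have hzs := star_mem_lower hzu
  have hzhs := star_mem_lower hzh
  have hz0 := (upper_subset_regular (P := P) hzu).1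
  have hzh0 := (upper_subset_regular (P := P) hzh).1
  have hzs0 := ne_zero_of_mem_lower hzs
  have hzhs0 := ne_zero_of_mem_lower hzhs
  have e1 : (P.q0 : ℂ) ^ 2 / star (P.hat z) = z := h.hat_hat hbc
  have e2 : (P.q0 : ℂ) ^ 2 / star z = P.hat z := rfl
  have hχm3 : ∀ x t, P.χm3 x t (star (P.hat z)) =
      (P.qp / P.qm) • (P.G x t (P.k (star (P.hat z)))).mulVec (D.χ 2 z) := fun x t => by
    rw [D.χm3_eq hsol hbc x t hzhs]; simp only [e1]
  have hχm3' : ∀ x t, P.χm3 x t (star z) =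
      (P.qp / P.qm) • (P.G x t (P.k (star z))).mulVec (D.χ 2 (P.hat z)) := fun x t => by
    rw [D.χm3_eq hsol hbc x t hzs]; rfl
  obtain ⟨c, hc⟩ := h.exists_a_eq_ψ
  obtain ⟨ccheck, hcheck⟩ := h.exists_φm4_eq hsol hbc h.exists_a_eq_χ
  obtain ⟨cbar, hbar⟩ := h.exists_eq_φp1 hsol hbc (h.exists_χ_hat_eq hbc)
  obtain ⟨chat, hhat⟩ := h.exists_ψ_hat_eq hbc
  have hN : P.NormingIV z (c * P.A123 z) ccheck cbar chat := by
    refine ⟨fun x t => ?_, fun x t => ?_, fun x t => ?_, fun x t => ?_⟩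
    · rw [mul_div_cancel_right₀ _ hA123, D.φm1_eq hsol hbc x t hzu, D.χp3_eq hsol hbc x t hzu]
      simp only
      rw [hc, Matrix.mulVec_smul]
    · rw [hcheck, hχm3]
    · rw [hχm3', hbar]
    · rw [D.χp3_eq hsol hbc x t hzh, D.φp4_eq hsol hbc x t hzh]
      simp only
      rw [hhat, Matrix.mulVec_smul]
  refine ⟨c * P.A123 z, ccheck, cbar, chat, hN, fun x t => ⟨?_, ?_, ?_, ?_⟩⟩
  · refine hasSimplePole_of_proportional (eventually_Mp_apply hminors hzu x t)
      (fun j => analyticAt_expθ x t j hz0) (fun j => expθ_ne x t j z) 0 2 rfl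
      (analyticAt_upperExt hzu) (analyticAt_upperExt hzu) hA1 hA1'
      (h.colP_regular hsol hbc x t) (h.φm1_ne hsol hbc x t) ?_ (expθ_zero_eq_expm x t z i2)
    rw [hN.main, div_eq_mul_inv, mul_smul]
    rfl
  · refine hasSimplePole_of_proportional (eventually_Mp_apply hminors hzh x t)
      (fun j => analyticAt_expθ x t j hzh0) (fun j => expθ_ne x t j _) 2 3 rfl
      (analyticAt_upperExt hzh) (analyticAt_upperExt hzh)
      ((D.A123_eq hbc hzh).trans (h.p3_hat_eq hbc)) ?_
      (h.colP_regular_hat hsol hbc x t) ?_ (hN.hat x t) ?_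
    · have := h.deriv_p3_hat hbc
      rwa [← deriv_eq_of_eqOn isOpen_upper (D.A123_eq hbc) hzh] at this
    · rw [D.χp3_eq hsol hbc x t hzh]
      exact G_mulVec_ne hsol x t _ (h.ψ_hat_ne hbc)
    · rw [← e2, expθ_inversion_mid hq x t hzs0 i2, expθ_inversion_zero hq x t hzs0,
        expθ_mid_eq_expp x t _ i2]
  · refine hasSimplePole_of_proportional (eventually_Mm_apply hminors hzs x t)
      (fun j => analyticAt_expθ x t j hzs0) (fun j => expθ_ne x t j _) 2 0 rfl
      (analyticAt_lowerExt hzs) (analyticAt_lowerExt hzs) ?_ ?_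
      (h.colM_regular hsol hbc x t) ?_ (hN.bar x t) (expθ_mid_eq_expp x t _ i2)
    · refine (D.A34_eq hsol hbc hzs).trans ?_
      simp only [e2]
      rw [h.p_hat_eq hbc, mul_zero]
    · exact deriv_inversion_ne_zero hq hzs hρ (D.A34_eq hsol hbc)
        ((D.hol_p 2 2 i2 i2).analyticAt hzh).differentiableAt (h.deriv_p_hat hbc)
    · rw [hχm3']
      exact smul_ne_zero hρ (G_mulVec_ne hsol x t _ (h.χ_hat_ne hbc))
  · have hA34 : P.A34 (star (P.hat z)) ≠ 0 := by
      rw [D.A34_eq hsol hbc hzhs]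
      simp only [e1]
      exact mul_ne_zero hρ h.p_ne
    refine hasSimplePole_of_proportional (eventually_Mm_apply hminors hzhs x t)
      (fun j => analyticAt_expθ x t j hzhs0) (fun j => expθ_ne x t j _) 3 2 rfl
      (analyticAt_lowerExt hzhs) (analyticAt_lowerExt hzhs) ?_ ?_
      (h.colM_regular_hat hsol hbc x t) (h.φm4_ne hsol hbc x t) ?_ ?_
    · refine (D.A4_eq hsol hbc hzhs).trans ?_
      simp only [e1]
      rw [h.p1_eq, mul_zero]
    · exact deriv_inversion_ne_zero hq hzhs hρ (D.A4_eq hsol hbc)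
        (by rw [e1]; exact (D.hol_p1.analyticAt hzu).differentiableAt)
        (by rw [e1]; exact h.deriv_p1)
    · show P.φm4 x t (star (P.hat z)) = (ccheck * P.A34 (star (P.hat z))) •
        (P.A34 (star (P.hat z)))⁻¹ • P.χm3 x t (star (P.hat z))
      rw [hN.check, mul_smul, smul_inv_smul₀ hA34]
    · have e3 : star (P.hat z) = (P.q0 : ℂ) ^ 2 / z := by simp [hat]
      rw [e3, expθ_inversion_zero hq x t hz0, expθ_inversion_mid hq x t hz0 i2,
        expθ_zero_eq_expm x t z i2]

end Potential

end

end VNLS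

theorem lemmaL (P : VNLS.Potential) (hsol : P.IsSolution) (hbc : P.HasNZBC)
    (hminors : P.NonPrincipalMinorsVanish) :
    (∀ z : ℂ, P.IsTypeI z → ∃ d dcheck dbar dhat : ℂ,
      P.NormingI z d dcheck dbar dhat ∧
      ∀ x t : ℝ,
        VNLS.HasSimplePole (P.Mp x t) z
          (VNLS.singleCol 0
            ((d / deriv P.A1 z * P.expm x t z) • (P.Mp x t z).col 1)) ∧
        VNLS.HasSimplePole (P.Mp x t) (P.hat z)
          (VNLS.singleCol 1
            ((dhat / deriv P.A12 (P.hat z) * P.expp x t (star z)) •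
              (P.Mp x t (P.hat z)).col 3)) ∧
        VNLS.HasSimplePole (P.Mm x t) (star z)
          (VNLS.singleCol 1
            ((dbar / deriv P.A234 (star z) * P.expp x t (star z)) •
              (P.Mm x t (star z)).col 0)) ∧
        VNLS.HasSimplePole (P.Mm x t) (star (P.hat z))
          (VNLS.singleCol 3
            ((dcheck * P.A234 (star (P.hat z)) / deriv P.A4 (star (P.hat z)) * P.expm x t z) •
              (P.Mm x t (star (P.hat z))).col 1))) ∧
    (∀ w : ℂ, P.IsTypeIV w → ∃ c ccheck cbar chat : ℂ,
      P.NormingIV w c ccheck cbar chat ∧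
      ∀ x t : ℝ,
        VNLS.HasSimplePole (P.Mp x t) w
          (VNLS.singleCol 0
            ((c / deriv P.A1 w * P.expm x t w) • (P.Mp x t w).col 2)) ∧
        VNLS.HasSimplePole (P.Mp x t) (P.hat w)
          (VNLS.singleCol 2
            ((chat / deriv P.A123 (P.hat w) * P.expp x t (star w)) •
              (P.Mp x t (P.hat w)).col 3)) ∧
        VNLS.HasSimplePole (P.Mm x t) (star w)
          (VNLS.singleCol 2
            ((cbar / deriv P.A34 (star w) * P.expp x t (star w)) •
              (P.Mm x t (star w)).col 0)) ∧
        VNLS.HasSimplePole (P.Mm x t) (star (P.hat w))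
          (VNLS.singleCol 3
            ((ccheck * P.A34 (star (P.hat w)) / deriv P.A4 (star (P.hat w)) * P.expm x t w) •
              (P.Mm x t (star (P.hat w))).col 2))) :=
  ⟨fun _ hz => VNLS.Potential.typeI hsol hbc hminors hz,
    fun _ hw => VNLS.Potential.typeIV hsol hbc hminors hw⟩
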